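/- A Chinese character is a finite uni-trivalent graph (multiple edges and self-loops allowed), each of whose connected components has at least one univalent vertex, with a cyclic order of the edges at each trivalent vertex; its degree is half its number of vertices. A Chinese character diagram on an oriented 1-manifold $X$ with $l$ ordered components (all intervals, called strings, or all circles) is a Chinese character with its univalent vertices placed at distinct points of $X$, up to homeomorphism preserving orientations and each component of $X$. Let $\mathcal P_l$ and $\mathcal A(\sqcup^l S^1)$ be the $\mathbb Q$-vector spaces spanned by Chinese character diagrams on $l$ strings and on $l$ circles, respectively, modulo the STU relations, and let $pr:\mathcal P_l\to\mathcal A(\sqcup^l S^1)$ be the map closing each string to a circle. For a Chinese character $\xi$ whose univalent vertices are coloured by $1,\dots,l$, with $k_i$ vertices of colour $i$, let $\chi(\xi)\in\mathcal P_l$ be $\frac1{k_1!\cdots k_l!}$ times the sum over the $k_1!\cdots k_l!$ ways of placing, for every $i$, the vertices of colour $i$ on the $i$-th string. The elements $\chi(\xi)$ span $\mathcal P_l$. Let $\overset{\circ}{\mathcal D}$ be the $\mathbb Q$-vector space spanned by vertex-oriented trivalent graphs, in which circles without vertices are allowed as components, modulo the antisymmetry and Jacobi (IHX) relations. Let $n\ge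 0$. For $\xi$ as above put $j'_n(\xi)=0$ if $k_i\ne 2n$ for some $i$ or if $\xi$ has degree greater than $(l+1)n$. Otherwise let $j'_n(\xi)\in\overset{\circ}{\mathcal D}$ be the sum, over all ways of partitioning the $2n$ univalent vertices of each colour into $n$ pairs, of the trivalent graph obtained by identifying the two vertices of each pair. Then there is a unique $\mathbb Q$-linear map $j'_n:\mathcal A(\sqcup^l S^1)\to\overset{\circ}{\mathcal D}$ with $j'_n(pr(\chi(\xi)))=j'_n(\xi)$ for all $\xi$. Moreover, for every Chinese character diagram $D$ on $l$ circles there is an integer $N\ge 1$, not divisible by any prime greater than $2n+1$, such that $N\,j'_n(D)$ is a linear combination of trivalent graphs with integer coefficients. -/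

import Mathlib

open Equiv

namespace ChineseChar

noncomputable section

open scoped Classical

/-! ### Uni-trivalent graphs -/

/-- A vertex-oriented uni-trivalent graph (a Chinese character), described by its finite set `H` of
half-edges. `opp` exchanges the two halves of each edge. `rot` sends a half-edge to the next one in
the (counterclockwise) cyclic order at its vertex, so the vertices are the cycles of `rot`: a fixed
point of `rot` is a univalent (external) vertex, a cycle of length three is an oriented trivalent
(internal) vertex. Multiple edges and edges joining a vertex to itself are allowed.
A set closed under `rot` and `opp` is a union of connected components, so `ext` says that every
connected component has at least one univalent vertex. -/
structure UTGraph where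
  H : Type
  [fin : Finite H]
  rot : Perm H
  opp : Perm H
  rot_rot_rot : ∀ h, rot (rot (rot h)) = h
  opp_opp : ∀ h, opp (opp h) = h
  opp_ne : ∀ h, opp h ≠ h
  ext : ∀ S : Set H, S.Nonempty → (∀ h ∈ S, rot h ∈ S ∧ opp h ∈ S) → ∃ h ∈ S, rot h = h

attribute [instance] UTGraph.fin

/-- The half-edge `h` ends at a univalent vertex. -/
def UTGraph.IsLeg (G : UTGraph) (h : G.H) : Prop := G.rot h = h

/-- The number of vertices: univalent ones plus trivalent ones (the division by 3 is exact). -/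
def UTGraph.numVertices (G : UTGraph) : ℕ :=
  Nat.card {h : G.H // G.IsLeg h} + Nat.card {h : G.H // ¬ G.IsLeg h} / 3

/-- Half the number of vertices (the division by 2 is exact). -/
def UTGraph.degree (G : UTGraph) : ℕ := G.numVertices / 2

/-! ### Chinese character diagrams on strings and on circles -/

/-- A Chinese character diagram on `l` ordered oriented strings: a Chinese character together with,
for each string, the list of the univalent vertices on it in the order in which they are met.
Cutting each circle at a base point, Chinese character diagrams on `l` circles are presented by the
same data. -/
structure Diagram (l : ℕ) extends UTGraph where
  word : Fin l → List H
  word_nodup : ∀ i, (word i).Nodup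
  word_disjoint : ∀ i j h, h ∈ word i → h ∈ word j → i = j
  mem_word : ∀ h, (∃ i, h ∈ word i) ↔ rot h = h

/-- Homeomorphism of diagrams on `l` strings. -/
def Diagram.StringIso {l : ℕ} (D D' : Diagram l) : Prop :=
  ∃ f : D.H ≃ D'.H, (∀ h, f (D.rot h) = D'.rot (f h)) ∧ (∀ h, f (D.opp h) = D'.opp (f h)) ∧
    ∀ i, (D.word i).map f = D'.word i

/-- Homeomorphism of diagrams on `l` circles: the order of the univalent vertices on each circle
is only cyclic, that is, the words agree up to rotation. -/
def Diagram.CircleIso {l : ℕ} (D D' : Diagram l) : Prop :=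
  ∃ f : D.H ≃ D'.H, (∀ h, f (D.rot h) = D'.rot (f h)) ∧ (∀ h, f (D.opp h) = D'.opp (f h)) ∧
    ∀ i, ((D.word i).map f).IsRotated (D'.word i)

/-- Exchange two consecutive univalent vertices `b`, `c` of the `i`-th component. -/
def Diagram.transpose {l : ℕ} (D : Diagram l) (i : Fin l) (l₁ : List D.H) (b c : D.H)
    (l₂ : List D.H) (hw : D.word i = l₁ ++ b :: c :: l₂) : Diagram l where
  toUTGraph := D.toUTGraph
  word := Function.update D.word i (l₁ ++ c :: b :: l₂)
  word_nodup := by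
    intro j
    by_cases hj : j = i
    · subst hj
      have h := D.word_nodup j
      rw [hw] at h
      rw [Function.update_self]
      refine (List.Perm.nodup_iff ?_).1 h
      exact List.Perm.append_left _ (List.Perm.swap _ _ _)
    · rw [Function.update_of_ne hj]
      exact D.word_nodup j
  word_disjoint := by
    have key : ∀ j h, h ∈ Function.update D.word i (l₁ ++ c :: b :: l₂) j ↔ h ∈ D.word j := by
      intro j h
      by_cases hj : j = i
      · subst hj
        rw [Function.update_self, hw]
        simp only [List.mem_append, List.mem_cons]
        tauto
      · rw [Function.update_of_ne hj]
    intro j k h h1 h2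
    exact D.word_disjoint j k h ((key j h).1 h1) ((key k h).1 h2)
  mem_word := by
    have key : ∀ j h, h ∈ Function.update D.word i (l₁ ++ c :: b :: l₂) j ↔ h ∈ D.word j := by
      intro j h
      by_cases hj : j = i
      · subst hj
        rw [Function.update_self, hw]
        simp only [List.mem_append, List.mem_cons]
        tauto
      · rw [Function.update_of_ne hj]
    intro h
    rw [← D.mem_word h]
    exact exists_congr fun j => key j h

/-- The vertex permutation after joining the univalent vertices `b` and `c` to a new trivalent
vertex. The new edge has the halves `inr false`, at the new trivalent vertex, and `inr true`, at a
new univalent vertex; the cyclic order at the new trivalent vertex is `(inr false, c, b)`. -/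
def fuseRot {H : Type} (r : Perm H) (b c : H) : Perm (H ⊕ Bool) :=
  Equiv.sumCongr r (1 : Perm Bool) *
    (swap (Sum.inr false) (Sum.inl c) * swap (Sum.inl c) (Sum.inl b))

theorem fuseRot_false {H : Type} (r : Perm H) {b c : H} (hc : r c = c) :
    fuseRot r b c (Sum.inr false) = Sum.inl c := by
  simp [fuseRot, Perm.mul_apply, swap_apply_def, hc]

theorem fuseRot_true {H : Type} (r : Perm H) (b c : H) :
    fuseRot r b c (Sum.inr true) = Sum.inr true := by
  simp [fuseRot, Perm.mul_apply, swap_apply_def]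

theorem fuseRot_c {H : Type} (r : Perm H) {b c : H} (hbc : b ≠ c) (hb : r b = b) :
    fuseRot r b c (Sum.inl c) = Sum.inl b := by
  simp [fuseRot, Perm.mul_apply, swap_apply_def, hb, hbc]

theorem fuseRot_b {H : Type} (r : Perm H) {b c : H} :
    fuseRot r b c (Sum.inl b) = Sum.inr false := by
  simp [fuseRot, Perm.mul_apply]

theorem fuseRot_other {H : Type} (r : Perm H) {b c h : H} (hb : h ≠ b) (hc : h ≠ c) :
    fuseRot r b c (Sum.inl h) = Sum.inl (r h) := by
  simp [fuseRot, Perm.mul_apply, swap_apply_def, hb, hc]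

/-- Given consecutive univalent vertices `b`, `c` of the `i`-th component, join them to a new
trivalent vertex whose third edge ends on the `i`-th component in place of `b`, `c`. -/
def Diagram.fuse {l : ℕ} (D : Diagram l) (i : Fin l) (l₁ : List D.H) (b c : D.H)
    (l₂ : List D.H) (hw : D.word i = l₁ ++ b :: c :: l₂) : Diagram l :=
  have hb : D.rot b = b := (D.mem_word b).1 ⟨i, by rw [hw]; simp⟩
  have hc : D.rot c = c := (D.mem_word c).1 ⟨i, by rw [hw]; simp⟩
  have hbc : b ≠ c := by
    have h := D.word_nodup i
    rw [hw] at h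
    rintro rfl
    simp [List.nodup_append] at h
  have key : ∀ j h, h ∈ Function.update (fun j => (D.word j).map Sum.inl) i
      (l₁.map Sum.inl ++ Sum.inr true :: l₂.map Sum.inl) j ↔
      (∃ g, h = Sum.inl g ∧ g ∈ D.word j ∧ g ≠ b ∧ g ≠ c) ∨
        (h = (Sum.inr true : D.H ⊕ Bool) ∧ j = i) := by
    intro j h
    by_cases hj : j = i
    · subst hj
      have hn := D.word_nodup j
      rw [hw] at hn
      simp only [List.nodup_append, List.nodup_cons, List.mem_cons, not_or] at hn
      rw [Function.update_self, hw]
      rcases h with g | _ | _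
      · simp only [List.mem_append, List.mem_map, List.mem_cons]
        grind
      · simp
      · simp
    · rw [Function.update_of_ne hj]
      have hb' : b ∉ D.word j := fun hm =>
        hj (D.word_disjoint j i b hm (by rw [hw]; simp))
      have hc' : c ∉ D.word j := fun hm =>
        hj (D.word_disjoint j i c hm (by rw [hw]; simp))
      rcases h with g | _ | _
      · simp only [List.mem_map]
        grind
      · simp
      · simp [hj]
  { H := D.H ⊕ Bool
    rot := fuseRot D.rot b c
    opp := Equiv.sumCongr D.opp (swap false true)
    rot_rot_rot := by
      rintro (h | _ | _)
      · by_cases h1 : h = b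
        · subst h1
          rw [fuseRot_b, fuseRot_false _ hc, fuseRot_c _ hbc hb]
        by_cases h2 : h = c
        · subst h2
          rw [fuseRot_c _ hbc hb, fuseRot_b, fuseRot_false _ hc]
        have e1 : ∀ k, D.rot k = b → k = b := fun k hk => D.rot.injective (hk.trans hb.symm)
        have e2 : ∀ k, D.rot k = c → k = c := fun k hk => D.rot.injective (hk.trans hc.symm)
        have h3 : D.rot h ≠ b := fun hk => h1 (e1 _ hk)
        have h4 : D.rot h ≠ c := fun hk => h2 (e2 _ hk)
        rw [fuseRot_other _ h1 h2, fuseRot_other _ h3 h4, fuseRot_other _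
          (fun hk => h3 (e1 _ hk)) (fun hk => h4 (e2 _ hk)), D.rot_rot_rot]
      · rw [fuseRot_false _ hc, fuseRot_c _ hbc hb, fuseRot_b]
      · simp only [fuseRot_true]
    opp_opp := by
      rintro (h | _ | _)
      · simp [D.opp_opp]
      · simp
      · simp
    opp_ne := by
      rintro (h | _ | _)
      · simp [D.opp_ne]
      · simp
      · simp
    ext := by
      intro S hS hcl
      by_cases ht : (Sum.inr true : D.H ⊕ Bool) ∈ S
      · exact ⟨_, ht, fuseRot_true _ _ _⟩
      have hf : (Sum.inr false : D.H ⊕ Bool) ∉ S := fun hf => ht (by simpa using (hcl _ hf).2)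
      have hb' : (Sum.inl b : D.H ⊕ Bool) ∉ S := fun h => hf (by
        have := (hcl _ h).1
        rwa [fuseRot_b] at this)
      have hc' : (Sum.inl c : D.H ⊕ Bool) ∉ S := fun h => hb' (by
        have := (hcl _ h).1
        rwa [fuseRot_c _ hbc hb] at this)
      have hne : ∀ g, Sum.inl g ∈ S → fuseRot D.rot b c (Sum.inl g) = Sum.inl (D.rot g) := by
        intro g hg
        exact fuseRot_other _ (fun h => hb' (h ▸ hg)) (fun h => hc' (h ▸ hg))
      obtain ⟨g, hg, hgr⟩ := D.ext (Sum.inl ⁻¹' S) (by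
        obtain ⟨x, hx⟩ := hS
        rcases x with g | _ | _
        · exact ⟨g, hx⟩
        · exact absurd hx hf
        · exact absurd hx ht) (by
        intro g hg
        have h := hcl _ hg
        rw [hne g hg] at h
        exact ⟨h.1, by simpa using h.2⟩)
      exact ⟨Sum.inl g, hg, by rw [hne g hg, hgr]⟩
    word := Function.update (fun j => (D.word j).map Sum.inl) i
      (l₁.map Sum.inl ++ Sum.inr true :: l₂.map Sum.inl)
    word_nodup := by
      intro j
      by_cases hj : j = i
      · subst hj
        have hn := D.word_nodup j
        rw [hw] at hn
        rw [Function.update_self]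
        simp only [List.nodup_append, List.nodup_cons, List.mem_cons, not_or] at hn ⊢
        refine ⟨hn.1.map Sum.inl_injective, ⟨by simp, hn.2.1.2.2.map Sum.inl_injective⟩, ?_⟩
        simp only [List.mem_map]
        grind
      · rw [Function.update_of_ne hj]
        exact (D.word_nodup j).map Sum.inl_injective
    word_disjoint := by
      intro j k h h1 h2
      rcases (key j h).1 h1 with ⟨g, rfl, hg, -, -⟩ | ⟨rfl, rfl⟩
      · rcases (key k _).1 h2 with ⟨g', hgg, hg', -, -⟩ | ⟨hh, -⟩
        · cases hgg
          exact D.word_disjoint j k g hg hg'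
        · cases hh
      · rcases (key k _).1 h2 with ⟨g', hgg, -, -, -⟩ | ⟨-, hk⟩
        · cases hgg
        · exact hk.symm
    mem_word := by
      intro h
      simp only [key]
      rcases h with g | _ | _
      · by_cases h1 : g = b
        · subst h1
          rw [fuseRot_b]
          simp
        by_cases h2 : g = c
        · subst h2
          rw [fuseRot_c _ hbc hb]
          simp [hbc]
        rw [fuseRot_other _ h1 h2, Sum.inl.injEq, ← D.mem_word g]
        simp [h1, h2]
      · rw [fuseRot_false _ hc]
        simp
      · simp [fuseRot_true] }

/-- The STU relations `S - T + U = 0`: in `T` the vertices `b`, `c` are consecutive on a solid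
component, in `U` they are exchanged, in `S` they are joined to a trivalent vertex. -/
def stuRel (l : ℕ) : Set (Diagram l →₀ ℚ) :=
  {r | ∃ (D : Diagram l) (i : Fin l) (l₁ : List D.H) (b c : D.H) (l₂ : List D.H)
      (hw : D.word i = l₁ ++ b :: c :: l₂),
      r = Finsupp.single (D.fuse i l₁ b c l₂ hw) 1 - Finsupp.single D 1
        + Finsupp.single (D.transpose i l₁ b c l₂ hw) 1}

def stringIsoRel (l : ℕ) : Set (Diagram l →₀ ℚ) :=
  {r | ∃ D D' : Diagram l, D.StringIso D' ∧ r = Finsupp.single D 1 - Finsupp.single D' 1}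

def circleIsoRel (l : ℕ) : Set (Diagram l →₀ ℚ) :=
  {r | ∃ D D' : Diagram l, D.CircleIso D' ∧ r = Finsupp.single D 1 - Finsupp.single D' 1}

def stringSub (l : ℕ) : Submodule ℚ (Diagram l →₀ ℚ) :=
  Submodule.span ℚ (stringIsoRel l ∪ stuRel l)

def circleSub (l : ℕ) : Submodule ℚ (Diagram l →₀ ℚ) :=
  Submodule.span ℚ (circleIsoRel l ∪ stuRel l)

/-- The space of Chinese character diagrams on `l` strings. -/
abbrev StringSpace (l : ℕ) : Type 1 := (Diagram l →₀ ℚ) ⧸ stringSub l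

/-- The space of Chinese character diagrams on `l` circles. -/
abbrev CircleSpace (l : ℕ) : Type 1 := (Diagram l →₀ ℚ) ⧸ circleSub l

def Diagram.onStrings {l : ℕ} (D : Diagram l) : StringSpace l :=
  (stringSub l).mkQ (Finsupp.single D 1)

def Diagram.onCircles {l : ℕ} (D : Diagram l) : CircleSpace l :=
  (circleSub l).mkQ (Finsupp.single D 1)

theorem stringSub_le_circleSub (l : ℕ) : stringSub l ≤ circleSub l := by
  refine Submodule.span_mono (Set.union_subset_union_left _ ?_)
  rintro r ⟨D, D', ⟨f, h1, h2, h3⟩, rfl⟩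
  exact ⟨D, D', ⟨f, h1, h2, fun i => by rw [h3 i]⟩, rfl⟩

/-- Closing each string to a circle by identifying its two endpoints. -/
def closure (l : ℕ) : StringSpace l →ₗ[ℚ] CircleSpace l :=
  Submodule.mapQ _ _ LinearMap.id (stringSub_le_circleSub l)

/-! ### Marked Chinese characters and symmetrization -/

/-- An `l`-marked Chinese character: the univalent vertices are coloured by `Fin l`. -/
structure Marked (l : ℕ) extends UTGraph where
  color : H → Option (Fin l)
  color_isSome : ∀ h, (color h).isSome ↔ rot h = h

/-- The number of univalent vertices of colour `i`. -/
def Marked.numLegs {l : ℕ} (X : Marked l) (i : Fin l) : ℕ := Nat.card {h : X.H // X.color h = some i}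

/-- The ways to put the vertices of colour `i` on the `i`-th string, for all `i`. -/
def Marked.Placement {l : ℕ} (X : Marked l) : Type :=
  {w : Fin l → List X.H // ∀ i, (w i).Nodup ∧ ∀ h, h ∈ w i ↔ X.color h = some i}

instance {l : ℕ} (X : Marked l) : Finite X.Placement := by
  have := Fintype.ofFinite X.H
  let f : X.Placement → (Fin l → {L : List X.H // L.Nodup}) := fun w i => ⟨w.1 i, (w.2 i).1⟩
  refine Finite.of_injective f ?_
  intro w w' h
  refine Subtype.ext (funext fun i => ?_)
  exact congrArg Subtype.val (congrFun h i)

instance {l : ℕ} (X : Marked l) : Fintype X.Placement := Fintype.ofFinite _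

def Marked.place {l : ℕ} (X : Marked l) (w : X.Placement) : Diagram l where
  toUTGraph := X.toUTGraph
  word := w.1
  word_nodup := fun i => (w.2 i).1
  word_disjoint := fun i j h h1 h2 =>
    Option.some.inj ((((w.2 i).2 h).1 h1).symm.trans (((w.2 j).2 h).1 h2))
  mem_word := fun h => by
    rw [← X.color_isSome h, Option.isSome_iff_exists]
    exact exists_congr fun i => (w.2 i).2 h

/-- The symmetrization map `χ`: the average of all `k₁! ⋯ k_l!` placements. -/
def Marked.chi {l : ℕ} (X : Marked l) : StringSpace l :=
  (∏ i, ((X.numLegs i).factorial : ℚ))⁻¹ • ∑ w : X.Placement, (X.place w).onStrings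

/-! ### Trivalent graphs, possibly with loop components -/

/-- A vertex-oriented trivalent graph, in which loops (circles without trivalent vertices) are
allowed as components. It is described by half-edges as before, where edges may be subdivided: a
cycle of `rot` of length three is an oriented trivalent vertex, a cycle of length two is a bivalent
vertex, which is just a marked point in the interior of an edge or on a loop. Inserting and
forgetting such points is factored out below. -/
structure TriGraph where
  H : Type
  [fin : Finite H]
  rot : Perm H
  opp : Perm H
  rot_ne : ∀ h, rot h ≠ h
  valence : ∀ h, rot (rot h) = h ∨ rot (rot (rot h)) = h
  opp_opp : ∀ h, opp (opp h) = h
  opp_ne : ∀ h, opp h ≠ h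

attribute [instance] TriGraph.fin

def TriGraph.Iso (G G' : TriGraph) : Prop :=
  ∃ f : G.H ≃ G'.H, (∀ h, f (G.rot h) = G'.rot (f h)) ∧ ∀ h, f (G.opp h) = G'.opp (f h)

/-- Insert a bivalent vertex, with half-edges `inr false` and `inr true`, in the edge of `a`:
this edge is replaced by the two edges `{a, inr false}` and `{inr true, opp a}`. -/
def TriGraph.subdivide (G : TriGraph) (a : G.H) : TriGraph where
  H := G.H ⊕ Bool
  rot := Equiv.sumCongr G.rot (swap false true)
  opp := swap (Sum.inl (G.opp a)) (Sum.inr false) * Equiv.sumCongr G.opp (swap false true) *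
    swap (Sum.inl (G.opp a)) (Sum.inr false)
  rot_ne := by
    rintro (h | _ | _)
    · simp [G.rot_ne]
    · simp
    · simp
  valence := by
    rintro (h | _ | _)
    · simpa using G.valence h
    · simp
    · simp
  opp_opp := by
    have key : ∀ x, Equiv.sumCongr G.opp (swap false true)
        (Equiv.sumCongr G.opp (swap false true) x) = x := by
      rintro (h | _ | _)
      · simp [G.opp_opp]
      · simp
      · simp
    intro h
    simp only [Perm.mul_apply, swap_apply_self, key]
  opp_ne := by
    have key : ∀ x, Equiv.sumCongr G.opp (swap false true) x ≠ x := by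
      rintro (h | _ | _)
      · simp [G.opp_ne]
      · simp
      · simp
    intro h hh
    apply key (swap (Sum.inl (G.opp a)) (Sum.inr false) h)
    apply (swap (Sum.inl (G.opp a)) (Sum.inr false)).injective
    rw [swap_apply_self]
    exact hh

/-- Permute by `π` the places that the half-edges occupy at the vertices. -/
def TriGraph.rewire (G : TriGraph) (π : Perm G.H) : TriGraph where
  H := G.H
  rot := (π.symm.trans G.rot).trans π
  opp := G.opp
  rot_ne := by
    intro h hh
    apply G.rot_ne (π.symm h)
    apply π.injective
    simpa using hh
  valence := by
    intro h
    rcases G.valence (π.symm h) with h1 | h1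
    · left
      simp [h1]
    · right
      simp [h1]
  opp_opp := G.opp_opp
  opp_ne := G.opp_ne

/-- The half-edge `h` ends at a trivalent vertex. -/
def TriGraph.IsTri (G : TriGraph) (h : G.H) : Prop := G.rot (G.rot h) ≠ h

def triIsoRel : Set (TriGraph →₀ ℚ) :=
  {r | ∃ G G' : TriGraph, G.Iso G' ∧ r = Finsupp.single G 1 - Finsupp.single G' 1}

def subdivRel : Set (TriGraph →₀ ℚ) :=
  {r | ∃ (G : TriGraph) (a : G.H),
    r = Finsupp.single (G.subdivide a) 1 - Finsupp.single G 1}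

/-- Antisymmetry: reversing the cyclic order at the trivalent vertex of `h` changes the sign. -/
def antisymRel : Set (TriGraph →₀ ℚ) :=
  {r | ∃ (G : TriGraph) (h : G.H), G.IsTri h ∧
    r = Finsupp.single G 1
      + Finsupp.single (G.rewire (swap (G.rot h) (G.rot.symm h))) 1}

/-- Jacobi (IHX): let the edge of `e` join two distinct trivalent vertices, with cyclic orders
`(e, B, A)` and `(opp e, R, C)`. Then this graph is the sum of the one with
`(e, R, A)`, `(opp e, B, C)` and the one with `(e, C, A)`, `(opp e, R, B)`. -/
def jacobiRel : Set (TriGraph →₀ ℚ) :=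
  {r | ∃ (G : TriGraph) (e : G.H), G.IsTri e ∧ G.IsTri (G.opp e) ∧
    G.opp e ≠ G.rot e ∧ G.opp e ≠ G.rot.symm e ∧
    r = Finsupp.single G 1
      - Finsupp.single (G.rewire (swap (G.rot e) (G.rot (G.opp e)))) 1
      - Finsupp.single (G.rewire (swap (G.rot e) (G.rot.symm (G.opp e)))) 1}

def triSub : Submodule ℚ (TriGraph →₀ ℚ) :=
  Submodule.span ℚ (triIsoRel ∪ subdivRel ∪ antisymRel ∪ jacobiRel)

/-- The space of trivalent graphs, loops being allowed as components. -/
abbrev TriSpace : Type 1 := (TriGraph →₀ ℚ) ⧸ triSub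

def TriGraph.cls (G : TriGraph) : TriSpace := triSub.mkQ (Finsupp.single G 1)

/-- `x` has denominator `N`: `N x` is an integral linear combination of trivalent graphs. -/
def HasDenominator (N : ℕ) (x : TriSpace) : Prop :=
  (N : ℚ) • x ∈ AddSubgroup.closure (Set.range TriGraph.cls)

/-! ### The map on marked Chinese characters and on diagrams on circles -/

/-- The partitions into pairs of the univalent vertices, each pair being of one colour, written as
involutions. -/
def Marked.Pairing {l : ℕ} (X : Marked l) : Type :=
  {p : Perm X.H // (∀ h, p (p h) = h) ∧ (∀ h, p h = h ↔ ¬ X.IsLeg h) ∧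
    ∀ h, X.color (p h) = X.color h}

instance {l : ℕ} (X : Marked l) : Finite X.Pairing := Subtype.finite

instance {l : ℕ} (X : Marked l) : Fintype X.Pairing := Fintype.ofFinite _

/-- Identify the two univalent vertices of each pair. -/
def Marked.glue {l : ℕ} (X : Marked l) (p : X.Pairing) : TriGraph :=
  have leg : ∀ h, X.rot h = h → X.rot (p.1 h) = p.1 h := by
    intro h hh
    by_contra hc
    have h1 : p.1 (p.1 h) = p.1 h := (p.2.2.1 _).2 hc
    exact (p.2.2.1 h).1 (p.1.injective h1) hh
  have fixed : ∀ h, X.rot h ≠ h → p.1 h = h := fun h hh => (p.2.2.1 h).2 hh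
  have moved : ∀ h, X.rot h = h → p.1 h ≠ h := fun h hh hp => (p.2.2.1 h).1 hp hh
  { H := X.H
    rot := X.rot * p.1
    opp := X.opp
    rot_ne := by
      intro h
      by_cases hh : X.rot h = h
      · rw [Perm.mul_apply, leg h hh]
        exact moved h hh
      · rw [Perm.mul_apply, fixed h hh]
        exact hh
    valence := by
      intro h
      simp only [Perm.mul_apply]
      by_cases hh : X.rot h = h
      · left
        rw [leg h hh, p.2.1 h, hh]
      · right
        have h1 : X.rot (X.rot h) ≠ X.rot h := fun hc => hh (X.rot.injective hc)
        have h2 : X.rot (X.rot (X.rot h)) ≠ X.rot (X.rot h) :=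
          fun hc => h1 (X.rot.injective hc)
        rw [fixed h hh, fixed _ h1, fixed _ h2, X.rot_rot_rot]
    opp_opp := X.opp_opp
    opp_ne := X.opp_ne }

/-- The map `j'_n` on an `l`-marked Chinese character. -/
def Marked.jPrime {l : ℕ} (n : ℕ) (X : Marked l) : TriSpace :=
  if (∀ i, X.numLegs i = 2 * n) ∧ X.degree ≤ (l + 1) * n then
    ∑ p : X.Pairing, (X.glue p).cls
  else 0

/-- `J` is the map `j'_n` on diagrams on `l` circles: for `x = closure y`, its value at `x` is the
value of `j'_n` at `χ⁻¹ y`. Writing `y` as a linear combination of the symmetrizations `χ X` of marked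
Chinese characters `X`, this is the following condition on the linear map `J`. -/
def IsJPrime (n l : ℕ) (J : CircleSpace l →ₗ[ℚ] TriSpace) : Prop :=
  ∀ X : Marked l, J (closure l X.chi) = X.jPrime n

end

end ChineseChar

/-! The symmetrizations span the string diagrams modulo STU, so the values of `j'_n` are forced.
What has to be shown is that they are consistent, survive closing the strings, and have small
denominators. Instead of inverting `χ`, the proof extends `j'_n` to a function `wordValue n X w` of
a coloured graph `X` and a linear order `w` of all its legs, colours mixed. Two properties determine
this function. Exchanging adjacent legs changes it by the value of the graph in which they are
joined, or not at all if their colours differ (STU). Its mean over all orders is `X.jPrime n`.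

Existence is by induction on the number of legs. Prescribed differences under adjacent
transpositions come from a function as soon as they are consistent along the defining relations of
the symmetric group (`IsCocycle`, `IsCocycle.sortCost_swap`): back and forth, the square of two
distant transpositions, and the hexagon on three neighbours. For the differences given by joining
legs, these are antisymmetry at the new vertex, the independence of two disjoint joins, and the
Jacobi relation. Hence the values on smaller graphs must already respect isomorphism, antisymmetry
and Jacobi, and both statements are proved in one induction (`relInvariant_and_stepCocycle`). A
principle used throughout is that a function of orders with no differences and mean zero vanishes
(`eq_zero_of_swap_invariant`).

To descend to circles one needs `wordValue_cons`: the first leg `x` may be moved to the end. By the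
principle and induction, only the mean of the change matters. That mean is proportional to the sum
of the `jPrime` of the graphs in which `x` is joined to another leg `y`. In this sum, fix the
pairing of the other legs: joining `x` at the two ends of a glued edge gives the same trivalent
graph with opposite orientations of the new vertex, so everything cancels (`sum_jPrime_fuse`). As
legs of different colours commute, each colour can then be rotated separately.

For the denominators, consider averages over the orders with a given beginning. Fixing one more
letter `x` is controlled by a Newton expansion in the place of `x` (`average_eq_sum`): the shorter
average is the longer one plus terms with coefficients `±1/(j+1)!`, in which `x` has been joined to
`j` further legs. With `2n` legs of each colour and degree at most `(l+1)n` there are at most `2n`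
trivalent vertices, so the terms with `j > 2n` vanish and only factorials up to `(2n+1)!` are
inverted. -/

namespace ChineseChar

noncomputable section

open scoped Classical

/-! ### Arrangements of a finite set -/

section Arrangements

variable {α β V : Type*}

/-- The lists containing each element of `s` exactly once. -/
def arr (s : Finset α) : Finset (List α) := s.toList.permutations.toFinset

theorem mem_arr {s : Finset α} {w : List α} : w ∈ arr s ↔ w.Nodup ∧ ∀ h, h ∈ w ↔ h ∈ s := by
  rw [arr, List.mem_toFinset, List.mem_permutations]
  constructor
  · intro h
    exact ⟨h.nodup_iff.2 s.nodup_toList, fun a => by rw [h.mem_iff, Finset.mem_toList]⟩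
  · rintro ⟨h1, h2⟩
    exact (List.perm_ext_iff_of_nodup h1 s.nodup_toList).2 fun a => by
      rw [h2, Finset.mem_toList]

theorem card_arr (s : Finset α) : (arr s).card = s.card.factorial := by
  rw [arr, List.toFinset_card_of_nodup (List.nodup_permutations _ s.nodup_toList),
    List.length_permutations, Finset.length_toList]

theorem length_of_mem_arr {s : Finset α} {w : List α} (h : w ∈ arr s) : w.length = s.card := by
  rw [mem_arr] at h
  rw [← List.toFinset_card_of_nodup h.1]
  congr 1
  ext a
  simp [h.2]

theorem perm_of_mem_arr {s : Finset α} {w w' : List α} (h : w ∈ arr s) (h' : w' ∈ arr s) :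
    w.Perm w' := by
  rw [mem_arr] at h h'
  exact (List.perm_ext_iff_of_nodup h.1 h'.1).2 fun a => by rw [h.2, h'.2]

theorem mem_arr_of_perm {s : Finset α} {w w' : List α} (h : w ∈ arr s) (hp : w.Perm w') :
    w' ∈ arr s := by
  rw [mem_arr] at h ⊢
  exact ⟨hp.nodup_iff.1 h.1, fun a => by rw [← hp.mem_iff, h.2]⟩

theorem mem_arr_swap {s : Finset α} {u v : List α} {b c : α} (h : u ++ b :: c :: v ∈ arr s) :
    u ++ c :: b :: v ∈ arr s :=
  mem_arr_of_perm h (List.Perm.append_left _ (List.Perm.swap _ _ _))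

theorem arr_nonempty (s : Finset α) : (arr s).Nonempty :=
  Finset.card_pos.1 (by rw [card_arr]; exact Nat.factorial_pos _)

theorem arr_empty : arr (∅ : Finset α) = {[]} := by
  ext w
  rw [mem_arr, Finset.mem_singleton]
  constructor
  · rintro ⟨-, h⟩
    exact List.eq_nil_iff_forall_not_mem.2 fun a ha => by simpa using (h a).1 ha
  · rintro rfl
    simp

theorem map_mem_arr (f : α ↪ β) {s : Finset α} {w : List α} (h : w ∈ arr s) :
    w.map f ∈ arr (s.map f) := by
  rw [mem_arr] at h ⊢
  refine ⟨h.1.map f.injective, fun a => ?_⟩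
  simp [h.2]

theorem sum_arr_map [AddCommMonoid V] (f : α ↪ β) (s : Finset α) (φ : List β → V) :
    ∑ w ∈ arr (s.map f), φ w = ∑ w ∈ arr s, φ (w.map f) := by
  symm
  refine Finset.sum_bij (fun w _ => w.map f) (fun w hw => map_mem_arr f hw) ?_ ?_ ?_
  · intro w _ w' _ h
    exact List.map_injective_iff.2 f.injective h
  · intro w hw
    have hw' := mem_arr.1 hw
    have : ∃ v : List α, v.map f = w := by
      rw [← Set.mem_range, Set.range_list_map]
      intro a ha
      obtain ⟨b, -, hb⟩ := Finset.mem_map.1 ((hw'.2 a).1 ha)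
      exact ⟨b, hb⟩
    obtain ⟨v, rfl⟩ := this
    refine ⟨v, mem_arr.2 ⟨hw'.1.of_map f, fun a => ?_⟩, rfl⟩
    have := hw'.2 (f a)
    simpa using this
  · intros; rfl

theorem perm_insert (p : ℕ) (y : α) (w : List α) :
    (w.take p ++ y :: w.drop p).Perm (y :: w) := by
  refine List.perm_middle.trans ?_
  rw [List.take_append_drop]

theorem insert_mem_arr [DecidableEq α] {s : Finset α} {y : α} (hy : y ∉ s) {w : List α} (hw : w ∈ arr s) (p : ℕ) :
    w.take p ++ y :: w.drop p ∈ arr (insert y s) := by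
  refine mem_arr_of_perm (w := y :: w) ?_ (perm_insert p y w).symm
  rw [mem_arr] at hw ⊢
  refine ⟨List.nodup_cons.2 ⟨fun h => hy ((hw.2 y).1 h), hw.1⟩, fun a => ?_⟩
  simp [hw.2]

theorem cons_mem_arr [DecidableEq α] {s : Finset α} {y : α} (hy : y ∉ s) {w : List α} (hw : w ∈ arr s) :
    y :: w ∈ arr (insert y s) := insert_mem_arr hy hw 0

theorem remove_mem_arr [DecidableEq α] {s : Finset α} {y : α} {u v : List α} (hw : u ++ y :: v ∈ arr s) :
    u ++ v ∈ arr (s.erase y) := by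
  have h := mem_arr.1 (mem_arr_of_perm hw List.perm_middle)
  rw [mem_arr]
  refine ⟨(List.nodup_cons.1 h.1).2, fun a => ?_⟩
  rw [Finset.mem_erase, ← h.2 a, List.mem_cons]
  constructor
  · intro ha
    exact ⟨fun e => (List.nodup_cons.1 h.1).1 (e ▸ ha), Or.inr ha⟩
  · rintro ⟨h1, h2⟩
    exact h2.resolve_left h1

theorem split_at_index {w : List α} {p : ℕ} (hp : p < w.length) :
    ∃ u y v, w = u ++ y :: v ∧ u.length = p :=
  ⟨w.take p, w[p], w.drop (p + 1), by simp, by simp; omega⟩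

/-- Sum over arrangements according to the entry with index `p`. -/
theorem sum_arr_eq_sum_insert [AddCommMonoid V] [DecidableEq α] (s : Finset α) {p : ℕ} (hp : p < s.card)
    (φ : List α → V) :
    ∑ w ∈ arr s, φ w = ∑ y ∈ s, ∑ w ∈ arr (s.erase y), φ (w.take p ++ y :: w.drop p) := by
  rw [Finset.sum_sigma']
  symm
  refine Finset.sum_bij (fun x _ => x.2.take p ++ x.1 :: x.2.drop p) ?_ ?_ ?_ ?_
  · rintro ⟨y, w⟩ h
    rw [Finset.mem_sigma] at h
    have := insert_mem_arr (Finset.notMem_erase y s) h.2 p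
    rwa [Finset.insert_erase h.1] at this
  · rintro ⟨y, w⟩ h ⟨y', w'⟩ h' e
    rw [Finset.mem_sigma] at h h'
    have l1 := length_of_mem_arr h.2
    have l2 := length_of_mem_arr h'.2
    dsimp only at e h h' l1 l2
    rw [Finset.card_erase_of_mem h.1] at l1
    rw [Finset.card_erase_of_mem h'.1] at l2
    have e1 := List.append_inj e (by simp; omega)
    have e2 := List.cons.inj e1.2
    have e3 : w = w' := by
      rw [← List.take_append_drop p w, ← List.take_append_drop p w', e1.1, e2.2]
    rw [e2.1, e3]
  · intro w hw
    obtain ⟨u, y, v, rfl, rfl⟩ := split_at_index (by rwa [length_of_mem_arr hw])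
    refine ⟨⟨y, u ++ v⟩, Finset.mem_sigma.2 ⟨((mem_arr.1 hw).2 y).1 (by simp), remove_mem_arr hw⟩, ?_⟩
    simp
  · intros; rfl

/-- Sum over arrangements according to the index of the entry `x`. -/
theorem sum_arr_insert [AddCommMonoid V] [DecidableEq α] {s : Finset α} {x : α} (hx : x ∉ s) (φ : List α → V) :
    ∑ w ∈ arr (insert x s), φ w =
      ∑ p ∈ Finset.range (s.card + 1), ∑ w ∈ arr s, φ (w.take p ++ x :: w.drop p) := by
  rw [Finset.sum_sigma']
  symm
  refine Finset.sum_bij (fun y _ => y.2.take y.1 ++ x :: y.2.drop y.1) ?_ ?_ ?_ ?_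
  · rintro ⟨p, w⟩ h
    rw [Finset.mem_sigma] at h
    exact insert_mem_arr hx h.2 p
  · rintro ⟨p, w⟩ h ⟨p', w'⟩ h' e
    rw [Finset.mem_sigma, Finset.mem_range] at h h'
    have l1 := length_of_mem_arr h.2
    have l2 := length_of_mem_arr h'.2
    simp only at e h h' l1 l2
    have n1 : x ∉ w := fun hh => hx (((mem_arr.1 h.2).2 x).1 hh)
    have n2 : x ∉ w' := fun hh => hx (((mem_arr.1 h'.2).2 x).1 hh)
    have m1 : x ∉ w.take p := fun hh => n1 (List.mem_of_mem_take hh)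
    have m2 : x ∉ w'.take p' := fun hh => n2 (List.mem_of_mem_take hh)
    have i1 : (w.take p ++ x :: w.drop p).idxOf x = p := by
      rw [List.idxOf_append_of_notMem m1, List.idxOf_cons_self, List.length_take]
      omega
    have i2 : (w'.take p' ++ x :: w'.drop p').idxOf x = p' := by
      rw [List.idxOf_append_of_notMem m2, List.idxOf_cons_self, List.length_take]
      omega
    have : p = p' := by rw [← i1, ← i2, e]
    subst this
    have e1 := List.append_inj e (by simp; omega)
    have e2 := List.cons.inj e1.2
    have e3 : w = w' := by
      rw [← List.take_append_drop p w, ← List.take_append_drop p w', e1.1, e2.2]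
    rw [e3]
  · intro w hw
    have hxw : x ∈ w := ((mem_arr.1 hw).2 x).2 (Finset.mem_insert_self _ _)
    obtain ⟨u, v, rfl⟩ := List.append_of_mem hxw
    have h1 := remove_mem_arr hw
    rw [Finset.erase_insert hx] at h1
    refine ⟨⟨u.length, u ++ v⟩, Finset.mem_sigma.2 ⟨?_, h1⟩, ?_⟩
    · have := length_of_mem_arr h1
      simp at this ⊢
      omega
    · simp
  · intros; rfl

/-! ### Functions of arrangements with given differences under adjacent transpositions -/

/-- Adjacent transpositions connect all arrangements. In the induction over `List.Perm` the prefix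
`u` absorbs the letters stripped off by `cons`. -/
theorem eq_of_swap_invariant {s : Finset α} {φ : List α → V}
    (h : ∀ u b c v, u ++ b :: c :: v ∈ arr s → φ (u ++ b :: c :: v) = φ (u ++ c :: b :: v))
    {w w' : List α} (hw : w ∈ arr s) (hw' : w' ∈ arr s) : φ w = φ w' := by
  have key : ∀ w w' : List α, w.Perm w' → ∀ u, u ++ w ∈ arr s → φ (u ++ w) = φ (u ++ w') := by
    intro w w' hp
    induction hp with
    | nil => intros; rfl
    | cons x _ ih =>
      intro u hu
      have := ih (u ++ [x]) (by simpa using hu)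
      simpa using this
    | swap x y l => intro u hu; exact h u y x l hu
    | trans h1 _ ih1 ih2 =>
      intro u hu
      rw [ih1 u hu, ih2 u (mem_arr_of_perm hu (List.Perm.append_left _ h1))]
  exact key w w' (perm_of_mem_arr hw hw') [] hw

/-- The condition for `g` to be the coboundary of a function on the arrangements of `s`. -/
structure IsCocycle [AddCommGroup V] (s : Finset α) (g : List α → α → α → List α → V) : Prop where
  antisymm : ∀ u b c v, u ++ b :: c :: v ∈ arr s → g u c b v = - g u b c v
  square : ∀ u b c v d e w, u ++ b :: c :: (v ++ d :: e :: w) ∈ arr s →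
    g u b c (v ++ d :: e :: w) - g u b c (v ++ e :: d :: w) =
      g (u ++ b :: c :: v) d e w - g (u ++ c :: b :: v) d e w
  hexagon : ∀ u a b c v, u ++ a :: b :: c :: v ∈ arr s →
    g u a b (c :: v) + g (u ++ [b]) a c v + g u b c (a :: v) =
      g (u ++ [a]) b c v + g u a c (b :: v) + g (u ++ [c]) a b v

variable [AddCommGroup V]

/-- The sum of `g` along the path moving `a` to the left past `w₁`. -/
def passCost (g : List α → α → α → List α → V) (a : α) (w₂ : List α) : List α → List α → V
  | _, [] => 0
  | u, y :: w₁ => passCost g a w₂ (u ++ [y]) w₁ + g u y a (w₁ ++ w₂)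

/-- The sum of `g` along the path sorting `w` into the order of the last argument. -/
def sortCost (g : List α → α → α → List α → V) : List α → List α → List α → V
  | _, _, [] => 0
  | u, w, a :: t =>
    passCost g a (w.drop (w.idxOf a + 1)) u (w.take (w.idxOf a)) +
      sortCost g (u ++ [a]) (w.take (w.idxOf a) ++ w.drop (w.idxOf a + 1)) t

theorem sortCost_cons (g : List α → α → α → List α → V) (u w₁ w₂ t : List α) {a : α}
    (ha : a ∉ w₁) : sortCost g u (w₁ ++ a :: w₂) (a :: t) =
      passCost g a w₂ u w₁ + sortCost g (u ++ [a]) (w₁ ++ w₂) t := by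
  have : (w₁ ++ a :: w₂).idxOf a = w₁.length := by
    rw [List.idxOf_append_of_notMem ha, List.idxOf_cons_self, add_zero]
  simp [sortCost, this]

/-- The recursion of `passCost` isolates the last step of the path of `a`; here the first step, past
the neighbour `y`, is isolated. -/
theorem passCost_snoc (g : List α → α → α → List α → V) (a y : α) (w₂ w₁ u : List α) :
    passCost g a w₂ u (w₁ ++ [y]) = g (u ++ w₁) y a w₂ + passCost g a (y :: w₂) u w₁ := by
  induction w₁ generalizing u with
  | nil => simp [passCost]
  | cons z w₁ ih => simp [passCost, ih, add_assoc]

variable {s : Finset α} {g : List α → α → α → List α → V}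

/-- The path of `a` and an exchange to its right involve disjoint places, so each step of the path
contributes one square. -/
theorem IsCocycle.passCost_right (hg : IsCocycle s g) (a b c : α) (v q : List α) (w₁ u : List α)
    (h : u ++ w₁ ++ a :: (v ++ b :: c :: q) ∈ arr s) :
    passCost g a (v ++ b :: c :: q) u w₁ - passCost g a (v ++ c :: b :: q) u w₁ =
      g (u ++ w₁ ++ a :: v) b c q - g (u ++ a :: w₁ ++ v) b c q := by
  induction w₁ generalizing u with
  | nil => simp [passCost]
  | cons y w₁ ih =>
    have h1 := ih (u ++ [y]) (by simpa using h)
    have h2 := hg.square u y a (w₁ ++ v) b c q (by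
      refine mem_arr_of_perm h ?_
      simp only [List.append_assoc, List.cons_append]
      exact List.Perm.append_left _ (List.Perm.cons _ List.perm_middle))
    simp only [passCost, List.append_assoc, List.cons_append, List.nil_append] at h1 h2 ⊢
    rw [add_sub_add_comm, h1, h2]
    abel

/-- Again one square for each step, the exchange now lying to the left of the stretch that `a`
traverses. The list `r` collects the letters of the stretch that the induction has split off. -/
theorem IsCocycle.passCost_prefix (hg : IsCocycle s g) (a b c : α) (w₂ : List α) (u r w₁ : List α)
    (h : u ++ b :: c :: (r ++ w₁) ++ a :: w₂ ∈ arr s) :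
    passCost g a w₂ (u ++ b :: c :: r) w₁ - passCost g a w₂ (u ++ c :: b :: r) w₁ =
      g u b c (r ++ w₁ ++ a :: w₂) - g u b c (r ++ a :: w₁ ++ w₂) := by
  induction w₁ generalizing r with
  | nil => simp [passCost]
  | cons y w₁ ih =>
    have h1 := ih (r ++ [y]) (by simpa using h)
    have h2 := hg.square u b c r y a (w₁ ++ w₂) (by
      refine mem_arr_of_perm h ?_
      simp only [List.append_assoc, List.cons_append]
      refine List.Perm.append_left _ (List.Perm.cons _ (List.Perm.cons _
        (List.Perm.append_left _ (List.Perm.cons _ List.perm_middle)))))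
    simp only [passCost, List.append_assoc, List.cons_append, List.nil_append] at h1 h2 ⊢
    rw [add_sub_add_comm, h1, ← h2]
    abel

/-- Here `a` moves across the two exchanged letters. The steps before and after that contribute
squares, and the crossing of `b` and `c` itself is the hexagon. -/
theorem IsCocycle.passCost_left (hg : IsCocycle s g) (a b c : α) (q w₂ : List α) (p u : List α)
    (h : u ++ p ++ b :: c :: q ++ a :: w₂ ∈ arr s) :
    passCost g a w₂ u (p ++ b :: c :: q) - passCost g a w₂ u (p ++ c :: b :: q) =
      g (u ++ p) b c (q ++ a :: w₂) - g (u ++ a :: p) b c (q ++ w₂) := by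
  induction p generalizing u with
  | nil =>
    have h1 := hg.passCost_prefix a b c w₂ u [] q (by simpa using h)
    have hp : u ++ b :: c :: a :: (q ++ w₂) ∈ arr s := by
      refine mem_arr_of_perm h ?_
      simp only [List.append_assoc, List.cons_append, List.append_nil]
      exact List.Perm.append_left _ (List.Perm.cons _ (List.Perm.cons _ List.perm_middle))
    have h2 := hg.hexagon u b c a (q ++ w₂) hp
    simp only [passCost, List.append_assoc, List.cons_append, List.nil_append,
      List.append_nil] at h1 h2 ⊢
    have h3 := sub_eq_iff_eq_add.1 h1
    have h4 := eq_sub_of_add_eq (eq_sub_of_add_eq h2.symm)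
    rw [h3, h4]
    abel_nf
  | cons y p ih =>
    have h1 := ih (u ++ [y]) (by simpa using h)
    have h2 := hg.square u y a p b c (q ++ w₂) (by
      refine mem_arr_of_perm h ?_
      simp only [List.append_assoc, List.cons_append]
      refine List.Perm.append_left _ (List.Perm.cons _ ?_)
      have : (p ++ b :: c :: (q ++ a :: w₂)) = (p ++ b :: c :: q) ++ a :: w₂ := by simp
      rw [this]
      refine List.perm_middle.trans ?_
      simp)
    simp only [passCost, List.append_assoc, List.cons_append, List.nil_append] at h1 h2 ⊢
    rw [add_sub_add_comm, h1, h2]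
    abel

/-- The cost of sorting has the coboundary `g`. Let `a` be the letter to be brought to the front. If
`a` is `b` or `c`, one of the two sorting paths is the other one preceded by the exchange itself.
Otherwise bringing `a` to the front transports the exchange to the remaining letters, at the cost
given by `passCost_right` or `passCost_left`, and the induction applies. -/
theorem IsCocycle.sortCost_swap (hg : IsCocycle s g) (t : List α) : ∀ (u p : List α) (b c : α)
    (q : List α), u ++ p ++ b :: c :: q ∈ arr s → t.Perm (p ++ b :: c :: q) →
    sortCost g u (p ++ b :: c :: q) t - sortCost g u (p ++ c :: b :: q) t =
      g (u ++ p) b c q := by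
  induction t with
  | nil =>
    intro u p b c q _ hp
    simpa using hp.length_eq
  | cons a t ih =>
    intro u p b c q h hp
    have hnd : (p ++ b :: c :: q).Nodup := by
      have := (mem_arr.1 h).1
      rw [List.append_assoc] at this
      exact (List.nodup_append.1 this).2.1
    have hap : a ∈ p ++ b :: c :: q := hp.subset (by simp)
    have hmid : (p ++ b :: c :: q).Perm (b :: c :: (p ++ q)) :=
      List.perm_middle.trans (List.Perm.cons _ List.perm_middle)
    have hnd' := hmid.nodup_iff.1 hnd
    simp only [List.nodup_cons, List.mem_cons, List.mem_append, not_or] at hnd'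
    by_cases hab : a = b
    · subst hab
      have ha : a ∉ p := hnd'.1.2.1
      have hac : a ≠ c := hnd'.1.1
      have e : p ++ c :: a :: q = (p ++ [c]) ++ a :: q := by simp
      rw [e, sortCost_cons g u p (c :: q) t ha, sortCost_cons g u (p ++ [c]) q t (by simp [ha, hac]),
        passCost_snoc, hg.antisymm (u ++ p) a c q h]
      simp
    by_cases hac : a = c
    · subst hac
      have ha : a ∉ p := hnd'.2.1.1
      have e : p ++ b :: a :: q = (p ++ [b]) ++ a :: q := by simp
      rw [e, sortCost_cons g u p (b :: q) t ha, sortCost_cons g u (p ++ [b]) q t (by simp [ha, hab]),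
        passCost_snoc]
      simp
    have hpq : a ∈ p ∨ a ∈ q := by
      simp only [List.mem_append, List.mem_cons] at hap
      tauto
    by_cases hpa : a ∈ p
    · obtain ⟨p₁, p₂, rfl⟩ := List.append_of_mem hpa
      have ha : a ∉ p₁ := by
        intro hh
        rw [List.append_assoc, List.nodup_append] at hnd
        exact hnd.2.2 a hh a (by simp) rfl
      have e : ∀ x y : α, p₁ ++ a :: p₂ ++ x :: y :: q = p₁ ++ a :: (p₂ ++ x :: y :: q) := by simp
      have h1 := hg.passCost_right a b c p₂ q p₁ u (by simpa using h)
      have hq : (u ++ [a]) ++ (p₁ ++ p₂) ++ b :: c :: q ∈ arr s := by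
        refine mem_arr_of_perm h ?_
        simp only [List.append_assoc, List.cons_append, List.nil_append]
        exact List.Perm.append_left _ List.perm_middle
      have h2 := ih (u ++ [a]) (p₁ ++ p₂) b c q hq (by
        refine List.Perm.cons_inv (a := a) (hp.trans ?_)
        rw [e]
        refine List.perm_middle.trans ?_
        simp)
      rw [e, e, sortCost_cons g u p₁ _ t ha, sortCost_cons g u p₁ _ t ha, add_sub_add_comm, h1]
      simp only [List.append_assoc, List.cons_append, List.nil_append] at h2 ⊢
      rw [h2]
      abel
    · obtain ⟨q₁, q₂, rfl⟩ := List.append_of_mem (hpq.resolve_left hpa)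
      have ha : a ∉ q₁ := by
        intro hh
        have h3 := hnd'.2.2
        rw [← List.append_assoc, List.nodup_append] at h3
        exact h3.2.2 a (by simp [hh]) a (by simp) rfl
      have e : ∀ x y : α, p ++ x :: y :: (q₁ ++ a :: q₂) = (p ++ x :: y :: q₁) ++ a :: q₂ := by simp
      have h1 := hg.passCost_left a b c q₁ q₂ p u (by simpa using h)
      have hq : (u ++ [a]) ++ p ++ b :: c :: (q₁ ++ q₂) ∈ arr s := by
        refine mem_arr_of_perm h ?_
        simp only [List.append_assoc, List.cons_append, List.nil_append]
        refine List.Perm.append_left _ ?_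
        rw [e]
        refine List.perm_middle.trans ?_
        simp
      have h2 := ih (u ++ [a]) p b c (q₁ ++ q₂) hq (by
        refine List.Perm.cons_inv (a := a) (hp.trans ?_)
        rw [e]
        refine List.perm_middle.trans ?_
        simp)
      rw [e, e, sortCost_cons g u _ _ t (by simp [hpa, hab, hac, ha]),
        sortCost_cons g u _ _ t (by simp [hpa, hab, hac, ha]), add_sub_add_comm, h1]
      simp only [List.append_assoc, List.cons_append, List.nil_append] at h2 ⊢
      rw [h2]
      abel

/-- `φ` has the coboundary `g` and mean value zero. -/
def IsPotential (s : Finset α) (g : List α → α → α → List α → V) (φ : List α → V) : Prop :=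
  (∀ u b c v, u ++ b :: c :: v ∈ arr s → φ (u ++ b :: c :: v) - φ (u ++ c :: b :: v) = g u b c v) ∧
    ∑ w ∈ arr s, φ w = 0

theorem IsCocycle.exists_potential [Module ℚ V] (hg : IsCocycle s g) :
    ∃ φ, IsPotential s g φ := by
  -- Subtracting the mean normalizes the sum to zero without affecting differences.
  refine ⟨fun w => sortCost g [] w s.toList -
    ((arr s).card : ℚ)⁻¹ • ∑ w ∈ arr s, sortCost g [] w s.toList, ?_, ?_⟩
  · intro u b c v h
    have := hg.sortCost_swap s.toList [] u b c v h (perm_of_mem_arr (s := s)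
      (mem_arr.2 ⟨s.nodup_toList, fun _ => Finset.mem_toList⟩) h)
    simpa using this
  · rw [Finset.sum_sub_distrib, Finset.sum_const, ← Nat.cast_smul_eq_nsmul ℚ, smul_smul,
      mul_inv_cancel₀, one_smul, sub_self]
    simpa using (Finset.card_pos.2 (arr_nonempty s)).ne'

/-- Some function with coboundary `g` and mean value zero, if there is one. -/
def potential (s : Finset α) (g : List α → α → α → List α → V) : List α → V :=
  if h : ∃ φ, IsPotential s g φ then h.choose else 0

theorem IsCocycle.isPotential [Module ℚ V] (hg : IsCocycle s g) :
    IsPotential s g (potential s g) := by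
  rw [potential, dif_pos hg.exists_potential]
  exact hg.exists_potential.choose_spec

/-- Such a function is constant on a nonempty set, and its sum is a nonzero multiple of its value.
This is the uniqueness principle behind all later inductions on the number of legs. -/
theorem eq_zero_of_swap_invariant [Module ℚ V] {φ : List α → V}
    (h : ∀ u b c v, u ++ b :: c :: v ∈ arr s → φ (u ++ b :: c :: v) = φ (u ++ c :: b :: v))
    (h0 : ∑ w ∈ arr s, φ w = 0) {w : List α} (hw : w ∈ arr s) : φ w = 0 := by
  rw [Finset.sum_congr rfl fun w' hw' => eq_of_swap_invariant h hw' hw, Finset.sum_const,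
    ← Nat.cast_smul_eq_nsmul ℚ] at h0
  refine (smul_eq_zero.1 h0).resolve_left ?_
  simpa using (Finset.card_pos.2 (arr_nonempty s)).ne'

end Arrangements

/-! ### Relations between trivalent graphs -/

theorem TriGraph.Iso.cls_eq {G G' : TriGraph} (h : G.Iso G') : G.cls = G'.cls := by
  rw [TriGraph.cls, TriGraph.cls, ← sub_eq_zero, ← map_sub, Submodule.mkQ_apply,
    Submodule.Quotient.mk_eq_zero]
  exact Submodule.subset_span (Or.inl (Or.inl (Or.inl ⟨G, G', h, rfl⟩)))

theorem TriGraph.cls_subdivide (G : TriGraph) (a : G.H) : (G.subdivide a).cls = G.cls := by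
  rw [TriGraph.cls, TriGraph.cls, ← sub_eq_zero, ← map_sub, Submodule.mkQ_apply,
    Submodule.Quotient.mk_eq_zero]
  exact Submodule.subset_span (Or.inl (Or.inl (Or.inr ⟨G, a, rfl⟩)))

theorem TriGraph.cls_antisymm (G : TriGraph) {h : G.H} (hh : G.IsTri h) :
    G.cls + (G.rewire (swap (G.rot h) (G.rot.symm h))).cls = 0 := by
  rw [TriGraph.cls, TriGraph.cls, ← map_add, Submodule.mkQ_apply, Submodule.Quotient.mk_eq_zero]
  exact Submodule.subset_span (Or.inl (Or.inr ⟨G, h, hh, rfl⟩))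

theorem TriGraph.cls_jacobi (G : TriGraph) {e : G.H} (h1 : G.IsTri e) (h2 : G.IsTri (G.opp e))
    (h3 : G.opp e ≠ G.rot e) (h4 : G.opp e ≠ G.rot.symm e) :
    G.cls - (G.rewire (swap (G.rot e) (G.rot (G.opp e)))).cls -
      (G.rewire (swap (G.rot e) (G.rot.symm (G.opp e)))).cls = 0 := by
  rw [TriGraph.cls, TriGraph.cls, TriGraph.cls, ← map_sub, ← map_sub, Submodule.mkQ_apply,
    Submodule.Quotient.mk_eq_zero]
  exact Submodule.subset_span (Or.inr ⟨G, e, h1, h2, h3, h4, rfl⟩)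

theorem TriGraph.rewire_one (G : TriGraph) : (G.rewire 1).cls = G.cls :=
  TriGraph.Iso.cls_eq ⟨Equiv.refl _, fun _ => rfl, fun _ => rfl⟩

/-! ### Joining two legs of a marked Chinese character -/

variable {l : ℕ}

/-- The set of legs. -/
def Marked.legs (X : Marked l) : Finset X.H := (Set.toFinite {h | X.rot h = h}).toFinset

theorem Marked.mem_legs {X : Marked l} {h : X.H} : h ∈ X.legs ↔ X.rot h = h := by
  simp [Marked.legs]

/-- `b` and `c` are distinct legs of the same colour. -/
def Marked.Fusable (X : Marked l) (b c : X.H) : Prop :=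
  X.rot b = b ∧ X.rot c = c ∧ b ≠ c ∧ X.color b = X.color c

/-- Join the legs `b` and `c` to a new trivalent vertex, whose third edge ends in a new leg. -/
abbrev Marked.fuse (X : Marked l) (b c : X.H) (hX : X.Fusable b c) : Marked l :=
  have hb := hX.1
  have hc := hX.2.1
  have hbc := hX.2.2.1
  { H := X.H ⊕ Bool
    rot := fuseRot X.rot b c
    opp := Equiv.sumCongr X.opp (swap false true)
    rot_rot_rot := by
      rintro (h | _ | _)
      · by_cases h1 : h = b
        · subst h1
          rw [fuseRot_b, fuseRot_false _ hc, fuseRot_c _ hbc hb]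
        by_cases h2 : h = c
        · subst h2
          rw [fuseRot_c _ hbc hb, fuseRot_b, fuseRot_false _ hc]
        have e1 : ∀ k, X.rot k = b → k = b := fun k hk => X.rot.injective (hk.trans hb.symm)
        have e2 : ∀ k, X.rot k = c → k = c := fun k hk => X.rot.injective (hk.trans hc.symm)
        have h3 : X.rot h ≠ b := fun hk => h1 (e1 _ hk)
        have h4 : X.rot h ≠ c := fun hk => h2 (e2 _ hk)
        rw [fuseRot_other _ h1 h2, fuseRot_other _ h3 h4, fuseRot_other _
          (fun hk => h3 (e1 _ hk)) (fun hk => h4 (e2 _ hk)), X.rot_rot_rot]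
      · rw [fuseRot_false _ hc, fuseRot_c _ hbc hb, fuseRot_b]
      · simp only [fuseRot_true]
    opp_opp := by
      rintro (h | _ | _)
      · simp [X.opp_opp]
      · simp
      · simp
    opp_ne := by
      rintro (h | _ | _)
      · simp [X.opp_ne]
      · simp
      · simp
    ext := by
      intro S hS hcl
      by_cases ht : (Sum.inr true : X.H ⊕ Bool) ∈ S
      · exact ⟨_, ht, fuseRot_true _ _ _⟩
      have hf : (Sum.inr false : X.H ⊕ Bool) ∉ S := fun hf => ht (by simpa using (hcl _ hf).2)
      have hb' : (Sum.inl b : X.H ⊕ Bool) ∉ S := fun h => hf (by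
        have := (hcl _ h).1
        rwa [fuseRot_b] at this)
      have hc' : (Sum.inl c : X.H ⊕ Bool) ∉ S := fun h => hb' (by
        have := (hcl _ h).1
        rwa [fuseRot_c _ hbc hb] at this)
      have hne : ∀ g, Sum.inl g ∈ S → fuseRot X.rot b c (Sum.inl g) = Sum.inl (X.rot g) := by
        intro g hg
        exact fuseRot_other _ (fun h => hb' (h ▸ hg)) (fun h => hc' (h ▸ hg))
      obtain ⟨g, hg, hgr⟩ := X.ext (Sum.inl ⁻¹' S) (by
        obtain ⟨x, hx⟩ := hS
        rcases x with g | _ | _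
        · exact ⟨g, hx⟩
        · exact absurd hx hf
        · exact absurd hx ht) (by
        intro g hg
        have h := hcl _ hg
        rw [hne g hg] at h
        exact ⟨h.1, by simpa using h.2⟩)
      exact ⟨Sum.inl g, hg, by rw [hne g hg, hgr]⟩
    color := Sum.elim (fun h => if h = b ∨ h = c then none else X.color h)
      (fun t => if t then X.color b else none)
    color_isSome := by
      rintro (h | _ | _)
      · by_cases h1 : h = b
        · subst h1
          simp [fuseRot_b]
        by_cases h2 : h = c
        · subst h2
          simp [fuseRot_c _ hbc hb, hbc]
        rw [fuseRot_other _ h1 h2, Sum.inl.injEq, ← X.color_isSome]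
        simp [h1, h2]
      · simp [fuseRot_false _ hc]
      · simp [fuseRot_true, X.color_isSome, hb] }

theorem Marked.legs_fuse (X : Marked l) (b c : X.H) (hX : X.Fusable b c) :
    (X.fuse b c hX).legs = insert (Sum.inr true)
      (((X.legs.erase b).erase c).map Function.Embedding.inl) := by
  ext h
  rw [Marked.mem_legs, ← Marked.color_isSome]
  rcases h with h | _ | _
  · by_cases h1 : h = b
    · simp [Marked.fuse, h1]
    by_cases h2 : h = c
    · simp [Marked.fuse, h2]
    simp [Marked.fuse, h1, h2, X.color_isSome, Marked.mem_legs]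
  · simp [Marked.fuse]
  · simp [Marked.fuse, X.color_isSome, hX.1]

/-- `Y` is, up to the identification `f`, obtained from `X` by permuting by `π` the places that the
half-edges occupy at the trivalent vertices. -/
structure IsRewire (X Y : Marked l) (f : X.H ≃ Y.H) (π : Perm X.H) : Prop where
  fix : ∀ h, X.rot h = h → π h = h
  rot : ∀ h, Y.rot (f h) = f (π (X.rot (π.symm h)))
  opp : ∀ h, Y.opp (f h) = f (X.opp h)
  color : ∀ h, Y.color (f h) = X.color h

namespace IsRewire

variable {X Y : Marked l} {f : X.H ≃ Y.H} {π : Perm X.H}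

theorem leg_iff (R : IsRewire X Y f π) (h : X.H) : Y.rot (f h) = f h ↔ X.rot h = h := by
  rw [← Y.color_isSome, ← X.color_isSome, R.color]

theorem fix_symm (R : IsRewire X Y f π) {h : X.H} (hh : X.rot h = h) : π.symm h = h := by
  rw [Equiv.symm_apply_eq, R.fix h hh]

theorem legs_eq (R : IsRewire X Y f π) : Y.legs = X.legs.map f.toEmbedding := by
  ext h
  obtain ⟨h, rfl⟩ := f.surjective h
  rw [Marked.mem_legs, R.leg_iff]
  simp [Marked.mem_legs]

theorem fusable_iff (R : IsRewire X Y f π) (b c : X.H) :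
    Y.Fusable (f b) (f c) ↔ X.Fusable b c := by
  simp [Marked.Fusable, R.leg_iff, R.color]

theorem fuse (R : IsRewire X Y f π) {b c : X.H} (hX : X.Fusable b c) (hY : Y.Fusable (f b) (f c)) :
    IsRewire (X.fuse b c hX) (Y.fuse (f b) (f c) hY) (Equiv.sumCongr f (Equiv.refl Bool))
      (Equiv.sumCongr π (Equiv.refl Bool)) where
  fix := by
    intro h hh
    rw [← Marked.mem_legs, Marked.legs_fuse] at hh
    rcases h with h | t
    · simp only [Finset.mem_insert, reduceCtorEq, Finset.mem_map, Finset.mem_erase,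
        Function.Embedding.inl_apply, Sum.inl.injEq, exists_eq_right, false_or,
        Marked.mem_legs] at hh
      simp [R.fix h hh.2.2]
    · simp
  rot := by
    have hb := hX.1
    have hc := hX.2.1
    have hbc := hX.2.2.1
    have hbc' : f b ≠ f c := fun e => hbc (f.injective e)
    have hb' : Y.rot (f b) = f b := hY.1
    have hc' : Y.rot (f c) = f c := hY.2.1
    have pb := R.fix b hb
    have pc := R.fix c hc
    have pb' := R.fix_symm hb
    have pc' := R.fix_symm hc
    rintro (h | _ | _)
    · by_cases h1 : h = b
      · subst h1
        simp [Marked.fuse, fuseRot_b, pb']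
      by_cases h2 : h = c
      · subst h2
        simp [Marked.fuse, fuseRot_c _ hbc hb, fuseRot_c _ hbc' hb', pc', pb]
      have h3 : π.symm h ≠ b := fun e => h1 (by rw [Equiv.symm_apply_eq] at e; rw [e, pb])
      have h4 : π.symm h ≠ c := fun e => h2 (by rw [Equiv.symm_apply_eq] at e; rw [e, pc])
      have h1' : f h ≠ f b := fun e => h1 (f.injective e)
      have h2' : f h ≠ f c := fun e => h2 (f.injective e)
      simp [Marked.fuse, fuseRot_other _ h1' h2', fuseRot_other _ h3 h4, R.rot]
    · simp [Marked.fuse, fuseRot_false _ hc, fuseRot_false _ hc', pc]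
    · simp [Marked.fuse, fuseRot_true]
  opp := by
    rintro (h | t)
    · simp [Marked.fuse, R.opp]
    · simp [Marked.fuse]
  color := by
    rintro (h | t)
    · simp [Marked.fuse, R.color]
    · simp [Marked.fuse, R.color]

theorem numLegs_eq (R : IsRewire X Y f π) (i : Fin l) : Y.numLegs i = X.numLegs i :=
  (Nat.card_congr (f.subtypeEquiv fun h => by rw [R.color])).symm

theorem degree_eq (R : IsRewire X Y f π) : Y.degree = X.degree := by
  rw [UTGraph.degree, UTGraph.degree, UTGraph.numVertices, UTGraph.numVertices]
  have h1 : Nat.card {h // X.IsLeg h} = Nat.card {h // Y.IsLeg h} :=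
    Nat.card_congr (f.subtypeEquiv fun h => (R.leg_iff h).symm)
  have h2 : Nat.card {h // ¬ X.IsLeg h} = Nat.card {h // ¬ Y.IsLeg h} :=
    Nat.card_congr (f.subtypeEquiv fun h => not_congr (R.leg_iff h).symm)
  rw [h1, h2]

/-- Transport of pairings. -/
def pairingEquiv (R : IsRewire X Y f π) : X.Pairing ≃ Y.Pairing :=
  (f.permCongr).subtypeEquiv fun p => by
    have hl : ∀ h, Y.IsLeg (f h) ↔ X.IsLeg h := R.leg_iff
    refine and_congr ?_ (and_congr ?_ ?_)
    · rw [f.forall_congr_left]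
      simp [Equiv.permCongr_apply, f.symm.forall_congr_left]
    · rw [f.symm.forall_congr_left]
      simp [Equiv.permCongr_apply, hl]
    · rw [f.symm.forall_congr_left]
      simp [Equiv.permCongr_apply, R.color]

/-- The two permutations have disjoint supports: `p` moves only legs and `π` moves only half-edges
at trivalent vertices. -/
theorem pairing_comm (R : IsRewire X Y f π) (p : X.Pairing) (h : X.H) :
    p.1 (π.symm h) = π.symm (p.1 h) := by
  by_cases hh : X.rot h = h
  · have h1 : X.rot (p.1 h) = p.1 h := by
      rw [← X.color_isSome, p.2.2.2, X.color_isSome, hh]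
    rw [R.fix_symm hh, R.fix_symm h1]
  · have h1 : ¬ X.rot (π.symm h) = π.symm h := by
      intro e
      have := R.fix _ e
      rw [Equiv.apply_symm_apply] at this
      rw [← this] at e
      exact hh e
    rw [(p.2.2.1 h).2 hh, (p.2.2.1 _).2 h1]

theorem glue_iso (R : IsRewire X Y f π) (p : X.Pairing) :
    ((X.glue p).rewire π).Iso (Y.glue (R.pairingEquiv p)) := by
  refine ⟨f, fun h => ?_, fun h => (R.opp h).symm⟩
  have h1 : ∀ h : X.H, f (π (X.rot (p.1 (π.symm h)))) = Y.rot (f (p.1 (f.symm (f h)))) := by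
    intro h
    rw [Equiv.symm_apply_apply, R.rot, R.pairing_comm]
  exact h1 h

theorem jPrime_eq (R : IsRewire X Y f π) (n : ℕ) : Y.jPrime n =
    if (∀ i, X.numLegs i = 2 * n) ∧ X.degree ≤ (l + 1) * n then
      ∑ p : X.Pairing, ((X.glue p).rewire π).cls else 0 := by
  simp only [Marked.jPrime, R.numLegs_eq, R.degree_eq]
  congr 1
  rw [← R.pairingEquiv.sum_comp]
  exact Finset.sum_congr rfl fun p _ => (R.glue_iso p).cls_eq.symm

end IsRewire

/-- The linear relations with coefficients `c` between the three graphs obtained from `X` by the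
permutations `π`: isomorphism, antisymmetry and Jacobi. -/
def Rel (X : Marked l) (c : Fin 3 → ℚ) (π : Fin 3 → Perm X.H) : Prop :=
  (c = ![1, -1, 0] ∧ π = ![1, 1, 1]) ∨
  (∃ h, X.rot h ≠ h ∧ c = ![1, 1, 0] ∧ π = ![1, swap (X.rot h) (X.rot.symm h), 1]) ∨
  ∃ e, X.rot e ≠ e ∧ X.rot (X.opp e) ≠ X.opp e ∧ X.opp e ≠ X.rot e ∧ X.opp e ≠ X.rot.symm e ∧
    c = ![1, -1, -1] ∧ π = ![1, swap (X.rot e) (X.rot (X.opp e)),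
      swap (X.rot e) (X.rot.symm (X.opp e))]

theorem sumCongr_swap_refl {α : Type*} [DecidableEq α] [DecidableEq (α ⊕ Bool)] (a b : α) :
    Equiv.sumCongr (swap a b) (Equiv.refl Bool) = swap (Sum.inl a) (Sum.inl b) := by
  ext x
  rcases x with h | t
  · rw [Equiv.sumCongr_apply, Sum.map_inl, swap_apply_def, swap_apply_def]
    split_ifs <;> simp_all
  · rw [Equiv.sumCongr_apply, swap_apply_of_ne_of_ne] <;> simp

theorem Marked.rot_symm_ne {X : Marked l} {h : X.H} (hh : X.rot h ≠ h) :
    X.rot (X.rot.symm h) ≠ X.rot.symm h := by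
  intro e
  rw [Equiv.apply_symm_apply] at e
  have h2 := X.rot.apply_symm_apply h
  rw [← e] at h2
  exact hh h2

theorem Marked.fuse_rot_of_ne (X : Marked l) {b c : X.H} (hX : X.Fusable b c) {h : X.H}
    (hh : X.rot h ≠ h) : (X.fuse b c hX).rot (Sum.inl h) = Sum.inl (X.rot h) :=
  fuseRot_other _ (fun e => hh (by rw [e, hX.1])) (fun e => hh (by rw [e, hX.2.1]))

theorem Marked.fuse_rot_symm_of_ne (X : Marked l) {b c : X.H} (hX : X.Fusable b c) {h : X.H}
    (hh : X.rot h ≠ h) : (X.fuse b c hX).rot.symm (Sum.inl h) = Sum.inl (X.rot.symm h) := by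
  refine (Equiv.symm_apply_eq _).2 ?_
  rw [X.fuse_rot_of_ne hX (Marked.rot_symm_ne hh), Equiv.apply_symm_apply]

/-- Joining two legs changes neither the trivalent vertices at which the relation takes place nor
the edge between them, so the relation persists with the same coefficients. -/
theorem Rel.fuse {X : Marked l} {c : Fin 3 → ℚ} {π : Fin 3 → Perm X.H} (hr : Rel X c π)
    {b d : X.H} (hX : X.Fusable b d) :
    Rel (X.fuse b d hX) c (fun t => Equiv.sumCongr (π t) (Equiv.refl Bool)) := by
  have inj : ∀ {x y : X.H}, x ≠ y → (Sum.inl x : X.H ⊕ Bool) ≠ Sum.inl y :=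
    fun h e => h (Sum.inl_injective e)
  have one : Equiv.sumCongr (1 : Perm X.H) (Equiv.refl Bool) = 1 := by
    ext x; rcases x with x | x <;> simp
  rcases hr with ⟨hc, hπ⟩ | ⟨h, h1, hc, hπ⟩ | ⟨e, h1, h2, h3, h4, hc, hπ⟩
  · refine Or.inl ⟨hc, ?_⟩
    subst hπ
    funext t
    fin_cases t <;> exact one
  · refine Or.inr (Or.inl ⟨Sum.inl h, ?_, hc, ?_⟩)
    · rw [X.fuse_rot_of_ne hX h1]
      exact inj h1
    · rw [X.fuse_rot_of_ne hX h1, X.fuse_rot_symm_of_ne hX h1]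
      subst hπ
      funext t
      fin_cases t
      · exact one
      · exact @sumCongr_swap_refl _ (_) (_) _ _
      · exact one
  · have ho : (X.fuse b d hX).opp (Sum.inl e) = Sum.inl (X.opp e) := rfl
    refine Or.inr (Or.inr ⟨Sum.inl e, ?_, ?_, ?_, ?_, hc, ?_⟩)
    · rw [X.fuse_rot_of_ne hX h1]
      exact inj h1
    · rw [ho, X.fuse_rot_of_ne hX h2]
      exact inj h2
    · rw [ho, X.fuse_rot_of_ne hX h1]
      exact inj h3
    · rw [ho, X.fuse_rot_symm_of_ne hX h1]
      exact inj h4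
    · rw [ho, X.fuse_rot_of_ne hX h1, X.fuse_rot_of_ne hX h2, X.fuse_rot_symm_of_ne hX h2]
      subst hπ
      funext t
      fin_cases t
      · exact one
      · exact @sumCongr_swap_refl _ (_) (_) _ _
      · exact @sumCongr_swap_refl _ (_) (_) _ _

theorem Marked.rot_ne_rot {X : Marked l} {h : X.H} (hh : X.rot h ≠ h) :
    X.rot (X.rot h) ≠ X.rot h ∧ X.rot (X.rot h) ≠ h := by
  refine ⟨fun e => hh (X.rot.injective e), fun e => hh ?_⟩
  have := X.rot_rot_rot h
  rw [e] at this
  exact this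

theorem Marked.glue_rot_of_ne (X : Marked l) (p : X.Pairing) {h : X.H} (hh : X.rot h ≠ h) :
    (X.glue p).rot h = X.rot h := by
  change X.rot (p.1 h) = _
  rw [(p.2.2.1 h).2 hh]

theorem Marked.glue_rot_symm_of_ne (X : Marked l) (p : X.Pairing) {h : X.H} (hh : X.rot h ≠ h) :
    (X.glue p).rot.symm h = X.rot.symm h := by
  refine (Equiv.symm_apply_eq (X.glue p).rot).2 ?_
  exact ((X.glue_rot_of_ne p (Marked.rot_symm_ne hh)).trans (Equiv.apply_symm_apply _ _)).symm

theorem Marked.glue_isTri (X : Marked l) (p : X.Pairing) {h : X.H} (hh : X.rot h ≠ h) :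
    (X.glue p).IsTri h := by
  have := Marked.rot_ne_rot hh
  change (X.glue p).rot ((X.glue p).rot h) ≠ h
  rw [X.glue_rot_of_ne p hh, X.glue_rot_of_ne p this.1]
  exact this.2

/-- Gluing legs leaves the old trivalent vertices intact, so the relation becomes one of the
defining relations of `TriSpace`. The entries with coefficient zero only pad the shorter relations
to three terms. -/
theorem Rel.sum_glue {X : Marked l} {c : Fin 3 → ℚ} {π : Fin 3 → Perm X.H} (hr : Rel X c π)
    (p : X.Pairing) : ∑ t, c t • ((X.glue p).rewire (π t)).cls = 0 := by
  rcases hr with ⟨rfl, rfl⟩ | ⟨h, h1, rfl, rfl⟩ | ⟨e, h1, h2, h3, h4, rfl, rfl⟩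
  · simp [Fin.sum_univ_three]
  · have := (X.glue p).cls_antisymm (X.glue_isTri p h1)
    rw [X.glue_rot_of_ne p h1, X.glue_rot_symm_of_ne p h1] at this
    have h1 := (X.glue p).rewire_one
    simp only [Fin.sum_univ_three, Matrix.cons_val]
    refine Eq.trans ?_ this
    rw [one_smul, one_smul, zero_smul, add_zero]
    exact congrArg (· + _) h1
  · have ho : (X.glue p).opp e = X.opp e := rfl
    have := (X.glue p).cls_jacobi (X.glue_isTri p h1) (by rw [ho]; exact X.glue_isTri p h2)
      (by rwa [ho, X.glue_rot_of_ne p h1]) (by rwa [ho, X.glue_rot_symm_of_ne p h1])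
    rw [ho, X.glue_rot_of_ne p h1, X.glue_rot_of_ne p h2, X.glue_rot_symm_of_ne p h2] at this
    have h1 := (X.glue p).rewire_one
    simp only [Fin.sum_univ_three, Matrix.cons_val]
    refine Eq.trans ?_ this
    rw [one_smul, neg_smul, neg_smul, one_smul, one_smul, ← sub_eq_add_neg, ← sub_eq_add_neg]
    exact congrArg (· - _ - _) h1

/-- The three graphs have the same pairings, numbers of legs and degree, so either all values are
zero by definition or the relation holds pairing by pairing. -/
theorem Rel.sum_jPrime {X : Marked l} {c : Fin 3 → ℚ} {π : Fin 3 → Perm X.H} (hr : Rel X c π)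
    {Y : Fin 3 → Marked l} {f : ∀ t, X.H ≃ (Y t).H} (R : ∀ t, IsRewire X (Y t) (f t) (π t))
    (n : ℕ) : ∑ t, c t • (Y t).jPrime n = 0 := by
  simp only [fun t => (R t).jPrime_eq n]
  split_ifs
  · simp only [Finset.smul_sum]
    rw [Finset.sum_comm]
    exact Finset.sum_eq_zero fun p _ => hr.sum_glue p
  · simp

/-! ### Extending `j'_n` from marked Chinese characters to words of legs -/

/-! ### Legs, colours and words after a join -/

section FuseLemmas

variable {X : Marked l} {b c : X.H} (hX : X.Fusable b c)

theorem Marked.Fusable.symm {X : Marked l} {b c : X.H} (h : X.Fusable b c) : X.Fusable c b :=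
  ⟨h.2.1, h.1, h.2.2.1.symm, h.2.2.2.symm⟩

theorem Marked.fuse_rot_left : (X.fuse b c hX).rot (Sum.inl b) = Sum.inr false := fuseRot_b _

theorem Marked.fuse_rot_right : (X.fuse b c hX).rot (Sum.inl c) = Sum.inl b :=
  fuseRot_c _ hX.2.2.1 hX.1

theorem Marked.fuse_rot_false : (X.fuse b c hX).rot (Sum.inr false) = Sum.inl c :=
  fuseRot_false _ hX.2.1

theorem Marked.fuse_rot_true : (X.fuse b c hX).rot (Sum.inr true) = Sum.inr true :=
  fuseRot_true _ _ _

theorem Marked.fuse_rot_other {h : X.H} (hb : h ≠ b) (hc : h ≠ c) :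
    (X.fuse b c hX).rot (Sum.inl h) = Sum.inl (X.rot h) := fuseRot_other _ hb hc

theorem Marked.fuse_color_other {h : X.H} (hb : h ≠ b) (hc : h ≠ c) :
    (X.fuse b c hX).color (Sum.inl h) = X.color h := by
  simp [hb, hc]

theorem Marked.fuse_color_true : (X.fuse b c hX).color (Sum.inr true) = X.color b := rfl

theorem Marked.fusable_fuse_inl {d e : X.H} (h1 : d ≠ b) (h2 : d ≠ c) (h3 : e ≠ b) (h4 : e ≠ c) :
    (X.fuse b c hX).Fusable (Sum.inl d) (Sum.inl e) ↔ X.Fusable d e := by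
  rw [Marked.Fusable, Marked.fuse_rot_other hX h1 h2, Marked.fuse_rot_other hX h3 h4,
    Marked.fuse_color_other hX h1 h2, Marked.fuse_color_other hX h3 h4]
  simp [Marked.Fusable]

theorem Marked.fusable_fuse_true {d : X.H} (h1 : d ≠ b) (h2 : d ≠ c) :
    (X.fuse b c hX).Fusable (Sum.inr true) (Sum.inl d) ↔ X.Fusable b d := by
  rw [Marked.Fusable, Marked.fuse_rot_other hX h1 h2, Marked.fuse_rot_true,
    Marked.fuse_color_other hX h1 h2, Marked.fuse_color_true]
  simp [Marked.Fusable, hX.1, h1.symm]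

theorem Marked.card_legs_fuse : (X.fuse b c hX).legs.card + 1 = X.legs.card := by
  have hb : b ∈ X.legs := Marked.mem_legs.2 hX.1
  have hc : c ∈ X.legs.erase b := Finset.mem_erase.2 ⟨hX.2.2.1.symm, Marked.mem_legs.2 hX.2.1⟩
  rw [Marked.legs_fuse, Finset.card_insert_of_notMem (by simp), Finset.card_map,
    Finset.card_erase_add_one hc, Finset.card_erase_add_one hb]

theorem Marked.mem_arr_fuse {u v : List X.H} (h : u ++ b :: c :: v ∈ arr X.legs) :
    u.map Sum.inl ++ Sum.inr true :: v.map Sum.inl ∈ arr (X.fuse b c hX).legs := by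
  rw [Marked.legs_fuse]
  have h1 := remove_mem_arr (remove_mem_arr h)
  have h2 := cons_mem_arr (y := (Sum.inr true : X.H ⊕ Bool)) (by simp)
    (map_mem_arr Function.Embedding.inl h1)
  refine mem_arr_of_perm h2 ?_
  rw [List.map_append]
  exact List.perm_middle.symm

end FuseLemmas

/-! ### The recursive extension and its two induction hypotheses -/

/-- The value of `F` on the word in which the consecutive legs `b` and `c` are joined; it is zero if
their colours differ. -/
def bracket (F : (X : Marked l) → List X.H → TriSpace) (X : Marked l) (u : List X.H) (b c : X.H)
    (v : List X.H) : TriSpace :=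
  if h : X.Fusable b c then
    F (X.fuse b c h) (u.map Sum.inl ++ Sum.inr true :: v.map Sum.inl) else 0

/-- The extension of `j'_n` to words with `k` legs. -/
def wordJ (n : ℕ) : ℕ → (X : Marked l) → List X.H → TriSpace
  | 0 => fun X _ => X.jPrime n
  | k + 1 => fun X w => X.jPrime n + potential X.legs (bracket (wordJ n k) X) w

variable (l) in
/-- `wordJ n k` respects isomorphisms, antisymmetry and Jacobi. -/
def RelInvariant (n k : ℕ) : Prop :=
  ∀ (X : Marked l) (c : Fin 3 → ℚ) (π : Fin 3 → Perm X.H), Rel X c π →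
    ∀ (Y : Fin 3 → Marked l) (f : ∀ t, X.H ≃ (Y t).H), (∀ t, IsRewire X (Y t) (f t) (π t)) →
    ∀ w ∈ arr X.legs, X.legs.card = k → ∑ t, c t • wordJ n k (Y t) (w.map (f t)) = 0

-- This guarantees that `potential` in the definition of `wordJ n (k + 1)` is a true potential on
-- graphs with `k + 1` legs and not its default value `0`. The definition of `wordJ` can thus
-- precede any proof of consistency.
variable (l) in
def StepCocycle (n k : ℕ) : Prop :=
  ∀ X : Marked l, X.legs.card = k + 1 → IsCocycle X.legs (bracket (wordJ n k) X)

theorem IsRewire.refl (X : Marked l) : IsRewire X X (Equiv.refl _) 1 :=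
  ⟨fun _ _ => rfl, fun _ => rfl, fun _ => rfl, fun _ => rfl⟩

theorem IsRewire.map_mem_arr {X Y : Marked l} {f : X.H ≃ Y.H} {π : Perm X.H}
    (R : IsRewire X Y f π) {w : List X.H} (hw : w ∈ arr X.legs) : w.map f ∈ arr Y.legs := by
  rw [R.legs_eq]
  exact ChineseChar.map_mem_arr f.toEmbedding hw

theorem IsRewire.card_legs {X Y : Marked l} {f : X.H ≃ Y.H} {π : Perm X.H}
    (R : IsRewire X Y f π) : Y.legs.card = X.legs.card := by
  rw [R.legs_eq, Finset.card_map]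

/-- The summand `X.jPrime n` does not depend on the word and cancels. -/
theorem StepCocycle.swap {n k : ℕ} (hc : StepCocycle l n k) {X : Marked l}
    (hX : X.legs.card = k + 1) {u v : List X.H} {b c : X.H} (h : u ++ b :: c :: v ∈ arr X.legs) :
    wordJ n (k + 1) X (u ++ b :: c :: v) - wordJ n (k + 1) X (u ++ c :: b :: v) =
      bracket (wordJ n k) X u b c v := by
  rw [← (hc X hX).isPotential.1 u b c v h]
  simp [wordJ]

theorem RelInvariant.zero (n : ℕ) : RelInvariant l n 0 :=
  fun _ _ _ hr _ _ R _ _ _ => hr.sum_jPrime R n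

/-- The combination of the `jPrime` terms vanishes. The combination of the potentials has mean zero,
and its differences are the same combination for the joined graphs, which is zero by the hypothesis
for `k` legs. -/
theorem RelInvariant.succ {n k : ℕ} (hk : RelInvariant l n k) (hc : StepCocycle l n k) :
    RelInvariant l n (k + 1) := by
  intro X c π hr Y f R w hw hX
  have hY : ∀ t, IsPotential (Y t).legs (bracket (wordJ n k) (Y t))
      (potential (Y t).legs (bracket (wordJ n k) (Y t))) := fun t =>
    (hc (Y t) ((R t).card_legs.trans hX)).isPotential
  simp only [wordJ, smul_add, Finset.sum_add_distrib]
  rw [hr.sum_jPrime R n, zero_add]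
  refine eq_zero_of_swap_invariant (s := X.legs) (φ := fun w =>
    ∑ t, c t • potential (Y t).legs (bracket (wordJ n k) (Y t)) (w.map (f t))) ?_ ?_ hw
  · intro u b d v h
    have hm : ∀ t, u.map (f t) ++ f t b :: f t d :: v.map (f t) ∈ arr (Y t).legs := fun t => by
      simpa using (R t).map_mem_arr h
    rw [← sub_eq_zero, ← Finset.sum_sub_distrib]
    simp only [List.map_append, List.map_cons, ← smul_sub]
    rw [Finset.sum_congr rfl fun t _ => congrArg (c t • ·) ((hY t).1 _ _ _ _ (hm t))]
    by_cases hF : X.Fusable b d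
    · have hF' : ∀ t, (Y t).Fusable (f t b) (f t d) := fun t => ((R t).fusable_iff b d).2 hF
      have key := hk (X.fuse b d hF) c _ (hr.fuse hF) _ _ (fun t => (R t).fuse hF (hF' t))
        _ (X.mem_arr_fuse hF h) (by have := X.card_legs_fuse hF; omega)
      rw [← key]
      refine Finset.sum_congr rfl fun t _ => ?_
      rw [bracket, dif_pos (hF' t)]
      simp [Function.comp_def]
    · refine Finset.sum_eq_zero fun t _ => ?_
      rw [bracket, dif_neg (mt ((R t).fusable_iff b d).1 hF), smul_zero]
  · rw [Finset.sum_comm]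
    refine Finset.sum_eq_zero fun t _ => ?_
    rw [← Finset.smul_sum]
    have := (hY t).2
    rw [(R t).legs_eq] at this ⊢
    rw [sum_arr_map] at this
    exact (congrArg (c t • ·) this).trans (smul_zero _)

/-- The triple of identifications in a relation. -/
def triple {X A B C : Marked l} (f : X.H ≃ A.H) (g : X.H ≃ B.H) (h : X.H ≃ C.H) :
    ∀ t, X.H ≃ ((![A, B, C] : Fin 3 → Marked l) t).H
  | 0 => f
  | 1 => g
  | 2 => h

theorem RelInvariant.iso {n k : ℕ} (hk : RelInvariant l n k) {X Y : Marked l} {f : X.H ≃ Y.H}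
    (R : IsRewire X Y f 1) (hX : X.legs.card = k) {w : List X.H} (hw : w ∈ arr X.legs) :
    wordJ n k Y (w.map f) = wordJ n k X w := by
  -- The third graph has coefficient zero; `X` itself fills its place.
  have := hk X ![1, -1, 0] ![1, 1, 1] (Or.inl ⟨rfl, rfl⟩) _ (triple (Equiv.refl _) f (Equiv.refl _))
    (by intro t; fin_cases t; exacts [IsRewire.refl X, R, IsRewire.refl X]) w hw hX
  simp only [Fin.sum_univ_three, Matrix.cons_val] at this
  rw [one_smul, neg_smul, one_smul, zero_smul, add_zero, ← sub_eq_add_neg, sub_eq_zero] at this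
  refine this.symm.trans ?_
  exact congrArg (wordJ n k X) (List.map_id w)

theorem RelInvariant.antisymm {n k : ℕ} (hk : RelInvariant l n k) {X Y : Marked l} {f : X.H ≃ Y.H}
    {h : X.H} (hh : X.rot h ≠ h) (R : IsRewire X Y f (swap (X.rot h) (X.rot.symm h)))
    (hX : X.legs.card = k) {w : List X.H} (hw : w ∈ arr X.legs) :
    wordJ n k X w + wordJ n k Y (w.map f) = 0 := by
  have := hk X ![1, 1, 0] ![1, _, 1] (Or.inr (Or.inl ⟨h, hh, rfl, rfl⟩)) _
    (triple (Equiv.refl _) f (Equiv.refl _))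
    (by intro t; fin_cases t; exacts [IsRewire.refl X, R, IsRewire.refl X]) w hw hX
  simp only [Fin.sum_univ_three, Matrix.cons_val] at this
  rw [one_smul, one_smul, zero_smul, add_zero] at this
  refine Eq.trans ?_ this
  exact congrArg (fun w' => wordJ n k X w' + _) (List.map_id w).symm

theorem RelInvariant.jacobi {n k : ℕ} (hk : RelInvariant l n k) {X Y Z : Marked l} {f : X.H ≃ Y.H}
    {g : X.H ≃ Z.H} {e : X.H} (h1 : X.rot e ≠ e) (h2 : X.rot (X.opp e) ≠ X.opp e)
    (h3 : X.opp e ≠ X.rot e) (h4 : X.opp e ≠ X.rot.symm e)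
    (R : IsRewire X Y f (swap (X.rot e) (X.rot (X.opp e))))
    (R' : IsRewire X Z g (swap (X.rot e) (X.rot.symm (X.opp e))))
    (hX : X.legs.card = k) {w : List X.H} (hw : w ∈ arr X.legs) :
    wordJ n k X w = wordJ n k Y (w.map f) + wordJ n k Z (w.map g) := by
  have := hk X ![1, -1, -1] ![1, _, _] (Or.inr (Or.inr ⟨e, h1, h2, h3, h4, rfl, rfl⟩)) _
    (triple (Equiv.refl _) f g)
    (by intro t; fin_cases t; exacts [IsRewire.refl X, R, R']) w hw hX
  simp only [Fin.sum_univ_three, Matrix.cons_val] at this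
  rw [one_smul, neg_smul, neg_smul, one_smul, one_smul, ← sub_eq_add_neg, ← sub_eq_add_neg,
    sub_sub, sub_eq_zero] at this
  refine Eq.trans ?_ this
  exact congrArg (fun w' => wordJ n k X w') (List.map_id w).symm

/-! #### Isomorphisms and relations between repeated fusions -/

theorem swap_inl_inr {α β : Type*} [DecidableEq (α ⊕ β)] (a b : α) (t : β) :
    swap (Sum.inl a) (Sum.inl b) (Sum.inr t : α ⊕ β) = Sum.inr t :=
  swap_apply_of_ne_of_ne (by simp) (by simp)

theorem swap_inl_other {α β : Type*} [DecidableEq (α ⊕ β)] {a b h : α} (h1 : h ≠ a) (h2 : h ≠ b) :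
    swap (Sum.inl a) (Sum.inl b) (Sum.inl h : α ⊕ β) = Sum.inl h :=
  swap_apply_of_ne_of_ne (by simpa) (by simpa)

/-- Reversing the order of the two legs reverses the new trivalent vertex. -/
theorem isRewire_fuse_symm {X : Marked l} {b c : X.H} (hX : X.Fusable b c) :
    IsRewire (X.fuse b c hX) (X.fuse c b hX.symm) (Equiv.refl _)
      (swap (Sum.inl c) (Sum.inl b)) where
  fix := by
    intro h hh
    refine swap_apply_of_ne_of_ne ?_ ?_
    · rintro rfl
      rw [Marked.fuse_rot_right] at hh
      exact hX.2.2.1 (Sum.inl_injective hh)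
    · rintro rfl
      rw [Marked.fuse_rot_left] at hh
      cases hh
  rot := by
    have hbc := hX.2.2.1
    have s0 : ∀ t : Bool, swap (Sum.inl c) (Sum.inl b) (Sum.inr t : X.H ⊕ Bool) = Sum.inr t :=
      fun t => swap_inl_inr c b t
    have s1 : ∀ h : X.H, h ≠ c → h ≠ b →
        swap (Sum.inl c) (Sum.inl b) (Sum.inl h : X.H ⊕ Bool) = Sum.inl h :=
      fun h h1 h2 => swap_inl_other h1 h2
    rintro (h | _ | _) <;> rw [symm_swap]
    · by_cases h1 : h = b
      · subst h1
        rw [swap_apply_right, Marked.fuse_rot_right, swap_apply_right]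
        exact Marked.fuse_rot_right hX.symm
      by_cases h2 : h = c
      · subst h2
        rw [swap_apply_left, Marked.fuse_rot_left, s0]
        exact Marked.fuse_rot_left hX.symm
      have h3 : X.rot h ≠ b := fun e => h1 (X.rot.injective (e.trans hX.1.symm))
      have h4 : X.rot h ≠ c := fun e => h2 (X.rot.injective (e.trans hX.2.1.symm))
      rw [s1 h h2 h1, Marked.fuse_rot_other hX h1 h2, s1 _ h4 h3]
      exact Marked.fuse_rot_other hX.symm h2 h1
    · rw [s0, Marked.fuse_rot_false hX, swap_apply_left]
      exact Marked.fuse_rot_false hX.symm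
    · rw [s0, Marked.fuse_rot_true hX, s0]
      exact Marked.fuse_rot_true hX.symm
  opp := fun _ => rfl
  color := by
    rintro (h | _ | _)
    · simp [or_comm]
    · rfl
    · simpa using hX.2.2.2.symm

/-- Exchange the two pairs of new half-edges. -/
def exchange (H : Type) : (H ⊕ Bool) ⊕ Bool ≃ (H ⊕ Bool) ⊕ Bool where
  toFun
    | Sum.inl (Sum.inl h) => Sum.inl (Sum.inl h)
    | Sum.inl (Sum.inr t) => Sum.inr t
    | Sum.inr t => Sum.inl (Sum.inr t)
  invFun
    | Sum.inl (Sum.inl h) => Sum.inl (Sum.inl h)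
    | Sum.inl (Sum.inr t) => Sum.inr t
    | Sum.inr t => Sum.inl (Sum.inr t)
  left_inv := by rintro ((_ | _) | _) <;> rfl
  right_inv := by rintro ((_ | _) | _) <;> rfl

/-- Joins of disjoint pairs are independent. Only the order in which the new half-edges are adjoined
differs, and `exchange` corrects it. -/
theorem isRewire_fuse_comm {X : Marked l} {b c d e : X.H} (hbc : X.Fusable b c)
    (hde : X.Fusable d e) (hde' : (X.fuse b c hbc).Fusable (Sum.inl d) (Sum.inl e))
    (hbc' : (X.fuse d e hde).Fusable (Sum.inl b) (Sum.inl c))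
    (h1 : d ≠ b) (h2 : d ≠ c) (h3 : e ≠ b) (h4 : e ≠ c) :
    IsRewire ((X.fuse b c hbc).fuse _ _ hde') ((X.fuse d e hde).fuse _ _ hbc') (exchange X.H) 1 where
  fix := fun _ _ => rfl
  rot := by
    have il : ∀ {x y : X.H}, x ≠ y → (Sum.inl x : X.H ⊕ Bool) ≠ Sum.inl y :=
      fun h e => h (Sum.inl_injective e)
    rintro ((h | _ | _) | _ | _)
    · change _ = exchange X.H (((X.fuse b c hbc).fuse _ _ hde').rot (Sum.inl (Sum.inl h)))
      by_cases hb : h = b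
      · subst hb
        rw [Marked.fuse_rot_other hde' (il h1.symm) (il h3.symm), Marked.fuse_rot_left hbc]
        exact Marked.fuse_rot_left hbc'
      by_cases hc : h = c
      · subst hc
        rw [Marked.fuse_rot_other hde' (il h2.symm) (il h4.symm), Marked.fuse_rot_right hbc]
        exact Marked.fuse_rot_right hbc'
      by_cases hd : h = d
      · subst hd
        rw [Marked.fuse_rot_left hde']
        exact (Marked.fuse_rot_other hbc' (il h1) (il h2)).trans
          (congrArg Sum.inl (Marked.fuse_rot_left hde))
      by_cases he : h = e
      · subst he
        rw [Marked.fuse_rot_right hde']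
        exact (Marked.fuse_rot_other hbc' (il h3) (il h4)).trans
          (congrArg Sum.inl (Marked.fuse_rot_right hde))
      rw [Marked.fuse_rot_other hde' (il hd) (il he), Marked.fuse_rot_other hbc hb hc]
      exact (Marked.fuse_rot_other hbc' (il hb) (il hc)).trans
        (congrArg Sum.inl (Marked.fuse_rot_other hde hd he))
    · change _ = exchange X.H (((X.fuse b c hbc).fuse _ _ hde').rot (Sum.inl (Sum.inr false)))
      rw [Marked.fuse_rot_other hde' (h := Sum.inr false) (by simp) (by simp),
        Marked.fuse_rot_false hbc]
      exact Marked.fuse_rot_false hbc'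
    · change _ = exchange X.H (((X.fuse b c hbc).fuse _ _ hde').rot (Sum.inl (Sum.inr true)))
      rw [Marked.fuse_rot_other hde' (h := Sum.inr true) (by simp) (by simp),
        Marked.fuse_rot_true hbc]
      exact Marked.fuse_rot_true hbc'
    · change _ = exchange X.H (((X.fuse b c hbc).fuse _ _ hde').rot (Sum.inr false))
      rw [Marked.fuse_rot_false hde']
      exact (Marked.fuse_rot_other hbc' (by simp) (by simp)).trans
        (congrArg Sum.inl (Marked.fuse_rot_false hde))
    · change _ = exchange X.H (((X.fuse b c hbc).fuse _ _ hde').rot (Sum.inr true))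
      rw [Marked.fuse_rot_true hde']
      exact (Marked.fuse_rot_other hbc' (by simp) (by simp)).trans
        (congrArg Sum.inl (Marked.fuse_rot_true hde))
  opp := by
    rintro ((h | _ | _) | _ | _) <;> rfl
  color := by
    rintro ((h | _ | _) | _ | _)
    · by_cases hb : h = b
      · subst hb
        simp [exchange]
      by_cases hc : h = c
      · subst hc
        simp [exchange]
      simp [exchange, hb, hc]
    · simp [exchange]
    · simp [exchange, h1.symm, h3.symm]
    · simp [exchange]
    · simp [exchange, h1, h2]

section DoubleFuse

variable {X : Marked l} {a b c : X.H} (hab : X.Fusable a b)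
  (habc : (X.fuse a b hab).Fusable (Sum.inr true) (Sum.inl c))

/-- Join `a` and `b`, and then the result and `c`. -/
abbrev Marked.fuseTwo : Marked l := (X.fuse a b hab).fuse (Sum.inr true) (Sum.inl c) habc

theorem Marked.fuseTwo_rot_first (hca : c ≠ a) :
    (X.fuseTwo hab habc).rot (Sum.inl (Sum.inl a)) = Sum.inl (Sum.inr false) := by
  rw [Marked.fuse_rot_other habc (by simp) (by simpa using hca.symm), Marked.fuse_rot_left hab]

theorem Marked.fuseTwo_rot_second (hcb : c ≠ b) :
    (X.fuseTwo hab habc).rot (Sum.inl (Sum.inl b)) = Sum.inl (Sum.inl a) := by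
  rw [Marked.fuse_rot_other habc (by simp) (by simpa using hcb.symm), Marked.fuse_rot_right hab]

theorem Marked.fuseTwo_rot_third :
    (X.fuseTwo hab habc).rot (Sum.inl (Sum.inl c)) = Sum.inl (Sum.inr true) :=
  Marked.fuse_rot_right habc

theorem Marked.fuseTwo_rot_other {h : X.H} (ha : h ≠ a) (hb : h ≠ b) (hc : h ≠ c) :
    (X.fuseTwo hab habc).rot (Sum.inl (Sum.inl h)) = Sum.inl (Sum.inl (X.rot h)) := by
  rw [Marked.fuse_rot_other habc (by simp) (by simpa using hc), Marked.fuse_rot_other hab ha hb]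

theorem Marked.fuseTwo_rot_inner_false :
    (X.fuseTwo hab habc).rot (Sum.inl (Sum.inr false)) = Sum.inl (Sum.inl b) := by
  rw [Marked.fuse_rot_other habc (h := Sum.inr false) (by simp) (by simp),
    Marked.fuse_rot_false hab]

theorem Marked.fuseTwo_rot_inner_true :
    (X.fuseTwo hab habc).rot (Sum.inl (Sum.inr true)) = Sum.inr false :=
  Marked.fuse_rot_left habc

theorem Marked.fuseTwo_rot_outer_false :
    (X.fuseTwo hab habc).rot (Sum.inr false) = Sum.inl (Sum.inl c) :=
  Marked.fuse_rot_false habc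

theorem Marked.fuseTwo_rot_outer_true :
    (X.fuseTwo hab habc).rot (Sum.inr true) = Sum.inr true :=
  Marked.fuse_rot_true habc

theorem Marked.fuseTwo_color :
    (X.fuseTwo hab habc).color = Sum.elim (Sum.elim (fun h => if h = a ∨ h = b ∨ h = c then none
      else X.color h) (fun _ => none)) (fun t => if t then X.color a else none) := by
  funext x
  rcases x with (h | _ | _) | _ | _
  · by_cases hc : h = c
    · simp [hc]
    · simp [hc]
  · simp
  · simp
  · simp
  · simp

end DoubleFuse

theorem fuseTwo_fix {X : Marked l} {a b c : X.H} (hab : X.Fusable a b)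
    (habc : (X.fuse a b hab).Fusable (Sum.inr true) (Sum.inl c))
    {x : (X.fuseTwo hab habc).H} (hx : (X.fuseTwo hab habc).rot x = x) :
    x ≠ Sum.inl (Sum.inl b) ∧ x ≠ Sum.inl (Sum.inl c) ∧ x ≠ Sum.inr false := by
  rw [← Marked.color_isSome, Marked.fuseTwo_color] at hx
  refine ⟨?_, ?_, ?_⟩ <;> rintro rfl <;> simp at hx

/-- Exchange the halves of the first new edge. -/
def flipInner (H : Type) : (H ⊕ Bool) ⊕ Bool ≃ (H ⊕ Bool) ⊕ Bool :=
  Equiv.sumCongr (Equiv.sumCongr (Equiv.refl H) (swap false true)) (Equiv.refl Bool)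

theorem flipInner_inl_inl (H : Type) (h : H) :
    flipInner H (Sum.inl (Sum.inl h)) = Sum.inl (Sum.inl h) := rfl

theorem flipInner_inr (H : Type) (t : Bool) : flipInner H (Sum.inr t) = Sum.inr t := rfl

section Jacobi

variable {X : Marked l} {a b c : X.H} (hab : X.Fusable a b)
  (habc : (X.fuse a b hab).Fusable (Sum.inr true) (Sum.inl c))
  (hac : a ≠ c) (hbc : b ≠ c)

-- Write `[a, b]` for the leg resulting from joining `a` and `b`. In `[[a, b], c]` the inner edge
-- connects vertices with cyclic orders `(inner false, b, a)` and `(inner true, outer false, c)`.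
-- Exchanging `b` with `outer false` gives the graph of `[[c, b], a]`, with the halves of the inner
-- edge interchanged; hence `flipInner`.
include hac hbc in
theorem isRewire_jacobi_first (hcb : X.Fusable c b)
    (hcba : (X.fuse c b hcb).Fusable (Sum.inr true) (Sum.inl a)) :
    IsRewire (X.fuseTwo hab habc) (X.fuseTwo hcb hcba) (flipInner X.H)
      (swap (Sum.inl (Sum.inl b)) (Sum.inr false)) where
  fix := fun x hx => by
    have := fuseTwo_fix hab habc hx
    exact swap_apply_of_ne_of_ne this.1 this.2.2
  rot := by
    have hab' := hab.2.2.1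
    have s0 : ∀ (_ : DecidableEq ((X.H ⊕ Bool) ⊕ Bool)) (x : (X.H ⊕ Bool) ⊕ Bool),
        x ≠ Sum.inl (Sum.inl b) → x ≠ Sum.inr false →
        swap (Sum.inl (Sum.inl b)) (Sum.inr false) x = x :=
      fun _ x h1 h2 => swap_apply_of_ne_of_ne h1 h2
    rintro ((h | _ | _) | _ | _) <;> rw [symm_swap]
    · by_cases ha : h = a
      · subst ha
        rw [s0 _ (Sum.inl (Sum.inl h)) (by simpa) (by simp), Marked.fuseTwo_rot_first _ _ hac.symm,
          s0 _ _ (by simp) (by simp)]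
        exact Marked.fuseTwo_rot_third hcb hcba
      by_cases hb : h = b
      · subst hb
        rw [swap_apply_left, Marked.fuseTwo_rot_outer_false, s0 _ _ (by simpa using hbc.symm) (by simp)]
        exact Marked.fuseTwo_rot_second hcb hcba hab'
      by_cases hc : h = c
      · subst hc
        rw [s0 _ (Sum.inl (Sum.inl h)) (by simpa) (by simp), Marked.fuseTwo_rot_third,
          s0 _ _ (by simp) (by simp)]
        exact Marked.fuseTwo_rot_first hcb hcba hac
      have h1 : X.rot h ≠ b := fun e => hb (X.rot.injective (e.trans hab.2.1.symm))
      rw [s0 _ (Sum.inl (Sum.inl h)) (by simpa) (by simp), Marked.fuseTwo_rot_other _ _ ha hb hc,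
        s0 _ _ (by simpa) (by simp)]
      exact Marked.fuseTwo_rot_other hcb hcba hc hb ha
    · rw [s0 _ (Sum.inl (Sum.inr false)) (by simp) (by simp), Marked.fuseTwo_rot_inner_false, swap_apply_left]
      exact Marked.fuseTwo_rot_inner_true hcb hcba
    · rw [s0 _ (Sum.inl (Sum.inr true)) (by simp) (by simp), Marked.fuseTwo_rot_inner_true, swap_apply_right]
      exact Marked.fuseTwo_rot_inner_false hcb hcba
    · rw [swap_apply_right, Marked.fuseTwo_rot_second _ _ hbc.symm, s0 _ _ (by simpa) (by simp)]
      exact Marked.fuseTwo_rot_outer_false hcb hcba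
    · rw [s0 _ (Sum.inr true) (by simp) (by simp), Marked.fuseTwo_rot_outer_true, s0 _ _ (by simp) (by simp)]
      exact Marked.fuseTwo_rot_outer_true hcb hcba
  opp := by
    rintro ((h | _ | _) | _ | _) <;> rfl
  color := by
    rw [Marked.fuseTwo_color, Marked.fuseTwo_color]
    have e : X.color a = X.color c := hab.2.2.2.trans hcb.2.2.2.symm
    rintro ((h | t) | t)
    · have : h = c ∨ h = b ∨ h = a ↔ h = a ∨ h = b ∨ h = c := by tauto
      change (if h = c ∨ h = b ∨ h = a then none else X.color h) = _
      simp [this]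
    · rfl
    · change (if t = true then X.color c else none) = _
      simp [e]

-- Exchanging `b` with `c` gives `[[a, c], b]`, with the inner edge keeping its direction.
include hac hbc in
theorem isRewire_jacobi_second (hac' : X.Fusable a c)
    (hacb : (X.fuse a c hac').Fusable (Sum.inr true) (Sum.inl b)) :
    IsRewire (X.fuseTwo hab habc) (X.fuseTwo hac' hacb) (Equiv.refl _)
      (swap (Sum.inl (Sum.inl b)) (Sum.inl (Sum.inl c))) where
  fix := fun x hx => by
    have := fuseTwo_fix hab habc hx
    exact swap_apply_of_ne_of_ne this.1 this.2.1
  rot := by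
    have hab' := hab.2.2.1
    have s0 : ∀ (_ : DecidableEq ((X.H ⊕ Bool) ⊕ Bool)) (x : (X.H ⊕ Bool) ⊕ Bool),
        x ≠ Sum.inl (Sum.inl b) → x ≠ Sum.inl (Sum.inl c) →
        swap (Sum.inl (Sum.inl b)) (Sum.inl (Sum.inl c)) x = x :=
      fun _ x h1 h2 => swap_apply_of_ne_of_ne h1 h2
    rintro ((h | _ | _) | _ | _) <;> rw [symm_swap]
    · by_cases ha : h = a
      · subst ha
        rw [s0 _ (Sum.inl (Sum.inl h)) (by simpa) (by simpa), Marked.fuseTwo_rot_first _ _ hac.symm,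
          s0 _ _ (by simp) (by simp)]
        exact Marked.fuseTwo_rot_first hac' hacb hab'.symm
      by_cases hb : h = b
      · subst hb
        rw [swap_apply_left, Marked.fuseTwo_rot_third, s0 _ _ (by simp) (by simp)]
        exact Marked.fuseTwo_rot_third hac' hacb
      by_cases hc : h = c
      · subst hc
        rw [swap_apply_right, Marked.fuseTwo_rot_second _ _ hbc.symm, s0 _ _ (by simpa) (by simpa)]
        exact Marked.fuseTwo_rot_second hac' hacb hbc
      have h1 : X.rot h ≠ b := fun e => hb (X.rot.injective (e.trans hab.2.1.symm))
      have h2 : X.rot h ≠ c := fun e => hc (X.rot.injective (e.trans hac'.2.1.symm))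
      rw [s0 _ (Sum.inl (Sum.inl h)) (by simpa) (by simpa), Marked.fuseTwo_rot_other _ _ ha hb hc,
        s0 _ _ (by simpa) (by simpa)]
      exact Marked.fuseTwo_rot_other hac' hacb ha hc hb
    · rw [s0 _ (Sum.inl (Sum.inr false)) (by simp) (by simp), Marked.fuseTwo_rot_inner_false, swap_apply_left]
      exact Marked.fuseTwo_rot_inner_false hac' hacb
    · rw [s0 _ (Sum.inl (Sum.inr true)) (by simp) (by simp), Marked.fuseTwo_rot_inner_true, s0 _ _ (by simp) (by simp)]
      exact Marked.fuseTwo_rot_inner_true hac' hacb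
    · rw [s0 _ (Sum.inr false) (by simp) (by simp), Marked.fuseTwo_rot_outer_false, swap_apply_right]
      exact Marked.fuseTwo_rot_outer_false hac' hacb
    · rw [s0 _ (Sum.inr true) (by simp) (by simp), Marked.fuseTwo_rot_outer_true, s0 _ _ (by simp) (by simp)]
      exact Marked.fuseTwo_rot_outer_true hac' hacb
  opp := fun _ => rfl
  color := by
    rw [Marked.fuseTwo_color, Marked.fuseTwo_color]
    rintro ((h | t) | t)
    · have : h = a ∨ h = c ∨ h = b ↔ h = a ∨ h = b ∨ h = c := by tauto
      simp [this]
    · rfl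
    · rfl

end Jacobi

/-- The Jacobi relation at the inner edge, read as the Jacobi identity `[[a, b], c] = [[c, b], a] +
[[a, c], b]`. -/
theorem RelInvariant.jacobi_fuse {n k : ℕ} (hk : RelInvariant l n k) {X : Marked l} {a b c : X.H}
    (hab : X.Fusable a b) (habc : (X.fuse a b hab).Fusable (Sum.inr true) (Sum.inl c))
    (hcb : X.Fusable c b) (hcba : (X.fuse c b hcb).Fusable (Sum.inr true) (Sum.inl a))
    (hac : X.Fusable a c) (hacb : (X.fuse a c hac).Fusable (Sum.inr true) (Sum.inl b))
    (hX : (X.fuseTwo hab habc).legs.card = k) {w : List ((X.H ⊕ Bool) ⊕ Bool)}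
    (hw : w ∈ arr (X.fuseTwo hab habc).legs) :
    wordJ n k (X.fuseTwo hab habc) w =
      wordJ n k (X.fuseTwo hcb hcba) (w.map (flipInner X.H)) +
        wordJ n k (X.fuseTwo hac hacb) w := by
  have e1 := Marked.fuseTwo_rot_inner_false hab habc
  have e2 := Marked.fuseTwo_rot_inner_true hab habc
  have e3 : (X.fuseTwo hab habc).rot.symm (Sum.inl (Sum.inr true)) = Sum.inl (Sum.inl c) :=
    (Equiv.symm_apply_eq _).2 (Marked.fuseTwo_rot_third hab habc).symm
  have e4 : (X.fuseTwo hab habc).rot.symm (Sum.inl (Sum.inr false)) = Sum.inl (Sum.inl a) :=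
    (Equiv.symm_apply_eq _).2 (Marked.fuseTwo_rot_first hab habc hac.2.2.1.symm).symm
  have ho : (X.fuseTwo hab habc).opp (Sum.inl (Sum.inr false)) = Sum.inl (Sum.inr true) := rfl
  have := hk.jacobi (X := X.fuseTwo hab habc) (Y := X.fuseTwo hcb hcba)
    (Z := X.fuseTwo hac hacb) (e := Sum.inl (Sum.inr false))
    (f := flipInner X.H) (g := Equiv.refl _)
    (by rw [e1]; simp) (by rw [ho, e2]; simp) (by rw [ho, e1]; simp) (by rw [ho, e4]; simp)
    (by rw [ho, e1, e2]; convert isRewire_jacobi_first hab habc hac.2.2.1 hcb.2.2.1.symm hcb hcba)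
    (by rw [ho, e1, e3]; convert isRewire_jacobi_second hab habc hac.2.2.1 hcb.2.2.1.symm hac hacb)
    hX hw
  refine this.trans ?_
  exact congrArg (fun w' => _ + wordJ n k (X.fuseTwo hac hacb) w') (List.map_id w)

/-! #### The cocycle property -/

/-- For equal colours this is antisymmetry at the new vertex; otherwise both sides are zero. -/
theorem bracket_antisymm {n k : ℕ} (hk : RelInvariant l n k) {X : Marked l}
    (hX : X.legs.card = k + 1) {u v : List X.H} {b c : X.H} (h : u ++ b :: c :: v ∈ arr X.legs) :
    bracket (wordJ n k) X u c b v = - bracket (wordJ n k) X u b c v := by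
  by_cases hbc : X.Fusable b c
  · rw [bracket, dif_pos hbc.symm, bracket, dif_pos hbc]
    have e : (X.fuse b c hbc).rot.symm (Sum.inr false) = Sum.inl b :=
      (Equiv.symm_apply_eq _).2 (Marked.fuse_rot_left hbc).symm
    have := hk.antisymm (X := X.fuse b c hbc) (Y := X.fuse c b hbc.symm) (h := Sum.inr false) (f := Equiv.refl _)
      (by rw [Marked.fuse_rot_false hbc]; simp)
      (by rw [Marked.fuse_rot_false hbc, e]; convert isRewire_fuse_symm hbc)
      (by have := X.card_legs_fuse hbc; omega) (X.mem_arr_fuse hbc h)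
    rw [eq_neg_iff_add_eq_zero, add_comm]
    refine Eq.trans ?_ this
    exact congrArg (_ + ·) (congrArg (wordJ n k (X.fuse c b hbc.symm)) (List.map_id _).symm)
  · rw [bracket, dif_neg (fun h => hbc h.symm), bracket, dif_neg hbc, neg_zero]

/-- Joining `b` and `c`, and then `d` and `e`, in two disjoint places. -/
theorem bracket_swap {n k : ℕ} (hc : StepCocycle l n k) {X : Marked l} (hX : X.legs.card = k + 2)
    {u v w : List X.H} {b c d e : X.H} (h : u ++ b :: c :: (v ++ d :: e :: w) ∈ arr X.legs) :
    bracket (wordJ n (k + 1)) X u b c (v ++ d :: e :: w) -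
      bracket (wordJ n (k + 1)) X u b c (v ++ e :: d :: w) =
    if hbc : X.Fusable b c then bracket (wordJ n k) (X.fuse b c hbc)
      (u.map Sum.inl ++ Sum.inr true :: v.map Sum.inl) (Sum.inl d) (Sum.inl e) (w.map Sum.inl)
    else 0 := by
  by_cases hbc : X.Fusable b c
  · rw [dif_pos hbc, bracket, dif_pos hbc, bracket, dif_pos hbc]
    have h1 := X.mem_arr_fuse hbc h
    have h2 := hc.swap (X := X.fuse b c hbc) (u := u.map Sum.inl ++ Sum.inr true :: v.map Sum.inl)
      (b := Sum.inl d) (c := Sum.inl e) (v := w.map Sum.inl)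
      (by have := X.card_legs_fuse hbc; omega) (by simpa using h1)
    rw [← h2]
    simp
  · rw [dif_neg hbc, bracket, dif_neg hbc, bracket, dif_neg hbc, sub_zero]

/-- The other pair of opposite sides of the square: `d` and `e` are joined, and the exchange of `b`
and `c` is resolved by STU. -/
theorem bracket_swap_left {n k : ℕ} (hc : StepCocycle l n k) {X : Marked l}
    (hX : X.legs.card = k + 2)
    {u v w : List X.H} {b c d e : X.H} (h : u ++ b :: c :: (v ++ d :: e :: w) ∈ arr X.legs) :
    bracket (wordJ n (k + 1)) X (u ++ b :: c :: v) d e w -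
      bracket (wordJ n (k + 1)) X (u ++ c :: b :: v) d e w =
    if hde : X.Fusable d e then bracket (wordJ n k) (X.fuse d e hde)
      (u.map Sum.inl) (Sum.inl b) (Sum.inl c) (v.map Sum.inl ++ Sum.inr true :: w.map Sum.inl)
    else 0 := by
  by_cases hde : X.Fusable d e
  · rw [dif_pos hde, bracket, dif_pos hde, bracket, dif_pos hde]
    have h1 := X.mem_arr_fuse (u := u ++ b :: c :: v) (v := w) hde (by simpa using h)
    have h2 := hc.swap (X := X.fuse d e hde) (u := u.map Sum.inl)
      (b := Sum.inl b) (c := Sum.inl c) (v := v.map Sum.inl ++ Sum.inr true :: w.map Sum.inl)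
      (by have := X.card_legs_fuse hde; omega) (by simpa using h1)
    rw [← h2]
    simp
  · rw [dif_neg hde, bracket, dif_neg hde, bracket, dif_neg hde, sub_zero]

/-- Two opposite sides of the hexagon differ by moving the joined leg `[a, b]` past `c`, which by
STU produces `[[a, b], c]`. -/
theorem bracket_pass {n k : ℕ} (hc : StepCocycle l n k) {X : Marked l} (hX : X.legs.card = k + 2)
    {u v : List X.H} {a b c : X.H} (h : u ++ a :: b :: c :: v ∈ arr X.legs) :
    bracket (wordJ n (k + 1)) X u a b (c :: v) -
      bracket (wordJ n (k + 1)) X (u ++ [c]) a b v =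
    if hab : X.Fusable a b then bracket (wordJ n k) (X.fuse a b hab)
      (u.map Sum.inl) (Sum.inr true) (Sum.inl c) (v.map Sum.inl)
    else 0 := by
  by_cases hab : X.Fusable a b
  · rw [dif_pos hab, bracket, dif_pos hab, bracket, dif_pos hab]
    have h1 := X.mem_arr_fuse hab h
    have h2 := hc.swap (X := X.fuse a b hab) (u := u.map Sum.inl)
      (b := Sum.inr true) (c := Sum.inl c) (v := v.map Sum.inl)
      (by have := X.card_legs_fuse hab; omega) (by simpa using h1)
    rw [← h2]
    simp
  · rw [dif_neg hab, bracket, dif_neg hab, bracket, dif_neg hab, sub_zero]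

/-- With a single leg there are no adjacent pairs. -/
theorem StepCocycle.of_small (n : ℕ) : StepCocycle l n 0 := by
  intro X hX
  have hlen : ∀ (u v : List X.H) (b c : X.H), u ++ b :: c :: v ∉ arr X.legs := by
    intro u v b c h
    have := length_of_mem_arr h
    simp at this
    omega
  exact ⟨fun u b c v h => (hlen _ _ _ _ h).elim, fun u b c v d e w h => (hlen _ _ _ _ h).elim,
    fun u a b c v h => (hlen _ _ _ _ h).elim⟩

/-- Both sides of the square condition become the value of the graph with both pairs joined, in
either order. In the hexagon condition the three pairs of opposite sides become the three terms of
the Jacobi identity. -/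
theorem StepCocycle.succ {n k : ℕ} (hk : RelInvariant l n k) (hk' : RelInvariant l n (k + 1))
    (hc : StepCocycle l n k) : StepCocycle l n (k + 1) := by
  intro X hX
  refine ⟨fun u b c v h => bracket_antisymm hk' hX h, ?_, ?_⟩
  · intro u b c v d e w h
    rw [bracket_swap hc hX h, bracket_swap_left hc hX h]
    have hnd : (b :: c :: (v ++ d :: e :: w)).Nodup :=
      (List.nodup_append.1 (mem_arr.1 h).1).2.1
    simp only [List.nodup_cons, List.mem_cons, List.mem_append, not_or] at hnd
    have n1 : d ≠ b := fun e => hnd.1.2.2.1 e.symm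
    have n2 : d ≠ c := fun e => hnd.2.1.2.1 e.symm
    have n3 : e ≠ b := fun e => hnd.1.2.2.2.1 e.symm
    have n4 : e ≠ c := fun e => hnd.2.1.2.2.1 e.symm
    by_cases hbc : X.Fusable b c <;> by_cases hde : X.Fusable d e
    · have hde' := (Marked.fusable_fuse_inl hbc n1 n2 n3 n4).2 hde
      have hbc' := (Marked.fusable_fuse_inl hde n1.symm n3.symm n2.symm n4.symm).2 hbc
      rw [dif_pos hbc, dif_pos hde, bracket, dif_pos hde', bracket, dif_pos hbc']
      have h1 := X.mem_arr_fuse hbc h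
      have h2 := (X.fuse b c hbc).mem_arr_fuse (b := Sum.inl d) (c := Sum.inl e)
        (u := u.map Sum.inl ++ Sum.inr true :: v.map Sum.inl) (v := w.map Sum.inl) hde'
        (by simpa using h1)
      have := hk.iso (isRewire_fuse_comm hbc hde hde' hbc' n1 n2 n3 n4)
        (by have := X.card_legs_fuse hbc; have := (X.fuse b c hbc).card_legs_fuse hde'; omega) h2
      rw [← this]
      congr 1
      simp [Function.comp_def, exchange]
    · rw [dif_pos hbc, dif_neg hde, bracket,
        dif_neg (mt (Marked.fusable_fuse_inl hbc n1 n2 n3 n4).1 hde)]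
    · rw [dif_neg hbc, dif_pos hde, bracket, dif_neg
        (mt (Marked.fusable_fuse_inl hde n1.symm n3.symm n2.symm n4.symm).1 hbc)]
    · rw [dif_neg hbc, dif_neg hde]
  · intro u a b c v h
    have hnd : (a :: b :: c :: v).Nodup := (List.nodup_append.1 (mem_arr.1 h).1).2.1
    simp only [List.nodup_cons, List.mem_cons, not_or] at hnd
    have hab : a ≠ b := hnd.1.1
    have hac : a ≠ c := hnd.1.2.1
    have hbc : b ≠ c := hnd.2.1.1
    have leg : ∀ x, x ∈ u ++ a :: b :: c :: v → X.rot x = x := fun x hx =>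
      Marked.mem_legs.1 (((mem_arr.1 h).2 x).1 hx)
    have la := leg a (by simp)
    have lb := leg b (by simp)
    have lc := leg c (by simp)
    have p1 := bracket_pass hc hX h
    have h' : u ++ a :: c :: b :: v ∈ arr X.legs :=
      mem_arr_of_perm h (List.Perm.append_left _ (List.Perm.cons _ (List.Perm.swap _ _ _)))
    have p2 := bracket_pass hc hX h'
    have h'' : u ++ c :: b :: a :: v ∈ arr X.legs := by
      refine mem_arr_of_perm h (List.Perm.append_left _ ?_)
      exact (List.Perm.swap _ _ _).trans ((List.Perm.cons _ (List.Perm.swap _ _ _)).trans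
        (List.Perm.swap _ _ _))
    have p3 := bracket_pass hc hX h''
    have a1 := bracket_antisymm hk' hX (u := u) (b := b) (c := c) (v := a :: v)
      (mem_arr_swap h'')
    have a2 := bracket_antisymm hk' hX (u := u ++ [a]) (b := b) (c := c) (v := v) (by simpa using h)
    rw [a1, a2] at p3
    -- By `p1`, `p2`, `p3` the hexagon is equivalent to `[[a, b], c] = [[c, b], a] + [[a, c], b]`.
    suffices hs : (if hab : X.Fusable a b then bracket (wordJ n k) (X.fuse a b hab)
          (u.map Sum.inl) (Sum.inr true) (Sum.inl c) (v.map Sum.inl) else 0) =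
        (if hcb : X.Fusable c b then bracket (wordJ n k) (X.fuse c b hcb)
          (u.map Sum.inl) (Sum.inr true) (Sum.inl a) (v.map Sum.inl) else 0) +
        (if hac : X.Fusable a c then bracket (wordJ n k) (X.fuse a c hac)
          (u.map Sum.inl) (Sum.inr true) (Sum.inl b) (v.map Sum.inl) else 0) by
      rw [← p1, ← p2, ← p3] at hs
      rw [← sub_eq_zero] at hs ⊢
      rw [← hs]
      abel
    by_cases hcol : X.color a = X.color b ∧ X.color a = X.color c
    · have fab : X.Fusable a b := ⟨la, lb, hab, hcol.1⟩
      have fac : X.Fusable a c := ⟨la, lc, hac, hcol.2⟩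
      have fcb : X.Fusable c b := ⟨lc, lb, hbc.symm, hcol.2.symm.trans hcol.1⟩
      have fabc := (Marked.fusable_fuse_true fab hac.symm hbc.symm).2 fac
      have facb := (Marked.fusable_fuse_true fac hab.symm hbc).2 fab
      have fcba := (Marked.fusable_fuse_true fcb hac hab).2 fac.symm
      simp only [bracket]
      rw [dif_pos fab, dif_pos fac, dif_pos fcb, dif_pos fabc, dif_pos facb, dif_pos fcba]
      have h1 := X.mem_arr_fuse fab h
      have h2 := (X.fuse a b fab).mem_arr_fuse (b := Sum.inr true) (c := Sum.inl c)
        (u := u.map Sum.inl) (v := v.map Sum.inl) fabc (by simpa using h1)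
      have := hk.jacobi_fuse fab fabc fcb fcba fac facb
        (by
          have := X.card_legs_fuse fab
          have := (X.fuse a b fab).card_legs_fuse fabc
          change ((X.fuse a b fab).fuse _ _ fabc).legs.card = k
          omega) h2
      rw [this]
      congr 2
      simp [Function.comp_def, flipInner_inl_inl, flipInner_inr]
    -- A double join requires all three colours to agree, so otherwise every term is zero.
    · have z1 : ∀ fab : X.Fusable a b, ¬ (X.fuse a b fab).Fusable (Sum.inr true) (Sum.inl c) :=
        fun fab hf => hcol ⟨fab.2.2.2, ((Marked.fusable_fuse_true fab hac.symm hbc.symm).1 hf).2.2.2⟩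
      have z2 : ∀ fcb : X.Fusable c b, ¬ (X.fuse c b fcb).Fusable (Sum.inr true) (Sum.inl a) :=
        fun fcb hf => by
          have := ((Marked.fusable_fuse_true fcb hac hab).1 hf).2.2.2
          exact hcol ⟨this.symm.trans fcb.2.2.2, this.symm⟩
      have z3 : ∀ fac : X.Fusable a c, ¬ (X.fuse a c fac).Fusable (Sum.inr true) (Sum.inl b) :=
        fun fac hf => hcol ⟨((Marked.fusable_fuse_true fac hab.symm hbc).1 hf).2.2.2, fac.2.2.2⟩
      simp [bracket, z1, z2, z3]

theorem relInvariant_and_stepCocycle (n k : ℕ) : RelInvariant l n k ∧ StepCocycle l n k := by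
  induction k with
  | zero => exact ⟨RelInvariant.zero n, StepCocycle.of_small n⟩
  | succ k ih =>
    have h := ih.1.succ ih.2
    exact ⟨h, ih.2.succ ih.1 h⟩

/-! #### The value on a word -/

/-- The extension of `j'_n` to words containing every leg once. -/
def wordValue (n : ℕ) (X : Marked l) (w : List X.H) : TriSpace := wordJ n X.legs.card X w

theorem wordValue_iso (n : ℕ) {X Y : Marked l} {f : X.H ≃ Y.H} (R : IsRewire X Y f 1)
    {w : List X.H} (hw : w ∈ arr X.legs) : wordValue n Y (w.map f) = wordValue n X w := by
  rw [wordValue, R.card_legs]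
  exact (relInvariant_and_stepCocycle n _).1.iso R rfl hw

theorem card_legs_pos {X : Marked l} {u v : List X.H} {b : X.H} (h : u ++ b :: v ∈ arr X.legs) :
    X.legs.card = X.legs.card - 1 + 1 := by
  have := length_of_mem_arr h
  simp at this
  omega

theorem wordValue_swap (n : ℕ) {X : Marked l} {u v : List X.H} {b c : X.H}
    (h : u ++ b :: c :: v ∈ arr X.legs) :
    wordValue n X (u ++ b :: c :: v) - wordValue n X (u ++ c :: b :: v) =
      bracket (wordValue n) X u b c v := by
  have hX := card_legs_pos h
  have := (relInvariant_and_stepCocycle n _).2.swap hX h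
  rw [← hX] at this
  refine this.trans ?_
  simp only [bracket]
  split_ifs with hbc
  · rw [wordValue]
    congr 1
    have := X.card_legs_fuse hbc
    omega
  · rfl

/-- The potential has mean zero, so only the constant term of `wordJ` contributes. -/
theorem sum_wordValue (n : ℕ) (X : Marked l) :
    ∑ w ∈ arr X.legs, wordValue n X w = (X.legs.card.factorial : ℚ) • X.jPrime n := by
  unfold wordValue
  rcases hX : X.legs.card with _ | k
  · rw [Finset.card_eq_zero] at hX
    rw [hX, arr_empty]
    simp [wordJ]
  · simp only [wordJ, Finset.sum_add_distrib, Finset.sum_const, card_arr, hX]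
    rw [((relInvariant_and_stepCocycle n k).2 X hX).isPotential.2, add_zero, Nat.cast_smul_eq_nsmul]

/-! ### Joining a leg to all other legs -/

theorem Marked.numLegs_fuse {X : Marked l} {b c : X.H} (hX : X.Fusable b c) (i : Fin l) :
    (X.fuse b c hX).numLegs i = X.numLegs i - if X.color b = some i then 1 else 0 := by
  have e : ∀ Y : Marked l, Y.numLegs i = (Y.legs.filter fun h => Y.color h = some i).card := by
    intro Y
    refine Nat.subtype_card _ fun h => ?_
    rw [Finset.mem_filter, Marked.mem_legs, ← Y.color_isSome, and_iff_right_iff_imp]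
    intro hh
    rw [hh, Option.isSome_some]
  rw [e, e]
  have hbc := hX.2.2.1
  split_ifs with hi
  · have hb : b ∈ X.legs.filter fun h => X.color h = some i :=
      Finset.mem_filter.2 ⟨Marked.mem_legs.2 hX.1, hi⟩
    have hc : c ∈ (X.legs.filter fun h => X.color h = some i).erase b :=
      Finset.mem_erase.2 ⟨hbc.symm, Finset.mem_filter.2 ⟨Marked.mem_legs.2 hX.2.1, hX.2.2.2 ▸ hi⟩⟩
    have : (X.fuse b c hX).legs.filter (fun h => (X.fuse b c hX).color h = some i) =
        insert (Sum.inr true) ((((X.legs.filter fun h => X.color h = some i).erase b).erase c).map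
          Function.Embedding.inl) := by
      rw [Marked.legs_fuse]
      ext h
      rcases h with h | _ | _
      · by_cases h1 : h = b
        · simp [h1]
        by_cases h2 : h = c
        · simp [h2]
        simp [h1, h2]
      · simp
      · simp [hi]
    rw [this, Finset.card_insert_of_notMem (by simp), Finset.card_map,
      Finset.card_erase_add_one hc, Finset.card_erase_of_mem hb]
  · have : (X.fuse b c hX).legs.filter (fun h => (X.fuse b c hX).color h = some i) =
        (X.legs.filter fun h => X.color h = some i).map Function.Embedding.inl := by
      have hi' : X.color c ≠ some i := hX.2.2.2 ▸ hi
      rw [Marked.legs_fuse]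
      ext h
      rcases h with h | _ | _
      · by_cases h1 : h = b
        · simp [h1, hi]
        by_cases h2 : h = c
        · simp [h2, hi']
        simp [h1, h2]
      · simp
      · simp [hi]
    rw [this, Finset.card_map, Nat.sub_zero]

theorem Marked.card_isLeg (X : Marked l) : Nat.card {h : X.H // X.IsLeg h} = X.legs.card :=
  Nat.subtype_card _ fun _ => Marked.mem_legs

/-- The number of half-edges at trivalent vertices. -/
def Marked.numInner (X : Marked l) : ℕ := Nat.card {h : X.H // ¬ X.IsLeg h}

theorem Marked.numInner_eq (X : Marked l) : X.numInner + X.legs.card = Nat.card X.H := by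
  rw [← X.card_isLeg, Marked.numInner, add_comm]
  have := Fintype.ofFinite X.H
  rw [Nat.card_eq_fintype_card, Nat.card_eq_fintype_card, Nat.card_eq_fintype_card]
  rw [Fintype.card_subtype_compl]
  have := Fintype.card_subtype_le X.IsLeg
  omega

theorem Marked.numInner_fuse {X : Marked l} {b c : X.H} (hX : X.Fusable b c) :
    (X.fuse b c hX).numInner = X.numInner + 3 := by
  have h1 := X.numInner_eq
  have h2 := (X.fuse b c hX).numInner_eq
  have h3 := X.card_legs_fuse hX
  have h4 : Nat.card (X.H ⊕ Bool) = Nat.card X.H + 2 := by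
    rw [Nat.card_sum, Nat.card_eq_two_iff.2 ⟨false, true, by simp, by ext x; cases x <;> simp⟩]
  have h5 : Nat.card (X.fuse b c hX).H = Nat.card X.H + 2 := h4
  omega

/-- One univalent vertex is lost and one trivalent vertex is gained. -/
theorem Marked.degree_fuse {X : Marked l} {b c : X.H} (hX : X.Fusable b c) :
    (X.fuse b c hX).degree = X.degree := by
  have h1 := Marked.numInner_fuse hX
  have h2 := X.card_legs_fuse hX
  have h3 := X.card_isLeg
  have h4 := (X.fuse b c hX).card_isLeg
  rw [Marked.numInner, Marked.numInner] at h1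
  rw [UTGraph.degree, UTGraph.degree, UTGraph.numVertices, UTGraph.numVertices]
  congr 1
  rw [h3, h4, h1]
  omega

/-! ### Pairings that leave one leg free -/

/-- A pairing of all legs except `x`, each pair being of one colour. -/
def Marked.PairingExcept (X : Marked l) (x : X.H) : Type :=
  {q : Perm X.H // (∀ h, q (q h) = h) ∧ (∀ h, q h = h ↔ ¬ X.IsLeg h ∨ h = x) ∧
    ∀ h, X.color (q h) = X.color h}

instance {l : ℕ} (X : Marked l) (x : X.H) : Finite (X.PairingExcept x) := Subtype.finite

instance {l : ℕ} (X : Marked l) (x : X.H) : Fintype (X.PairingExcept x) := Fintype.ofFinite _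

namespace Marked.PairingExcept

variable {X : Marked l} {x : X.H} (q : X.PairingExcept x)

theorem leg_apply {h : X.H} : X.rot (q.1 h) = q.1 h ↔ X.rot h = h := by
  rw [← X.color_isSome, ← X.color_isSome, q.2.2.2]

theorem apply_self : q.1 x = x := (q.2.2.1 x).2 (Or.inr rfl)

theorem apply_ne {y : X.H} (hy : X.rot y = y) (hyx : y ≠ x) : q.1 y ≠ y := fun e =>
  ((q.2.2.1 y).1 e).elim (fun h => h hy) hyx

theorem apply_ne_self {y : X.H} (hyx : y ≠ x) : q.1 y ≠ x := fun e =>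
  hyx (q.1.injective (e.trans q.apply_self.symm))

theorem apply_of_not_leg {y : X.H} (hy : X.rot y ≠ y) : q.1 y = y := (q.2.2.1 y).2 (Or.inl hy)

end Marked.PairingExcept

/-- Glue the legs according to `q` and join `x` to the middle of the edge glued at `y`; the cyclic
order at the new trivalent vertex is `(x, q y, y)`. -/
def Marked.glueAt (X : Marked l) (x : X.H) (q : X.PairingExcept x) (y : X.H)
    (hx : X.rot x = x) (hy : X.rot y = y) (hyx : y ≠ x) : TriGraph where
  H := X.H
  rot := X.rot * q.1 * swap x y
  rot_ne := by
    intro h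
    simp only [Perm.mul_apply]
    by_cases h1 : h = x
    · subst h1
      rw [swap_apply_left, q.leg_apply.2 hy]
      exact q.apply_ne_self hyx
    by_cases h2 : h = y
    · subst h2
      rw [swap_apply_right, q.apply_self, hx]
      exact hyx.symm
    rw [swap_apply_of_ne_of_ne h1 h2]
    by_cases h3 : X.rot h = h
    · rw [q.leg_apply.2 h3]
      exact q.apply_ne h3 h1
    · rwa [q.apply_of_not_leg h3]
  valence := by
    intro h
    have rx : X.rot (q.1 (swap x y x)) = q.1 y := by rw [swap_apply_left, q.leg_apply.2 hy]
    have ry : X.rot (q.1 (swap x y y)) = x := by rw [swap_apply_right, q.apply_self, hx]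
    have rq : X.rot (q.1 (swap x y (q.1 y))) = y := by
      rw [swap_apply_of_ne_of_ne (q.apply_ne_self hyx) (q.apply_ne hy hyx), q.2.1, hy]
    simp only [Perm.mul_apply]
    by_cases h1 : h = x
    · subst h1
      right
      rw [rx, rq, ry]
    by_cases h2 : h = y
    · subst h2
      right
      rw [ry, rx, rq]
    by_cases h4 : h = q.1 y
    · subst h4
      right
      rw [rq, ry, rx]
    rw [swap_apply_of_ne_of_ne h1 h2]
    by_cases h3 : X.rot h = h
    · left
      rw [q.leg_apply.2 h3, swap_apply_of_ne_of_ne (q.apply_ne_self h1), q.2.1, h3]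
      rintro rfl
      exact h4 (q.2.1 h).symm
    · right
      have n : ∀ {k}, X.rot k ≠ k → k ≠ x ∧ k ≠ y := fun hk => ⟨fun e => hk (e ▸ hx), fun e => hk (e ▸ hy)⟩
      have n1 := (Marked.rot_ne_rot h3).1
      have n2 := (Marked.rot_ne_rot n1).1
      rw [q.apply_of_not_leg h3, swap_apply_of_ne_of_ne (n n1).1 (n n1).2, q.apply_of_not_leg n1,
        swap_apply_of_ne_of_ne (n n2).1 (n n2).2, q.apply_of_not_leg n2, X.rot_rot_rot]
  opp := X.opp
  opp_opp := X.opp_opp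
  opp_ne := X.opp_ne

/-- Joining `x` to the edge from the other side changes the sign. -/
theorem Marked.glueAt_antisymm (X : Marked l) {x : X.H} (q : X.PairingExcept x) {y : X.H}
    (hx : X.rot x = x) (hy : X.rot y = y) (hyx : y ≠ x) :
    (X.glueAt x q y hx hy hyx).cls +
      (X.glueAt x q (q.1 y) hx (q.leg_apply.2 hy) (q.apply_ne_self hyx)).cls = 0 := by
  have rx : (X.glueAt x q y hx hy hyx).rot x = q.1 y := by
    change X.rot (q.1 (swap x y x)) = _
    rw [swap_apply_left, q.leg_apply.2 hy]
  have ry : (X.glueAt x q y hx hy hyx).rot y = x := by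
    change X.rot (q.1 (swap x y y)) = _
    rw [swap_apply_right, q.apply_self, hx]
  have rq : (X.glueAt x q y hx hy hyx).rot (q.1 y) = y := by
    change X.rot (q.1 (swap x y (q.1 y))) = _
    rw [swap_apply_of_ne_of_ne (q.apply_ne_self hyx) (q.apply_ne hy hyx), q.2.1, hy]
  have ry' : (X.glueAt x q y hx hy hyx).rot.symm x = y := by
    exact (Equiv.symm_apply_eq (X.glueAt x q y hx hy hyx).rot).2 ry.symm
  have := (X.glueAt x q y hx hy hyx).cls_antisymm (h := x) (by
    change (X.glueAt x q y hx hy hyx).rot ((X.glueAt x q y hx hy hyx).rot x) ≠ x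
    rw [rx, rq]
    exact hyx)
  rw [rx, ry'] at this
  rw [← this]
  congr 1
  refine TriGraph.Iso.cls_eq ⟨Equiv.refl _, fun h => ?_, fun _ => rfl⟩
  have key : ∀ h : X.H, X.rot (q.1 (swap x (q.1 y) h)) =
      swap (q.1 y) y (X.rot (q.1 (swap x y (swap (q.1 y) y h)))) := by
    intro h
    have hqy := q.apply_ne hy hyx
    have hqx := q.apply_ne_self hyx
    by_cases h1 : h = x
    · subst h1
      rw [swap_apply_left, q.2.1, hy, swap_apply_of_ne_of_ne hqx.symm hyx.symm, swap_apply_left,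
        q.leg_apply.2 hy, swap_apply_left]
    by_cases h2 : h = y
    · subst h2
      rw [swap_apply_of_ne_of_ne hyx hqy.symm, q.leg_apply.2 hy, swap_apply_right,
        swap_apply_of_ne_of_ne hqx hqy, q.2.1, hy, swap_apply_right]
    by_cases h3 : h = q.1 y
    · subst h3
      rw [swap_apply_right, q.apply_self, hx, swap_apply_left, swap_apply_right, q.apply_self, hx,
        swap_apply_of_ne_of_ne hqx.symm hyx.symm]
    rw [swap_apply_of_ne_of_ne h1 h3, swap_apply_of_ne_of_ne h3 h2, swap_apply_of_ne_of_ne h1 h2,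
      swap_apply_of_ne_of_ne]
    · intro e
      have := X.rot.injective (e.trans (q.leg_apply.2 hy).symm)
      exact h2 (q.1.injective this)
    · intro e
      have := X.rot.injective (e.trans hy.symm)
      exact h3 (by rw [← this, q.2.1])
  exact key h

section

variable {X : Marked l} {x y : X.H} (hxy : X.Fusable x y)

/-- The permutation of the half-edges of `X.fuse x y` in which the new leg takes the place of `y`. -/
def fusePerm (q : X.PairingExcept x) (y : X.H) : Perm (X.H ⊕ Bool) :=
  swap (Sum.inl y) (Sum.inr true) * Equiv.sumCongr q.1 (Equiv.refl Bool) *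
    swap (Sum.inl y) (Sum.inr true)

include hxy in
theorem fusePerm_apply (q : X.PairingExcept x) :
    (∀ k, k ≠ y → q.1 k ≠ y → fusePerm q y (Sum.inl k) = Sum.inl (q.1 k)) ∧
      fusePerm q y (Sum.inl (q.1 y)) = Sum.inr true ∧ fusePerm q y (Sum.inl y) = Sum.inl y ∧
      fusePerm q y (Sum.inr false) = Sum.inr false ∧
      fusePerm q y (Sum.inr true) = Sum.inl (q.1 y) := by
  have hqy := q.apply_ne hxy.2.1 hxy.2.2.1.symm
  have sl : ∀ k, k ≠ y → swap (Sum.inl y : X.H ⊕ Bool) (Sum.inr true) (Sum.inl k) = Sum.inl k :=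
    fun k hk => swap_apply_of_ne_of_ne (by simpa) (by simp)
  have sf : swap (Sum.inl y : X.H ⊕ Bool) (Sum.inr true) (Sum.inr false) = Sum.inr false :=
    swap_apply_of_ne_of_ne (by simp) (by simp)
  have ml : ∀ k, Equiv.sumCongr q.1 (Equiv.refl Bool) (Sum.inl k) = Sum.inl (q.1 k) := fun _ => rfl
  have mr : ∀ t, Equiv.sumCongr q.1 (Equiv.refl Bool) (Sum.inr t) = Sum.inr t := fun _ => rfl
  refine ⟨fun k h1 h2 => ?_, ?_, ?_, ?_, ?_⟩ <;> rw [fusePerm, Perm.mul_apply, Perm.mul_apply]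
  · rw [sl k h1, ml, sl _ h2]
  · rw [sl _ hqy, ml, q.2.1, swap_apply_left]
  · rw [swap_apply_left, mr, swap_apply_right]
  · rw [sf, mr, sf]
  · rw [swap_apply_right, ml, sl _ hqy]

theorem isLeg_fuse_inl (k : X.H) :
    (X.fuse x y hxy).IsLeg (Sum.inl k) ↔ X.IsLeg k ∧ k ≠ x ∧ k ≠ y := by
  have := Marked.mem_legs (X := X.fuse x y hxy) (h := Sum.inl k)
  rw [Marked.legs_fuse] at this
  simp only [UTGraph.IsLeg]
  rw [← this]
  simp [Marked.mem_legs]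
  tauto

theorem isLeg_fuse_true : (X.fuse x y hxy).IsLeg (Sum.inr true) := Marked.fuse_rot_true hxy

theorem not_isLeg_fuse_false : ¬ (X.fuse x y hxy).IsLeg (Sum.inr false) := by
  rw [UTGraph.IsLeg, Marked.fuse_rot_false]
  simp

/-- The pairing of the legs of `X.fuse x y` in which the new leg takes the place of `y`. -/
def fusePairing (q : X.PairingExcept x) : (X.fuse x y hxy).Pairing :=
  ⟨fusePerm q y, by
    intro h
    rw [fusePerm, ← Perm.mul_apply]
    have : Equiv.sumCongr q.1 (Equiv.refl Bool) * Equiv.sumCongr q.1 (Equiv.refl Bool) = 1 := by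
      ext h
      rcases h with h | h <;> simp [q.2.1]
    simp only [mul_assoc]
    rw [swap_mul_self_mul, ← mul_assoc (Equiv.sumCongr q.1 (Equiv.refl Bool)), this, one_mul,
      swap_mul_self]
    rfl, by
    obtain ⟨e1, e2, e3, e4, e5⟩ := fusePerm_apply hxy q
    have hqy := q.apply_ne hxy.2.1 hxy.2.2.1.symm
    rintro (k | _ | _)
    · rw [isLeg_fuse_inl]
      by_cases h1 : k = y
      · subst h1
        simp [e3]
      by_cases h2 : q.1 k = y
      · have h3 : k = q.1 y := by rw [← h2, q.2.1]
        subst h3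
        rw [e2]
        have : X.IsLeg (q.1 y) := q.leg_apply.2 hxy.2.1
        simp [this, h1, q.apply_ne_self hxy.2.2.1.symm]
      · rw [e1 k h1 h2, Sum.inl.injEq, q.2.2.1]
        tauto
    · exact iff_of_true e4 (not_isLeg_fuse_false hxy)
    · exact iff_of_false (by rw [e5]; simp) (not_not.2 (isLeg_fuse_true hxy)), by
    obtain ⟨e1, e2, e3, e4, e5⟩ := fusePerm_apply hxy q
    have hqy := q.apply_ne hxy.2.1 hxy.2.2.1.symm
    have hqx := q.apply_ne_self hxy.2.2.1.symm
    have hcol := hxy.2.2.2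
    rintro (k | _ | _)
    · by_cases h1 : k = y
      · subst h1
        rw [e3]
      by_cases h2 : q.1 k = y
      · have h3 : k = q.1 y := by rw [← h2, q.2.1]
        subst h3
        rw [e2, Marked.fuse_color_true, Marked.fuse_color_other hxy hqx hqy, q.2.2.2, hcol]
      · rw [e1 k h1 h2]
        by_cases h3 : k = x
        · subst h3
          rw [q.apply_self]
        rw [Marked.fuse_color_other hxy h3 h1,
          Marked.fuse_color_other hxy (q.apply_ne_self h3) h2, q.2.2.2]
    · rw [e4]
    · rw [e5, Marked.fuse_color_true, Marked.fuse_color_other hxy hqx hqy, q.2.2.2, hcol]⟩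

/-- Conjugation by the transposition of `y` with the new leg is undone by itself. It remains to see
that a pairing of the joined graph, so conjugated, comes from a permutation of `X.H`. -/
theorem fusePairing_bijective : Function.Bijective (fusePairing hxy) := by
  have hyx := hxy.2.2.1.symm
  constructor
  · intro q q' h
    have h1 : fusePerm q y = fusePerm q' y := congrArg Subtype.val h
    rw [fusePerm, fusePerm] at h1
    have h2 := mul_left_cancel (mul_right_cancel h1)
    refine Subtype.ext (Equiv.ext fun k => ?_)
    have := Equiv.congr_fun h2 (Sum.inl k)
    simpa using this
  · rintro ⟨p, hp1, hp2, hp3⟩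
    let Q : Perm (X.H ⊕ Bool) := swap (Sum.inl y) (Sum.inr true) * p *
      swap (Sum.inl y) (Sum.inr true)
    have hpy : p (Sum.inl y) = Sum.inl y := (hp2 _).2 (by rw [isLeg_fuse_inl]; tauto)
    have hpx : p (Sum.inl x) = Sum.inl x := (hp2 _).2 (by rw [isLeg_fuse_inl]; tauto)
    have hpf : p (Sum.inr false) = Sum.inr false := (hp2 _).2 (not_isLeg_fuse_false hxy)
    have Qinv : ∀ h, Q (Q h) = h := by
      intro h
      simp only [Q, Perm.mul_apply, swap_apply_self]
      have := hp1 (swap (Sum.inl y) (Sum.inr true) h)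
      rw [this, swap_apply_self]
    have Qr : ∀ t, Q (Sum.inr t) = Sum.inr t := by
      intro t
      cases t
      · simp only [Q, Perm.mul_apply]
        have sf : swap (Sum.inl y : X.H ⊕ Bool) (Sum.inr true) (Sum.inr false) = Sum.inr false :=
          swap_apply_of_ne_of_ne (by simp) (by simp)
        rw [sf, hpf, sf]
      · simp only [Q, Perm.mul_apply]
        rw [swap_apply_right, hpy, swap_apply_left]
    -- `Q` is an involution fixing both new half-edges, hence it preserves the old ones.
    have hQ : Q ∈ (Perm.sumCongrHom X.H Bool).range := by
      refine Perm.mem_sumCongrHom_range_of_perm_mapsTo_inl ?_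
      rintro _ ⟨k, rfl⟩
      rcases hk : Q (Sum.inl k) with k' | t
      · exact ⟨k', rfl⟩
      · have := Qinv (Sum.inl k)
        rw [hk, Qr] at this
        cases this
    obtain ⟨⟨q, r⟩, hqr⟩ := hQ
    have hl : ∀ k, Q (Sum.inl k) = Sum.inl (q k) := by
      intro k
      rw [← hqr]
      rfl
    have hpl : ∀ k, k ≠ y → p (Sum.inl k) = swap (Sum.inl y) (Sum.inr true) (Sum.inl (q k)) := by
      intro k hk
      rw [← hl]
      simp only [Q, Perm.mul_apply, swap_apply_self]
      rw [swap_apply_of_ne_of_ne (by simpa) (by simp)]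
    have hpt : p (Sum.inr true) = swap (Sum.inl y) (Sum.inr true) (Sum.inl (q y)) := by
      rw [← hl]
      simp only [Q, Perm.mul_apply, swap_apply_self]
      rw [swap_apply_left]
    have hqy : q y ≠ y := by
      intro e
      rw [e, swap_apply_left] at hpt
      exact (hp2 _).1 hpt (isLeg_fuse_true hxy)
    refine ⟨⟨q, ?_, ?_, ?_⟩, Subtype.ext ?_⟩
    · intro k
      have := Qinv (Sum.inl k)
      rw [hl, hl] at this
      exact Sum.inl_injective this
    · intro k
      by_cases h1 : k = y
      · subst h1
        have : X.IsLeg k := hxy.2.1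
        simp [hqy, this, hyx]
      have h2 := hp2 (Sum.inl k)
      rw [isLeg_fuse_inl, hpl k h1] at h2
      have h3 : q k = k ↔ swap (Sum.inl y) (Sum.inr true) (Sum.inl (q k)) = Sum.inl k := by
        constructor
        · intro e
          rw [e, swap_apply_of_ne_of_ne (by simpa) (by simp)]
        · intro e
          rw [swap_apply_eq_iff, swap_apply_of_ne_of_ne (by simpa) (by simp)] at e
          exact Sum.inl_injective e
      rw [h3, h2]
      tauto
    · intro k
      by_cases h1 : k = y
      · subst h1
        have h2 := hp3 (Sum.inr true)
        rw [hpt, swap_apply_of_ne_of_ne (by simpa) (by simp), Marked.fuse_color_true] at h2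
        have h3 : q k ≠ x := by
          intro e
          rw [e, swap_apply_of_ne_of_ne (by simpa using hyx.symm) (by simp)] at hpt
          have := p.injective (hpt.trans hpx.symm)
          cases this
        rw [Marked.fuse_color_other hxy h3 hqy] at h2
        exact h2.trans hxy.2.2.2
      by_cases h2 : k = x
      · subst h2
        have := hpl k h1
        rw [hpx, eq_comm, swap_apply_eq_iff, swap_apply_of_ne_of_ne (by simpa) (by simp)] at this
        rw [Sum.inl_injective this]
      have h3 := hp3 (Sum.inl k)
      rw [hpl k h1, Marked.fuse_color_other hxy h2 h1] at h3
      by_cases h4 : q k = y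
      · rw [h4, swap_apply_left, Marked.fuse_color_true, hxy.2.2.2] at h3
        rw [h4, h3]
      rw [swap_apply_of_ne_of_ne (by simpa) (by simp)] at h3
      have h5 : q k ≠ x := by
        intro e
        have := hpl k h1
        rw [e, swap_apply_of_ne_of_ne (by simpa using hyx.symm) (by simp)] at this
        exact h2 (Sum.inl_injective (p.injective (this.trans hpx.symm)))
      rwa [Marked.fuse_color_other hxy h5 h4] at h3
    · change swap (Sum.inl y) (Sum.inr true) * Equiv.sumCongr q (Equiv.refl Bool) *
        swap (Sum.inl y) (Sum.inr true) = p
      have : Equiv.sumCongr q (Equiv.refl Bool) = Q := by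
        refine Equiv.ext ?_
        rintro (k | t)
        · rw [hl]; rfl
        · rw [Qr]; rfl
      rw [this]
      simp only [Q, mul_assoc, swap_mul_self, mul_one]
      rw [swap_mul_self_mul]

/-- The new leg, glued to `q y`, is a bivalent vertex on the third edge at the new trivalent vertex.
In `glueAt` that edge is undivided, so the graphs agree after one subdivision. -/
theorem glue_fusePairing (q : X.PairingExcept x) :
    ((X.fuse x y hxy).glue (fusePairing hxy q)).cls =
      (X.glueAt x q y hxy.1 hxy.2.1 hxy.2.2.1.symm).cls := by
  have hqy := q.apply_ne hxy.2.1 hxy.2.2.1.symm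
  have hqx := q.apply_ne_self hxy.2.2.1.symm
  have hyx := hxy.2.2.1.symm
  obtain ⟨e1, e2, e3, e4, e5⟩ := fusePerm_apply hxy q
  rw [← TriGraph.cls_subdivide (X.glueAt x q y hxy.1 hxy.2.1 hxy.2.2.1.symm) (q.1 y)]
  symm
  -- In the subdivided `glueAt` the half-edge at the trivalent vertex is `q y`, while in the joined
  -- graph it is `inr false` and `q y` lies at the bivalent vertex. The 3-cycle `q y ↦ inr false ↦
  -- inr true ↦ q y` translates between the two labellings.
  let φ : Perm (X.H ⊕ Bool) := swap (Sum.inl (q.1 y)) (Sum.inr true) *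
    swap (Sum.inl (q.1 y)) (Sum.inr false)
  have φ1 : φ (Sum.inl (q.1 y)) = Sum.inr false := by
    simp only [φ, Perm.mul_apply]
    rw [swap_apply_left, swap_apply_of_ne_of_ne (by simp) (by simp)]
  have φ2 : φ (Sum.inr false) = Sum.inr true := by
    simp only [φ, Perm.mul_apply]
    rw [swap_apply_right, swap_apply_left]
  have φ3 : φ (Sum.inr true) = Sum.inl (q.1 y) := by
    simp only [φ, Perm.mul_apply]
    rw [swap_apply_of_ne_of_ne (x := Sum.inr true) (by simp) (by simp), swap_apply_right]
  have φ4 : ∀ k, k ≠ q.1 y → φ (Sum.inl k) = Sum.inl k := by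
    intro k hk
    simp only [φ, Perm.mul_apply]
    rw [swap_apply_of_ne_of_ne (x := Sum.inl k) (by simpa) (by simp),
      swap_apply_of_ne_of_ne (by simpa) (by simp)]
  have keyrot : ∀ h : X.H ⊕ Bool,
      φ (Equiv.sumCongr (X.rot * q.1 * swap x y) (swap false true) h) =
        fuseRot X.rot x y (fusePerm q y (φ h)) := by
    have ml : ∀ k, Equiv.sumCongr (X.rot * q.1 * swap x y) (swap false true) (Sum.inl k) =
        Sum.inl (X.rot (q.1 (swap x y k))) := fun _ => rfl
    rintro (k | _ | _)
    · rw [ml]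
      by_cases h1 : k = q.1 y
      · subst h1
        rw [φ1, e4, fuseRot_false _ hxy.2.1, swap_apply_of_ne_of_ne (x := q.1 y) hqx hqy, q.2.1,
          hxy.2.1, φ4 _ hqy.symm]
      by_cases h2 : k = x
      · subst h2
        rw [φ4 _ h1, e1 k hyx.symm (by rw [q.apply_self]; exact hyx.symm), q.apply_self, fuseRot_b,
          swap_apply_left, q.leg_apply.2 hxy.2.1, φ1]
      by_cases h3 : k = y
      · subst h3
        rw [φ4 _ h1, e3, fuseRot_c _ hxy.2.2.1 hxy.1, swap_apply_right, q.apply_self, hxy.1,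
          φ4 _ hqx.symm]
      have h4 : q.1 k ≠ y := fun e => h1 (by rw [← e, q.2.1])
      have h5 : X.rot (q.1 k) ≠ q.1 y := fun e =>
        h3 (q.1.injective (X.rot.injective (e.trans (q.leg_apply.2 hxy.2.1).symm)))
      rw [φ4 _ h1, e1 k h3 h4, fuseRot_other _ (q.apply_ne_self h2) h4,
        swap_apply_of_ne_of_ne h2 h3, φ4 _ h5]
    · rw [φ2, e5, fuseRot_other _ hqx hqy, q.leg_apply.2 hxy.2.1, ← φ3]
      rfl
    · rw [φ3, e2, fuseRot_true]
      exact φ2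
  have keyopp : ∀ (_ : DecidableEq (X.H ⊕ Bool)) (h : X.H ⊕ Bool),
      φ ((swap (Sum.inl (X.opp (q.1 y))) (Sum.inr false) * Equiv.sumCongr X.opp (swap false true) *
        swap (Sum.inl (X.opp (q.1 y))) (Sum.inr false)) h) =
        Equiv.sumCongr X.opp (swap false true) (φ h) := by
    intro _ h
    have ho := X.opp_ne (q.1 y)
    have sl : ∀ k, Equiv.sumCongr X.opp (swap false true) (Sum.inl k) = Sum.inl (X.opp k) :=
      fun _ => rfl
    have sf : Equiv.sumCongr X.opp (swap false true) (Sum.inr false) = Sum.inr true := by simp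
    have st : Equiv.sumCongr X.opp (swap false true) (Sum.inr true) = Sum.inr false := by simp
    obtain ⟨T, hT⟩ : ∃ T : Perm (X.H ⊕ Bool),
      T = swap (Sum.inl (X.opp (q.1 y))) (Sum.inr false) := ⟨_, rfl⟩
    have t1 : T (Sum.inl (X.opp (q.1 y))) = Sum.inr false := by rw [hT, swap_apply_left]
    have t2 : T (Sum.inr false) = Sum.inl (X.opp (q.1 y)) := by rw [hT, swap_apply_right]
    have t3 : T (Sum.inr true) = Sum.inr true := by
      rw [hT, swap_apply_of_ne_of_ne (by simp) (by simp)]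
    have t4 : ∀ k, k ≠ X.opp (q.1 y) → T (Sum.inl k) = Sum.inl k := fun k hk => by
      rw [hT, swap_apply_of_ne_of_ne (by simpa) (by simp)]
    rw [← hT]
    change φ (T (Equiv.sumCongr X.opp (swap false true) (T h))) = _
    rcases h with k | _ | _
    · by_cases h1 : k = q.1 y
      · subst h1
        rw [t4 _ ho.symm, sl, t1, φ1, sf, φ2]
      by_cases h2 : k = X.opp (q.1 y)
      · subst h2
        rw [t1, sf, t3, φ3, φ4 _ h1, sl, X.opp_opp]
      have h3 : X.opp k ≠ q.1 y := fun e => h2 (by rw [← e, X.opp_opp])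
      have h4 : X.opp k ≠ X.opp (q.1 y) := fun e => h1 (X.opp.injective e)
      rw [t4 _ h2, sl, t4 _ h4, φ4 _ h3, φ4 _ h1, sl]
    · rw [t2, sl, X.opp_opp, t4 _ ho.symm, φ1, φ2, st]
    · rw [t3, st, t2, φ3, sl, φ4 _ ho]
  exact TriGraph.Iso.cls_eq ⟨φ, keyrot, keyopp _⟩

end

/-- The sum over all ways of joining a leg to another leg of the same colour vanishes. -/
theorem sum_jPrime_fuse (n : ℕ) {X : Marked l} {x : X.H} (hx : X.rot x = x) :
    ∑ y ∈ X.legs.erase x, (if h : X.Fusable x y then (X.fuse x y h).jPrime n else 0) = 0 := by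
  -- The conditions on the numbers of legs and on the degree of the joined graph do not depend on
  -- `y`, so either all terms are sums over pairings or all are zero.
  by_cases hcond : (∀ i, (X.numLegs i - if X.color x = some i then 1 else 0) = 2 * n) ∧
      X.degree ≤ (l + 1) * n
  · let g : X.PairingExcept x → X.H → TriSpace := fun q y =>
      if h : X.Fusable x y then (X.glueAt x q y h.1 h.2.1 h.2.2.1.symm).cls else 0
    have h1 : ∀ y, (if h : X.Fusable x y then (X.fuse x y h).jPrime n else 0) = ∑ q, g q y := by
      intro y
      by_cases h : X.Fusable x y
      · simp only [g, dif_pos h]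
        rw [Marked.jPrime, if_pos]
        · rw [← (fusePairing_bijective h).sum_comp]
          exact Finset.sum_congr rfl fun q _ => glue_fusePairing h q
        · rw [Marked.degree_fuse h]
          simpa only [Marked.numLegs_fuse h] using hcond
      · simp [g, h]
    -- The pairing `q` of the remaining legs is now fixed; the terms for `y` and `q y`, the two ends
    -- of a glued edge, cancel.
    rw [Finset.sum_congr rfl fun y _ => h1 y, Finset.sum_comm]
    refine Finset.sum_eq_zero fun q _ => ?_
    have hF : ∀ y, X.Fusable x y → X.Fusable x (q.1 y) := fun y h =>
      ⟨hx, q.leg_apply.2 h.2.1, (q.apply_ne_self h.2.2.1.symm).symm, by rw [q.2.2.2, h.2.2.2]⟩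
    refine Finset.sum_involution (fun y _ => q.1 y) ?_ ?_ ?_ ?_
    · intro y _
      by_cases h : X.Fusable x y
      · simp only [g, dif_pos h, dif_pos (hF y h)]
        exact X.glueAt_antisymm q h.1 h.2.1 h.2.2.1.symm
      · have h' : ¬ X.Fusable x (q.1 y) := fun h' => h (by simpa [q.2.1] using hF _ h')
        simp [g, h, h']
    · intro y hy _
      rw [Finset.mem_erase, Marked.mem_legs] at hy
      exact q.apply_ne hy.2 hy.1
    · intro y hy
      rw [Finset.mem_erase, Marked.mem_legs] at hy ⊢
      exact ⟨q.apply_ne_self hy.1, q.leg_apply.2 hy.2⟩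
    · intro y _
      exact q.2.1 y
  · refine Finset.sum_eq_zero fun y _ => ?_
    split_ifs with h
    · rw [Marked.jPrime, if_neg]
      rw [Marked.degree_fuse h]
      simpa only [Marked.numLegs_fuse h] using hcond
    · rfl

/-! ### Averages over the completions of a word -/

/-- The word `u` followed by an arrangement of `s` is an arrangement of `t`. -/
def Splits {α : Type*} (t : Finset α) (u : List α) (s : Finset α) : Prop :=
  ∃ v ∈ arr s, u ++ v ∈ arr t

theorem Splits.mem_arr {α : Type*} {t s : Finset α} {u v : List α} (h : Splits t u s)
    (hv : v ∈ arr s) : u ++ v ∈ arr t := by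
  obtain ⟨v', hv', h'⟩ := h
  exact mem_arr_of_perm h' (List.Perm.append_left _ (perm_of_mem_arr hv' hv))

theorem Splits.insert_mem_arr {α : Type*} {t s : Finset α} {u v : List α} {x : α}
    (h : Splits t (u ++ [x]) s) (hv : v ∈ arr s) (p : ℕ) :
    u ++ (v.take p ++ x :: v.drop p) ∈ arr t := by
  have := h.mem_arr hv
  rw [List.append_assoc] at this
  exact mem_arr_of_perm this (List.Perm.append_left _ (perm_insert p x v).symm)

theorem Splits.notMem {α : Type*} {t s : Finset α} {u : List α} {x : α}
    (h : Splits t (u ++ [x]) s) : x ∉ s := by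
  obtain ⟨v, hv, h'⟩ := h
  rw [← (ChineseChar.mem_arr.1 hv).2]
  have := (ChineseChar.mem_arr.1 h').1
  intro hxv
  simp only [List.append_assoc, List.nodup_append, List.cons_append, List.nil_append,
    List.nodup_cons] at this
  exact this.2.1.1 hxv

theorem Splits.mem_iff {α : Type*} {t s : Finset α} {x : α} (h : Splits t ([] ++ [x]) s) (a : α) :
    a ∈ t ↔ a = x ∨ a ∈ s := by
  obtain ⟨v, hv, h'⟩ := h
  rw [← (ChineseChar.mem_arr.1 hv).2, ← (ChineseChar.mem_arr.1 h').2]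
  simp

/-- The legs of `X.fuse x y` which come from `s`. -/
def fuseRest {α : Type} (s : Finset α) (y : α) : Finset (α ⊕ Bool) :=
  (s.erase y).map Function.Embedding.inl

theorem card_fuseRest {α : Type} {s : Finset α} {y : α} (hy : y ∈ s) :
    (fuseRest s y).card + 1 = s.card := by
  rw [fuseRest, Finset.card_map, Finset.card_erase_add_one hy]

theorem Splits.fuse {X : Marked l} {u : List X.H} {x y : X.H} {s : Finset X.H}
    (h : Splits X.legs (u ++ [x]) s) (hy : y ∈ s) (hxy : X.Fusable x y) :
    Splits (X.fuse x y hxy).legs (u.map Sum.inl ++ [Sum.inr true]) (fuseRest s y) := by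
  obtain ⟨v, hv⟩ := arr_nonempty (s.erase y)
  refine ⟨v.map Sum.inl, ChineseChar.map_mem_arr Function.Embedding.inl hv, ?_⟩
  rw [List.append_assoc]
  refine Marked.mem_arr_fuse hxy ?_
  have := h.mem_arr (v := y :: v) (by
    have := cons_mem_arr (Finset.notMem_erase y s) hv
    rwa [Finset.insert_erase hy] at this)
  simpa using this

/-- The average of `wordValue` over the words that begin with `u` and continue with `s`. -/
def average (n : ℕ) (X : Marked l) (u : List X.H) (s : Finset X.H) : TriSpace :=
  (s.card.factorial : ℚ)⁻¹ • ∑ v ∈ arr s, wordValue n X (u ++ v)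

/-- The average of `wordValue` over the words that begin with `u`, and continue with the elements
of `s`, among which the `p`-th place is taken by `x`. -/
def averageAt (n : ℕ) (X : Marked l) (u : List X.H) (x : X.H) (s : Finset X.H) (p : ℕ) : TriSpace :=
  (s.card.factorial : ℚ)⁻¹ • ∑ v ∈ arr s, wordValue n X (u ++ (v.take p ++ x :: v.drop p))

theorem averageAt_zero (n : ℕ) (X : Marked l) (u : List X.H) (x : X.H) (s : Finset X.H) :
    averageAt n X u x s 0 = average n X (u ++ [x]) s := by
  simp [averageAt, average]

theorem average_legs (n : ℕ) (X : Marked l) : average n X [] X.legs = X.jPrime n := by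
  simp only [average, List.nil_append]
  rw [sum_wordValue, smul_smul, inv_mul_cancel₀, one_smul]
  exact_mod_cast Nat.factorial_ne_zero _

theorem average_empty (n : ℕ) (X : Marked l) (u : List X.H) :
    average n X u ∅ = wordValue n X u := by
  simp [average, arr_empty]

/-- Each of the `s.card + 1` places is taken by `x` equally often. -/
theorem average_insert (n : ℕ) (X : Marked l) (u : List X.H) {x : X.H} {s t : Finset X.H}
    (hx : x ∉ s) (ht : ∀ h, h ∈ t ↔ h = x ∨ h ∈ s) :
    average n X u t =
      ((s.card + 1 : ℕ) : ℚ)⁻¹ • ∑ p ∈ Finset.range (s.card + 1), averageAt n X u x s p := by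
  obtain rfl : t = insert x s := by
    ext h
    rw [ht, Finset.mem_insert]
  simp only [average, averageAt]
  rw [sum_arr_insert hx, ← Finset.smul_sum, smul_smul, Finset.card_insert_of_notMem hx,
    Nat.factorial_succ, Nat.cast_mul, mul_inv]

/-- Moving `x` one place to the right exchanges it with the letter `y` at that place. The
arrangements are sorted by `y` and STU is applied to each; the factor `1 / s.card` passes from
`s.card !` to the factorial of the smaller rest. -/
theorem averageAt_sub (n : ℕ) {X : Marked l} {u : List X.H} {x : X.H} {s : Finset X.H}
    (hs : Splits X.legs (u ++ [x]) s) {p : ℕ} (hp : p < s.card) :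
    averageAt n X u x s p - averageAt n X u x s (p + 1) =
      (s.card : ℚ)⁻¹ • ∑ y ∈ s, if h : X.Fusable x y then
        averageAt n (X.fuse x y h) (u.map Sum.inl) (Sum.inr true) (fuseRest s y) p else 0 := by
  rw [averageAt, averageAt, ← smul_sub, ← Finset.sum_sub_distrib, sum_arr_eq_sum_insert s hp,
    Finset.smul_sum, Finset.smul_sum]
  refine Finset.sum_congr rfl fun y hy => ?_
  have hcard : (s.erase y).card + 1 = s.card := Finset.card_erase_add_one hy
  have key : ∀ w ∈ arr (s.erase y),
      wordValue n X (u ++ ((w.take p ++ y :: w.drop p).take p ++ x ::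
          (w.take p ++ y :: w.drop p).drop p)) -
        wordValue n X (u ++ ((w.take p ++ y :: w.drop p).take (p + 1) ++ x ::
          (w.take p ++ y :: w.drop p).drop (p + 1))) =
      if h : X.Fusable x y then wordValue n (X.fuse x y h) (u.map Sum.inl ++
        ((w.map Sum.inl).take p ++ Sum.inr true :: (w.map Sum.inl).drop p)) else 0 := by
    intro w hw
    have hlen := length_of_mem_arr hw
    have h1 : (w.take p).length = p := by rw [List.length_take]; omega
    have hw' : w.take p ++ y :: w.drop p ∈ arr s := by
      have := ChineseChar.insert_mem_arr (Finset.notMem_erase y s) hw p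
      rwa [Finset.insert_erase hy] at this
    have h2 := hs.insert_mem_arr hw' p
    have h3 : (w.take p ++ y :: w.drop p).take p = w.take p := by
      rw [List.take_append_of_le_length h1.ge, List.take_of_length_le h1.le]
    have h4 : (w.take p ++ y :: w.drop p).drop p = y :: w.drop p := List.drop_left' h1
    have h5 : (w.take p ++ y :: w.drop p).take (p + 1) = w.take p ++ [y] := by
      rw [List.take_append, List.take_of_length_le (by omega), h1]
      simp
    have h6 : (w.take p ++ y :: w.drop p).drop (p + 1) = w.drop p := by
      rw [← List.drop_drop, h4]
      rfl
    rw [h3, h4] at h2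
    rw [h3, h4, h5, h6]
    have := wordValue_swap n (u := u ++ w.take p) (by simpa using h2)
    simp only [List.append_assoc, List.cons_append, List.nil_append] at this ⊢
    rw [this, bracket]
    simp [List.map_take, List.map_drop]
  rw [Finset.sum_congr rfl key]
  split_ifs with h
  · rw [averageAt, fuseRest, sum_arr_map, smul_smul, Finset.card_map]
    congr 1
    rw [← mul_inv, ← hcard, Nat.factorial_succ, Nat.cast_mul]
  · simp

/-! ### Cyclic invariance -/

/-- The change of the value is a function of the order of the other legs, and the uniqueness
principle applies to it. Its differences are the changes for graphs with one leg fewer, which vanish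
by induction; its sum vanishes because joining `x` to all other legs gives zero. -/
theorem wordValue_cons (n : ℕ) (X : Marked l) {x : X.H} {w : List X.H} (h : x :: w ∈ arr X.legs) :
    wordValue n X (x :: w) = wordValue n X (w ++ [x]) := by
  obtain ⟨k, hk⟩ : ∃ k, X.legs.card = k := ⟨_, rfl⟩
  induction k generalizing X with
  | zero =>
    have := length_of_mem_arr h
    simp [hk] at this
  | succ k ih =>
    set s := X.legs.erase x with hs
    have hx : x ∈ X.legs := ((mem_arr.1 h).2 x).1 (by simp)
    have hins : insert x s = X.legs := Finset.insert_erase hx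
    have hxs : x ∉ s := Finset.notMem_erase _ _
    have hcard : s.card = k := by
      rw [hs, Finset.card_erase_of_mem hx, hk, Nat.add_sub_cancel]
    have hcons : ∀ {v}, v ∈ arr s → x :: v ∈ arr X.legs := fun hv => by
      rw [← hins]
      exact cons_mem_arr hxs hv
    have hsp : Splits X.legs ([] ++ [x]) s := by
      obtain ⟨v, hv⟩ := arr_nonempty s
      exact ⟨v, hv, hcons hv⟩
    have hw : w ∈ arr s := remove_mem_arr (u := []) h
    rw [← sub_eq_zero]
    refine eq_zero_of_swap_invariant
      (φ := fun w => wordValue n X (x :: w) - wordValue n X (w ++ [x])) ?_ ?_ hw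
    · intro u b c v hv
      have h1 := wordValue_swap n (u := x :: u) (hcons hv)
      have h2 := wordValue_swap n (X := X) (u := u) (b := b) (c := c) (v := v ++ [x])
        (mem_arr_of_perm (hcons hv) (by
          simpa using List.perm_append_comm (l₁ := [x]) (l₂ := u ++ b :: c :: v)))
      -- This is the induction hypothesis for the graph with `b` and `c` joined.
      have h3 : bracket (wordValue n) X (x :: u) b c v =
          bracket (wordValue n) X u b c (v ++ [x]) := by
        rw [bracket, bracket]
        split_ifs with hbc
        · have := ih (X.fuse b c hbc) (x := Sum.inl x)
            (w := u.map Sum.inl ++ Sum.inr true :: v.map Sum.inl)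
            (by simpa using Marked.mem_arr_fuse (u := x :: u) hbc (hcons hv)) (by
              have := X.card_legs_fuse hbc
              omega)
          simpa using this
        · rfl
      have h4 := h1.trans (h3.trans h2.symm)
      simp only [List.cons_append, List.append_assoc] at h4 ⊢
      rw [← sub_eq_zero] at h4 ⊢
      rw [← h4]
      abel
    -- The passage of `x` from the first to the last place telescopes. For fixed `y`, the sum over
    -- the places of the joined leg is a multiple of the full average of the joined graph, that is,
    -- of its `jPrime`.
    · have h0 : averageAt n X [] x s 0 - averageAt n X [] x s s.card = 0 := by
        rw [← Finset.sum_range_sub']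
        rw [Finset.sum_congr rfl fun p hp => averageAt_sub n hsp (Finset.mem_range.1 hp),
          ← Finset.smul_sum, Finset.sum_comm]
        have : ∀ y ∈ s, ∑ p ∈ Finset.range s.card, (if h : X.Fusable x y then
            averageAt n (X.fuse x y h) (([] : List X.H).map Sum.inl) (Sum.inr true)
              (fuseRest s y) p else 0) =
            (s.card : ℚ) • if h : X.Fusable x y then (X.fuse x y h).jPrime n else 0 := by
          intro y hy
          split_ifs with hxy
          · have hsp' := hsp.fuse hy hxy
            have hc := card_fuseRest hy
            have e := average_insert n (X.fuse x y hxy) [] hsp'.notMem hsp'.mem_iff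
            rw [average_legs, hc] at e
            rw [e, smul_smul, mul_inv_cancel₀, one_smul]
            · rfl
            · exact Nat.cast_ne_zero.2 (Finset.card_ne_zero_of_mem hy)
          · simp
        rw [Finset.sum_congr rfl this, ← Finset.smul_sum, sum_jPrime_fuse n (Marked.mem_legs.1 hx),
          smul_zero, smul_zero]
      rw [averageAt, averageAt, ← smul_sub, smul_eq_zero, ← Finset.sum_sub_distrib] at h0
      refine Eq.trans (Finset.sum_congr rfl fun v hv => ?_)
        (h0.resolve_left (by simpa using Nat.factorial_ne_zero _))
      have := length_of_mem_arr hv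
      rw [← this]
      simp

theorem wordValue_swap_of_not_fusable (n : ℕ) {X : Marked l} {u v : List X.H} {b c : X.H}
    (h : u ++ b :: c :: v ∈ arr X.legs) (hbc : ¬ X.Fusable b c) :
    wordValue n X (u ++ b :: c :: v) = wordValue n X (u ++ c :: b :: v) := by
  rw [← sub_eq_zero, wordValue_swap n h, bracket, dif_neg hbc]

theorem wordValue_move (n : ℕ) {X : Marked l} {u v w : List X.H} {b : X.H}
    (h : u ++ b :: (w ++ v) ∈ arr X.legs) (hb : ∀ c ∈ w, ¬ X.Fusable b c) :
    wordValue n X (u ++ b :: (w ++ v)) = wordValue n X (u ++ (w ++ b :: v)) := by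
  induction w generalizing u with
  | nil => rfl
  | cons c w ih =>
    rw [List.cons_append] at h
    have h1 := mem_arr_swap h
    rw [List.cons_append, wordValue_swap_of_not_fusable n h (hb c (by simp))]
    have := ih (u := u ++ [c]) (by simpa using h1) fun c' hc' => hb c' (by simp [hc'])
    simpa using this

/-- Invariance under rotation of a block of legs which commute with all others. -/
theorem wordValue_isRotated (n : ℕ) {X : Marked l} {u v w w' : List X.H}
    (h : u ++ (w ++ v) ∈ arr X.legs) (hu : ∀ b ∈ w, ∀ c ∈ u, ¬ X.Fusable b c)
    (hv : ∀ b ∈ w, ∀ c ∈ v, ¬ X.Fusable b c) (hw : w.IsRotated w') :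
    wordValue n X (u ++ (w ++ v)) = wordValue n X (u ++ (w' ++ v)) := by
  obtain ⟨k, rfl⟩ := hw
  induction k with
  | zero => simp
  | succ k ih =>
    rw [ih, ← List.rotate_rotate]
    have hr : ∀ b ∈ w.rotate k, b ∈ w := fun b hb => List.mem_rotate.1 hb
    have h' : u ++ (w.rotate k ++ v) ∈ arr X.legs :=
      mem_arr_of_perm h (List.Perm.append_left _ (List.Perm.append_right _
        (List.rotate_perm w k).symm))
    rcases hk : w.rotate k with _ | ⟨b, t⟩
    · simp
    rw [hk] at hr h'
    -- The first letter `b` of the block goes left past `u`, by cyclicity from the front to the very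
    -- end, and then left past `v` to the end of its block.
    have e1 : wordValue n X (b :: (u ++ (t ++ v))) = wordValue n X (u ++ b :: (t ++ v)) :=
      wordValue_move n (u := []) (mem_arr_of_perm h' (by simp))
        (hu b (hr b (by simp)))
    have e2 := wordValue_cons n X (x := b) (w := u ++ (t ++ v))
      (mem_arr_of_perm h' (by simp))
    have e3 : wordValue n X (u ++ t ++ b :: (v ++ [])) = wordValue n X (u ++ t ++ (v ++ [b])) :=
      wordValue_move n (mem_arr_of_perm h' (by
        simpa using (List.perm_middle (l₁ := t)).symm.append_left u)) (hv b (hr b (by simp)))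
    simp only [List.append_assoc, List.append_nil] at e2 e3
    simp only [List.cons_append, List.rotate_cons_succ, List.rotate_zero, List.append_assoc,
      List.nil_append]
    rw [← e1, e2, e3]

/-! ### Words sorted by colour -/

theorem Marked.isSome_of_mem {X : Marked l} {w : List X.H} (hw : w ∈ arr X.legs) {h : X.H}
    (hh : h ∈ w) : ∃ i, X.color h = some i :=
  Option.isSome_iff_exists.1 ((X.color_isSome h).2 (Marked.mem_legs.1 (((mem_arr.1 hw).2 h).1 hh)))

/-- A stable partition made from the right: a letter violating `P` only has to pass letters
satisfying `P`, with which it commutes. -/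
theorem wordValue_partition (n : ℕ) {X : Marked l} (P : X.H → Bool)
    (hP : ∀ b c, P c = true → ¬ P b = true → ¬ X.Fusable b c) {u v : List X.H}
    (h : u ++ v ∈ arr X.legs) :
    wordValue n X (u ++ v) =
      wordValue n X (u ++ (v.filter P ++ v.filter fun a => !P a)) := by
  induction v generalizing u with
  | nil => rfl
  | cons a v ih =>
    have := ih (u := u ++ [a]) (by simpa using h)
    simp only [List.append_assoc, List.cons_append, List.nil_append] at this
    rw [this]
    by_cases ha : P a = true
    · simp [ha]
    · have h' : u ++ a :: (v.filter P ++ v.filter fun a => !P a) ∈ arr X.legs :=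
        mem_arr_of_perm h (List.Perm.append_left _ (List.Perm.cons _
          (List.filter_append_perm P v).symm))
      rw [wordValue_move n h' fun c hc => hP _ _ (List.mem_filter.1 hc).2 ha]
      simp [ha]

theorem wordValue_flatMap (n : ℕ) {X : Marked l} {L : List (Fin l)} (hn : L.Nodup)
    {u v : List X.H} (h : u ++ v ∈ arr X.legs) (hL : ∀ a ∈ v, ∃ i ∈ L, X.color a = some i) :
    wordValue n X (u ++ v) =
      wordValue n X (u ++ L.flatMap fun i => v.filter fun a => X.color a = some i) := by
  induction L generalizing u v with
  | nil =>
    rcases v with _ | ⟨a, v⟩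
    · rfl
    · obtain ⟨i, hi, -⟩ := hL a (by simp)
      cases hi
  | cons i L ih =>
    rw [wordValue_partition n (fun a => decide (X.color a = some i)) (fun b c hc hb hbc => by
      rw [decide_eq_true_eq] at hc hb
      exact hb (hbc.2.2.2.trans hc)) h, ← List.append_assoc]
    rw [List.nodup_cons] at hn
    rw [ih hn.2]
    · rw [List.flatMap_cons, List.append_assoc]
      congr 3
      refine List.flatMap_congr fun j hj => ?_
      rw [List.filter_filter]
      refine List.filter_congr fun a _ => ?_
      have : j ≠ i := fun e => hn.1 (e ▸ hj)
      by_cases ha : X.color a = some j <;> simp [ha, this]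
    · rw [List.append_assoc]
      refine mem_arr_of_perm h (List.Perm.append_left _ ?_)
      exact (List.filter_append_perm (fun a => decide (X.color a = some i)) v).symm
    · intro a ha
      rw [List.mem_filter] at ha
      obtain ⟨j, hj, hc⟩ := hL a ha.1
      rcases List.mem_cons.1 hj with rfl | hj
      · simp [hc] at ha
      · exact ⟨j, hj, hc⟩

/-- The blocks are rotated one at a time, since the letters outside a block have other colours and
commute with it. The prefix `u` holds the blocks already rotated. -/
theorem wordValue_rotate_blocks (n : ℕ) {X : Marked l} {L : List (Fin l)} (hn : L.Nodup)
    {A B : Fin l → List X.H} {u : List X.H} (h : u ++ L.flatMap A ∈ arr X.legs)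
    (hA : ∀ i ∈ L, ∀ a ∈ A i, X.color a = some i) (hu : ∀ c ∈ u, ∀ i ∈ L, X.color c ≠ some i)
    (hAB : ∀ i, (A i).IsRotated (B i)) :
    wordValue n X (u ++ L.flatMap A) = wordValue n X (u ++ L.flatMap B) := by
  induction L generalizing u with
  | nil => rfl
  | cons i L ih =>
    rw [List.nodup_cons] at hn
    rw [List.flatMap_cons, List.flatMap_cons] at *
    have hi := hA i (by simp)
    rw [wordValue_isRotated n h _ _ (hAB i), ← List.append_assoc, ih hn.2, List.append_assoc]
    · rw [List.append_assoc]
      exact mem_arr_of_perm h (List.Perm.append_left _ (List.Perm.append_right _ (hAB i).perm))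
    · exact fun j hj => hA j (by simp [hj])
    · intro c hc j hj e
      rcases List.mem_append.1 hc with hc | hc
      · exact hu c hc j (by simp [hj]) e
      · have := hi c ((hAB i).mem_iff.2 hc)
        rw [this, Option.some.injEq] at e
        exact hn.1 (e ▸ hj)
    · intro b hb c hc hbc
      exact hu c hc i (by simp) (hbc.2.2.2.symm.trans (hi b hb))
    · intro b hb c hc hbc
      obtain ⟨j, hj, hc⟩ := List.mem_flatMap.1 hc
      have h1 := hA j (by simp [hj]) c hc
      have h2 := hbc.2.2.2.symm.trans (hi b hb)
      rw [h1, Option.some.injEq] at h2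
      exact hn.1 (h2 ▸ hj)

/-- The letters of a word distributed according to their colours. -/
def Marked.sort (X : Marked l) {v : List X.H} (hv : v ∈ arr X.legs) : X.Placement :=
  ⟨fun i => v.filter fun a => X.color a = some i, fun i => ⟨(mem_arr.1 hv).1.filter _, fun h => by
    rw [List.mem_filter, decide_eq_true_eq, and_iff_right_iff_imp, (mem_arr.1 hv).2,
      Marked.mem_legs, ← X.color_isSome]
    intro e
    rw [e, Option.isSome_some]⟩⟩

/-- The concatenation of the words of a placement. -/
def Marked.Placement.flat {X : Marked l} (w : X.Placement) : List X.H := (List.finRange l).flatMap w.1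

theorem Marked.Placement.flat_mem_arr {X : Marked l} (w : X.Placement) : w.flat ∈ arr X.legs := by
  rw [mem_arr, Marked.Placement.flat, List.nodup_flatMap]
  refine ⟨⟨fun i _ => (w.2 i).1, ?_⟩, fun h => ?_⟩
  · refine (List.nodup_finRange l).imp fun {i j} hij a hi hj => hij ?_
    rw [(w.2 _).2] at hi hj
    exact Option.some.inj (hi.symm.trans hj)
  · rw [Marked.mem_legs, ← X.color_isSome, Option.isSome_iff_exists]
    simp [(w.2 _).2]

/-- A word mixes the colours, whereas a diagram records only the order on each string. Because
different colours commute, no information about the value is lost. -/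
theorem wordValue_sort (n : ℕ) {X : Marked l} {v : List X.H} (hv : v ∈ arr X.legs) :
    wordValue n X v = wordValue n X (X.sort hv).flat :=
  wordValue_flatMap n (u := []) (List.nodup_finRange l) hv fun a ha => by
    obtain ⟨i, hi⟩ := Marked.isSome_of_mem hv ha
    exact ⟨i, List.mem_finRange i, hi⟩

theorem flatMap_ite {α ι : Type*} {L : List ι} (hL : L.Nodup) {i : ι} (hi : i ∈ L)
    (x : List α) : (L.flatMap fun j => if j = i then x else []) = x := by
  induction L with
  | nil => cases hi
  | cons j L ih =>
    rw [List.nodup_cons] at hL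
    rw [List.flatMap_cons]
    by_cases hj : j = i
    · subst hj
      rw [if_pos rfl, List.flatMap_eq_nil_iff.2, List.append_nil]
      intro k hk
      rw [if_neg]
      rintro rfl
      exact hL.1 hk
    · rw [if_neg hj, List.nil_append, ih hL.2]
      exact (List.mem_cons.1 hi).resolve_left (Ne.symm hj)

theorem Marked.sort_flat {X : Marked l} (w : X.Placement) : X.sort w.flat_mem_arr = w := by
  refine Subtype.ext (funext fun i => ?_)
  change (w.flat.filter _) = _
  rw [Marked.Placement.flat, List.filter_flatMap]
  refine Eq.trans (List.flatMap_congr fun j _ => ?_)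
    (flatMap_ite (List.nodup_finRange l) (List.mem_finRange i) (w.1 i))
  split_ifs with h
  · subst h
    rw [List.filter_eq_self]
    intro a ha
    simpa using ((w.2 _).2 a).1 ha
  · rw [List.filter_eq_nil_iff]
    intro a ha
    simpa [((w.2 _).2 a).1 ha] using h

/-! ### Words and placements -/

theorem exists_perm_map {α : Type*} {a b : List α} (ha : a.Nodup) (hb : b.Nodup)
    (h : a.length = b.length) : ∃ σ : Perm α, a.map σ = b := by
  let x : Fin a.length ↪ α := ⟨a.get, List.nodup_iff_injective_get.1 ha⟩
  let y : Fin a.length ↪ α := ⟨fun i => b.get (i.cast h), fun i j e =>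
    Fin.cast_injective h (List.nodup_iff_injective_get.1 hb e)⟩
  have := Equiv.Perm.isMultiplyPretransitive α a.length
  obtain ⟨σ, hσ⟩ := MulAction.exists_smul_eq (Perm α) x y
  refine ⟨σ, List.ext_getElem (by simpa using h) fun i h1 h2 => ?_⟩
  have := DFunLike.congr_fun hσ ⟨i, by simpa using h1⟩
  rw [List.getElem_map]
  exact this

theorem flatMap_injective {α ι : Type*} {L : List ι} {A B : ι → List α}
    (hlen : ∀ i ∈ L, (A i).length = (B i).length) (h : L.flatMap A = L.flatMap B) :
    ∀ i ∈ L, A i = B i := by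
  induction L with
  | nil => simp
  | cons j L ih =>
    rw [List.flatMap_cons, List.flatMap_cons] at h
    have := List.append_inj h (hlen j (by simp))
    intro i hi
    rcases List.mem_cons.1 hi with rfl | hi
    · exact this.1
    · exact ih (fun i hi => hlen i (by simp [hi])) this.2 i hi

theorem Marked.Placement.exists_perm {X : Marked l} (w w' : X.Placement) :
    ∃ σ : Perm X.H, (∀ h, X.color (σ h) = X.color h) ∧ ∀ i, (w.1 i).map σ = w'.1 i := by
  obtain ⟨σ, hσ⟩ := exists_perm_map (mem_arr.1 w.flat_mem_arr).1 (mem_arr.1 w'.flat_mem_arr).1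
    ((length_of_mem_arr w.flat_mem_arr).trans (length_of_mem_arr w'.flat_mem_arr).symm)
  have h : ∀ i, (w.1 i).map σ = w'.1 i := fun i => by
    refine flatMap_injective (L := List.finRange l) (A := fun i => (w.1 i).map σ) (B := w'.1)
      (fun i _ => ?_) ?_ i (List.mem_finRange i)
    · rw [List.length_map]
      refine List.Perm.length_eq ((List.perm_ext_iff_of_nodup (w.2 i).1 (w'.2 i).1).2 fun a => ?_)
      rw [(w.2 i).2, (w'.2 i).2]
    · rw [← List.map_flatMap]
      exact hσ
  refine ⟨σ, fun a => Option.ext fun i => ?_, h⟩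
  rw [← (w'.2 i).2, ← h i, ← (w.2 i).2, List.mem_map_of_injective σ.injective]

/-- A colour-preserving permutation of the legs carrying `w` to `w'` embeds the words sorted to `w`
in those sorted to `w'`. By symmetry all fibres of sorting have the same size. -/
theorem Marked.card_sort_le {X : Marked l} (w w' : X.Placement) :
    ((arr X.legs).attach.filter fun v => X.sort v.2 = w).card ≤
      ((arr X.legs).attach.filter fun v => X.sort v.2 = w').card := by
  obtain ⟨σ, hσ, h⟩ := w.exists_perm w'
  have hm : ∀ v ∈ arr X.legs, v.map σ ∈ arr X.legs := fun v hv => by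
    have h1 := ChineseChar.map_mem_arr σ.toEmbedding hv
    have h2 : X.legs.map σ.toEmbedding = X.legs := by
      refine Finset.eq_of_subset_of_card_le ?_ (Finset.card_map _).ge
      intro a ha
      obtain ⟨b, hb, rfl⟩ := Finset.mem_map.1 ha
      rw [Marked.mem_legs, ← X.color_isSome] at hb ⊢
      rwa [← hσ] at hb
    rwa [h2] at h1
  refine Finset.card_le_card_of_injOn (fun v => ⟨v.1.map σ, hm v.1 v.2⟩) ?_ ?_
  · intro v hv
    have hv := (Finset.mem_filter.1 hv).2
    refine Finset.mem_filter.2 ⟨Finset.mem_attach _ _, Subtype.ext (funext fun i => ?_)⟩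
    rw [← h i, ← hv]
    change (v.1.map σ).filter _ = (v.1.filter _).map σ
    rw [List.filter_map]
    congr 1
    refine List.filter_congr fun a _ => ?_
    simp [hσ]
  · intro v _ v' _ e
    exact Subtype.ext (List.map_injective_iff.2 σ.injective (congrArg Subtype.val e))

theorem Marked.card_placement (X : Marked l) :
    Fintype.card X.Placement = ∏ i, (X.numLegs i).factorial := by
  rw [← Nat.card_eq_fintype_card]
  refine (Nat.card_congr (Equiv.subtypePiEquivPi (p := fun i (w : List X.H) =>
    w.Nodup ∧ ∀ h, h ∈ w ↔ X.color h = some i))).trans ?_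
  rw [Nat.card_pi]
  refine Finset.prod_congr rfl fun i _ => ?_
  have := Fintype.ofFinite X.H
  rw [Marked.numLegs, Nat.card_eq_fintype_card (α := {h : X.H // X.color h = some i}),
    Fintype.card_subtype, ← card_arr, ← Nat.card_eq_finsetCard]
  refine Nat.card_congr (Equiv.subtypeEquivRight fun w => ?_)
  rw [mem_arr]
  simp

/-- Averaging over all words is the same as averaging over all placements. -/
theorem Marked.sum_sort {V : Type*} [AddCommGroup V] [Module ℚ V] (X : Marked l)
    (φ : X.Placement → V) :
    (∏ i, ((X.numLegs i).factorial : ℚ)) • ∑ v ∈ (arr X.legs).attach, φ (X.sort v.2) =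
      (X.legs.card.factorial : ℚ) • ∑ w, φ w := by
  rcases isEmpty_or_nonempty X.Placement with he | ⟨⟨w₀⟩⟩
  · have : (arr X.legs).attach = ∅ := by
      rw [Finset.eq_empty_iff_forall_notMem]
      intro v
      exact (he.false (X.sort v.2)).elim
    simp [this]
  set c := ((arr X.legs).attach.filter fun v => X.sort v.2 = w₀).card with hc
  have hcw : ∀ w, ((arr X.legs).attach.filter fun v => X.sort v.2 = w).card = c := fun w =>
    le_antisymm (Marked.card_sort_le w w₀) (Marked.card_sort_le w₀ w)
  have hsum : ∑ v ∈ (arr X.legs).attach, φ (X.sort v.2) = (c : ℚ) • ∑ w, φ w := by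
    rw [← Finset.sum_fiberwise (arr X.legs).attach (fun v => X.sort v.2), Finset.smul_sum]
    refine Finset.sum_congr rfl fun w _ => ?_
    rw [Finset.sum_congr rfl fun v hv => congrArg φ (Finset.mem_filter.1 hv).2, Finset.sum_const,
      hcw, Nat.cast_smul_eq_nsmul]
  -- Counting all words by their placements gives the common size of the fibres.
  have hcard : X.legs.card.factorial = (∏ i, (X.numLegs i).factorial) * c := by
    rw [← card_arr, ← Finset.card_attach, ← X.card_placement,
      Finset.card_eq_sum_card_fiberwise (f := fun v => X.sort v.2) (t := Finset.univ)
        fun _ _ => Finset.mem_coe.2 (Finset.mem_univ _), Finset.sum_congr rfl fun w _ => hcw w]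
    simp
  rw [hsum, smul_smul, hcard]
  push_cast
  rfl

theorem Marked.sum_flat (n : ℕ) (X : Marked l) :
    ∑ w : X.Placement, wordValue n X w.flat =
      (∏ i, ((X.numLegs i).factorial : ℚ)) • X.jPrime n := by
  have h := X.sum_sort fun w => wordValue n X w.flat
  have h0 : (X.legs.card.factorial : ℚ) ≠ 0 := by exact_mod_cast Nat.factorial_ne_zero _
  rw [Finset.sum_congr rfl fun v _ => (wordValue_sort n v.2).symm,
    Finset.sum_attach (arr X.legs) (wordValue n X), sum_wordValue, smul_comm] at h
  exact (smul_right_injective _ h0 h).symm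

/-! ### The map on diagrams -/

/-- The coloured graph of a diagram. -/
def Diagram.toMarked (D : Diagram l) : Marked l where
  toUTGraph := D.toUTGraph
  color h := if hi : ∃ i, h ∈ D.word i then some hi.choose else none
  color_isSome h := by
    rw [← D.mem_word]
    split_ifs with hi <;> simp [hi]

theorem Diagram.toMarked_color (D : Diagram l) {h : D.H} {i : Fin l} :
    D.toMarked.color h = some i ↔ h ∈ D.word i := by
  change (if hi : ∃ i, h ∈ D.word i then some hi.choose else none) = some i ↔ _
  split_ifs with hi
  · rw [Option.some.injEq]
    exact ⟨fun e => e ▸ hi.choose_spec, D.word_disjoint _ _ h hi.choose_spec⟩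
  · simp only [false_iff]
    exact fun h' => hi ⟨i, h'⟩

/-- The placement given by a diagram. -/
def Diagram.placement (D : Diagram l) : D.toMarked.Placement :=
  ⟨D.word, fun i => ⟨D.word_nodup i, fun _ => D.toMarked_color.symm⟩⟩

theorem Diagram.place_placement (D : Diagram l) : D.toMarked.place D.placement = D := rfl

/-- The extension of `j'_n` to diagrams. -/
def diagramValue (n : ℕ) (D : Diagram l) : TriSpace := wordValue n D.toMarked D.placement.flat

theorem Marked.isRewire_place {X : Marked l} (w : X.Placement) :
    IsRewire X (X.place w).toMarked (Equiv.refl _) 1 :=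
  ⟨fun _ _ => rfl, fun _ => rfl, fun _ => rfl, fun h => Option.ext fun i =>
    (Diagram.toMarked_color _).trans ((w.2 i).2 h)⟩

theorem diagramValue_place (n : ℕ) {X : Marked l} (w : X.Placement) :
    diagramValue n (X.place w) = wordValue n X w.flat := by
  exact (congrArg (wordValue n (X.place w).toMarked) (List.map_id w.flat).symm).trans
    (wordValue_iso n (Marked.isRewire_place w) w.flat_mem_arr)

/-- Transport along the homeomorphism leaves a word whose colour blocks are rotations of those of
the target. -/
theorem diagramValue_circleIso (n : ℕ) {D D' : Diagram l} (h : D.CircleIso D') :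
    diagramValue n D = diagramValue n D' := by
  obtain ⟨f, h1, h2, h3⟩ := h
  have R : IsRewire D.toMarked D'.toMarked f 1 :=
    ⟨fun _ _ => rfl, fun h => (h1 h).symm, fun h => (h2 h).symm, fun h => Option.ext fun i =>
      (Diagram.toMarked_color D').trans (((h3 i).mem_iff.symm.trans
        (List.mem_map_of_injective f.injective)).trans D.toMarked_color.symm)⟩
  have hw := R.map_mem_arr D.placement.flat_mem_arr
  rw [diagramValue, ← wordValue_iso n R D.placement.flat_mem_arr]
  rw [Marked.Placement.flat, List.map_flatMap] at hw ⊢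
  refine wordValue_rotate_blocks n (u := []) (List.nodup_finRange l) hw ?_ (by simp) h3
  intro i _ a ha
  exact D'.toMarked_color.2 ((h3 i).mem_iff.1 ha)

/-- The lists `p` and `q` serve all alphabets at once; this is needed because the joined diagram in
an STU relation has other half-edges. -/
theorem flatMap_update (i : Fin l) : ∃ p q : List (Fin l), ∀ {α : Type} (W : Fin l → List α) x,
    (List.finRange l).flatMap (Function.update W i x) = p.flatMap W ++ (x ++ q.flatMap W) := by
  obtain ⟨p, q, hpq⟩ := List.append_of_mem (List.mem_finRange i)
  refine ⟨p, q, fun W x => ?_⟩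
  have hn := List.nodup_finRange l
  rw [hpq, List.nodup_append, List.nodup_cons] at hn
  rw [hpq, List.flatMap_append, List.flatMap_cons, Function.update_self]
  congr 1
  · exact List.flatMap_congr fun j hj => Function.update_of_ne (hn.2.2 j hj i (by simp)) _ _
  · congr 1
    refine List.flatMap_congr fun j hj => Function.update_of_ne ?_ _ _
    rintro rfl
    exact hn.2.1.1 hj

section

variable (D : Diagram l) (i : Fin l) (l₁ : List D.H) (b c : D.H) (l₂ : List D.H)
  (hw : D.word i = l₁ ++ b :: c :: l₂)

include hw in
theorem Diagram.fusable : D.toMarked.Fusable b c := by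
  have hb : b ∈ D.word i := by rw [hw]; simp
  have hc : c ∈ D.word i := by rw [hw]; simp
  refine ⟨(D.mem_word b).1 ⟨i, hb⟩, (D.mem_word c).1 ⟨i, hc⟩, ?_, ?_⟩
  · have h := D.word_nodup i
    rw [hw] at h
    rintro rfl
    simp [List.nodup_append] at h
  · rw [D.toMarked_color.2 hb, D.toMarked_color.2 hc]

theorem Diagram.mem_transpose (j : Fin l) (h : D.H) :
    h ∈ (D.transpose i l₁ b c l₂ hw).word j ↔ h ∈ D.word j := by
  change h ∈ Function.update D.word i (l₁ ++ c :: b :: l₂) j ↔ _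
  by_cases hj : j = i
  · subst hj
    rw [Function.update_self, hw]
    simp only [List.mem_append, List.mem_cons]
    tauto
  · rw [Function.update_of_ne hj]

theorem Diagram.mem_fuse_inl (j : Fin l) (h : D.H) :
    (Sum.inl h : D.H ⊕ Bool) ∈ (D.fuse i l₁ b c l₂ hw).word j ↔ h ∈ D.word j ∧ ¬ (h = b ∨ h = c) := by
  change (Sum.inl h : D.H ⊕ Bool) ∈ Function.update (fun j => (D.word j).map Sum.inl) i
    (l₁.map Sum.inl ++ Sum.inr true :: l₂.map Sum.inl) j ↔ _
  have hn := D.word_nodup i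
  by_cases hj : j = i
  · subst hj
    rw [hw] at hn
    simp only [List.nodup_append, List.nodup_cons, List.mem_cons, not_or] at hn
    rw [Function.update_self, hw]
    simp only [List.mem_append, List.mem_map, List.mem_cons]
    grind
  · rw [Function.update_of_ne hj]
    have hb' : b ∉ D.word j := fun hm => hj (D.word_disjoint j i b hm (by rw [hw]; simp))
    have hc' : c ∉ D.word j := fun hm => hj (D.word_disjoint j i c hm (by rw [hw]; simp))
    simp only [List.mem_map]
    grind

theorem Diagram.mem_fuse_inr (j : Fin l) (t : Bool) :
    (Sum.inr t : D.H ⊕ Bool) ∈ (D.fuse i l₁ b c l₂ hw).word j ↔ t = true ∧ j = i := by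
  change (Sum.inr t : D.H ⊕ Bool) ∈ Function.update (fun j => (D.word j).map Sum.inl) i
    (l₁.map Sum.inl ++ Sum.inr true :: l₂.map Sum.inl) j ↔ _
  by_cases hj : j = i
  · subst hj
    rw [Function.update_self]
    simp
  · rw [Function.update_of_ne hj]
    simp [hj]

theorem Diagram.isRewire_transpose :
    IsRewire D.toMarked (D.transpose i l₁ b c l₂ hw).toMarked (Equiv.refl _) 1 :=
  ⟨fun _ _ => rfl, fun _ => rfl, fun _ => rfl, fun h => Option.ext fun j =>
    ((Diagram.toMarked_color _).trans (D.mem_transpose i l₁ b c l₂ hw j h)).trans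
      D.toMarked_color.symm⟩

theorem Diagram.isRewire_fuse :
    IsRewire (D.toMarked.fuse b c (D.fusable i l₁ b c l₂ hw))
      (D.fuse i l₁ b c l₂ hw).toMarked (Equiv.refl _) 1 := by
  have hb : b ∈ D.word i := by rw [hw]; simp
  refine ⟨fun _ _ => rfl, fun _ => rfl, fun _ => rfl, fun h => Option.ext fun j => ?_⟩
  refine (Diagram.toMarked_color _).trans ?_
  rcases h with h | t
  · refine (D.mem_fuse_inl i l₁ b c l₂ hw j h).trans ?_
    change _ ↔ (if h = b ∨ h = c then none else D.toMarked.color h) = some j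
    split_ifs with h1
    · exact ⟨fun e => absurd h1 e.2, fun e => by cases e⟩
    · exact ⟨fun e => D.toMarked_color.2 e.1, fun e => ⟨D.toMarked_color.1 e, h1⟩⟩
  · refine (D.mem_fuse_inr i l₁ b c l₂ hw j t).trans ?_
    change _ ↔ (if t then D.toMarked.color b else none) = some j
    rw [D.toMarked_color.2 hb]
    cases t <;> simp [eq_comm]

/-- Two legs adjacent on a string are also adjacent in the concatenated word, so STU for diagrams is
STU for words with the other strings as prefix and suffix. -/
theorem diagramValue_stu (n : ℕ) :
    diagramValue n (D.fuse i l₁ b c l₂ hw) - diagramValue n D +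
      diagramValue n (D.transpose i l₁ b c l₂ hw) = 0 := by
  obtain ⟨p, q, hpq⟩ := flatMap_update i
  let P := p.flatMap D.word
  let Q := q.flatMap D.word
  have e1 : (List.finRange l).flatMap D.word = (P ++ l₁) ++ b :: c :: (l₂ ++ Q) := by
    have := hpq D.word (D.word i)
    rw [Function.update_eq_self, hw] at this
    simpa using this
  have e2 : (List.finRange l).flatMap (Function.update D.word i (l₁ ++ c :: b :: l₂)) =
      (P ++ l₁) ++ c :: b :: (l₂ ++ Q) := by
    simpa using hpq D.word (l₁ ++ c :: b :: l₂)
  have e3 : (List.finRange l).flatMap (Function.update (fun j => (D.word j).map Sum.inl) i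
      (l₁.map Sum.inl ++ Sum.inr true :: l₂.map Sum.inl)) =
      (P ++ l₁).map Sum.inl ++ (Sum.inr true : D.H ⊕ Bool) :: (l₂ ++ Q).map Sum.inl := by
    refine (hpq (fun j => (D.word j).map Sum.inl)
      (l₁.map Sum.inl ++ Sum.inr true :: l₂.map Sum.inl)).trans ?_
    simp [P, Q, List.map_flatMap]
  have hF := D.fusable i l₁ b c l₂ hw
  have hm : (P ++ l₁) ++ b :: c :: (l₂ ++ Q) ∈ arr D.toMarked.legs := e1 ▸ D.placement.flat_mem_arr
  have h1 := wordValue_swap n hm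
  have h2 := wordValue_iso n (D.isRewire_transpose i l₁ b c l₂ hw) (mem_arr_swap hm)
  have h3 := wordValue_iso n (D.isRewire_fuse i l₁ b c l₂ hw) (Marked.mem_arr_fuse hF hm)
  have h1' : diagramValue n D = _ := congrArg (wordValue n D.toMarked) e1
  have h2' : diagramValue n (D.transpose i l₁ b c l₂ hw) = _ :=
    (congrArg (wordValue n _) (e2.trans (List.map_id _).symm)).trans h2
  have h3' : diagramValue n (D.fuse i l₁ b c l₂ hw) = _ :=
    (congrArg (wordValue n _) (e3.trans (List.map_id _).symm)).trans h3
  have h4 := h1.trans (dif_pos hF)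
  rw [h1', h2', h3']
  have key : ∀ x y z : TriSpace, x - y = z → z - x + y = 0 := by
    rintro x y _ rfl
    abel
  exact key _ _ _ h4

end

/-- The map `j'_n` on diagrams on circles. -/
def circleMap (n l : ℕ) : CircleSpace l →ₗ[ℚ] TriSpace :=
  (circleSub l).liftQ (Finsupp.linearCombination ℚ (diagramValue n)) (by
    rw [circleSub, Submodule.span_le]
    rintro r (⟨D, D', h, rfl⟩ | ⟨D, i, l₁, b, c, l₂, hw, rfl⟩)
    · simp [diagramValue_circleIso n h]
    · simpa using diagramValue_stu D i l₁ b c l₂ hw n)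

theorem circleMap_onCircles (n : ℕ) (D : Diagram l) :
    circleMap n l D.onCircles = diagramValue n D := by
  simp [circleMap, Diagram.onCircles]

theorem closure_onStrings (D : Diagram l) : closure l D.onStrings = D.onCircles := by
  simp [closure, Diagram.onStrings, Diagram.onCircles]

theorem closure_chi (X : Marked l) : closure l X.chi =
    (∏ i, ((X.numLegs i).factorial : ℚ))⁻¹ • ∑ w : X.Placement, (X.place w).onCircles := by
  simp [Marked.chi, closure_onStrings]

theorem prod_factorial_ne_zero (X : Marked l) : (∏ i, ((X.numLegs i).factorial : ℚ)) ≠ 0 :=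
  Finset.prod_ne_zero_iff.2 fun _ _ => by exact_mod_cast Nat.factorial_ne_zero _

theorem isJPrime_circleMap (n l : ℕ) : IsJPrime n l (circleMap n l) := by
  intro X
  rw [closure_chi, map_smul, map_sum]
  simp only [circleMap_onCircles, diagramValue_place]
  rw [Marked.sum_flat, smul_smul, inv_mul_cancel₀ (prod_factorial_ne_zero X), one_smul]

/-! ### Uniqueness -/

theorem onCircles_stu (D : Diagram l) (i : Fin l) (l₁ : List D.H) (b c : D.H) (l₂ : List D.H)
    (hw : D.word i = l₁ ++ b :: c :: l₂) :
    (D.fuse i l₁ b c l₂ hw).onCircles - D.onCircles + (D.transpose i l₁ b c l₂ hw).onCircles = 0 := by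
  simp only [Diagram.onCircles]
  rw [← map_sub, ← map_add, Submodule.mkQ_apply, Submodule.Quotient.mk_eq_zero]
  exact Submodule.subset_span (Or.inr ⟨D, i, l₁, b, c, l₂, hw, rfl⟩)

theorem Diagram.eq_of_word (G : UTGraph) {w w' : Fin l → List G.H} (h : w = w') (h1 h2 h3 h1' h2' h3') :
    (⟨G, w, h1, h2, h3⟩ : Diagram l) = ⟨G, w', h1', h2', h3'⟩ := by
  subst h
  rfl

/-- An exchange in a mixed word is invisible on the strings if the colours differ, and is an
exchange on one string otherwise. -/
theorem Marked.place_sort_swap {X : Marked l} {u v : List X.H} {b c : X.H}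
    (h : u ++ b :: c :: v ∈ arr X.legs) (h' : u ++ c :: b :: v ∈ arr X.legs) :
    (X.sort h = X.sort h') ∨ ∃ (i : Fin l) (l₁ l₂ : List X.H)
      (hw : (X.place (X.sort h)).word i = l₁ ++ b :: c :: l₂),
      X.place (X.sort h') = (X.place (X.sort h)).transpose i l₁ b c l₂ hw := by
  by_cases hbc : X.color b = X.color c
  · right
    obtain ⟨i, hi⟩ := Marked.isSome_of_mem h (h := b) (by simp)
    have hc := hbc.symm.trans hi
    refine ⟨i, u.filter fun a => X.color a = some i, v.filter fun a => X.color a = some i, ?_, ?_⟩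
    · change (u ++ b :: c :: v).filter _ = _
      simp [hi, hc]
    · have e : (fun j => (u ++ c :: b :: v).filter fun a => X.color a = some j) =
          Function.update (fun j => (u ++ b :: c :: v).filter fun a => X.color a = some j) i
            ((u.filter fun a => X.color a = some i) ++
              c :: b :: v.filter fun a => X.color a = some i) := by
        funext j
        by_cases hj : j = i
        · subst hj
          simp [hi, hc]
        · simp [hi, hc, hj, Ne.symm hj]
      exact Diagram.eq_of_word X.toUTGraph e _ _ _ _ _ _
  · left
    refine Subtype.ext (funext fun i => ?_)
    change (u ++ b :: c :: v).filter _ = (u ++ c :: b :: v).filter _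
    by_cases hb : X.color b = some i
    · have hc : ¬ X.color c = some i := fun hc => hbc (hb.trans hc.symm)
      simp [hb, hc]
    · simp [hb, List.filter_cons]

/-- Modulo diagrams with fewer legs, STU identifies all placements of `X`, hence each of them with
its symmetrization. Induction on the number of legs shows that the closed symmetrizations span. -/
theorem eq_zero_of_place {V : Type*} [AddCommGroup V] [Module ℚ V] {K : CircleSpace l →ₗ[ℚ] V}
    (hK : ∀ X : Marked l, K (closure l X.chi) = 0) {k : ℕ} {X : Marked l} (hX : X.legs.card = k)
    (w : X.Placement) : K (X.place w).onCircles = 0 := by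
  induction k using Nat.strong_induction_on generalizing X with
  | _ k ih =>
    -- The uniqueness principle concerns functions on all lists; the value off the arrangements is
    -- irrelevant.
    let ψ : List X.H → V := fun v =>
      if hv : v ∈ arr X.legs then K (X.place (X.sort hv)).onCircles else 0
    have hψ : ∀ {v} (hv : v ∈ arr X.legs), ψ v = K (X.place (X.sort hv)).onCircles :=
      fun hv => dif_pos hv
    rw [← X.sort_flat w, ← hψ]
    refine eq_zero_of_swap_invariant (fun u b c v h => ?_) ?_ w.flat_mem_arr
    · have h' := mem_arr_swap h
      rw [hψ h, hψ h']
      rcases Marked.place_sort_swap h h' with e | ⟨i, l₁, l₂, hw, e⟩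
      · rw [e]
      · have e1 := congrArg K (onCircles_stu (X.place (X.sort h)) i l₁ b c l₂ hw)
        have e2 := (Diagram.isRewire_fuse (X.place (X.sort h)) i l₁ b c l₂ hw).card_legs
        have e3 := (X.place (X.sort h)).toMarked.card_legs_fuse
          (Diagram.fusable (X.place (X.sort h)) i l₁ b c l₂ hw)
        have e4 := (Marked.isRewire_place (X.sort h)).card_legs
        have e5 := ih _ (by omega) e2 (Diagram.placement _)
        rw [Diagram.place_placement] at e5
        rw [map_add, map_sub, e5, zero_sub, map_zero, neg_add_eq_zero] at e1
        rw [e, e1]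
    · have h := X.sum_sort fun w => K (X.place w).onCircles
      have h0 := hK X
      rw [closure_chi, map_smul, map_sum, smul_eq_zero] at h0
      rw [h0.resolve_left (inv_ne_zero (prod_factorial_ne_zero X)), smul_zero, smul_eq_zero] at h
      rw [← Finset.sum_attach]
      exact (Finset.sum_congr rfl fun v _ => hψ v.2).trans
        (h.resolve_left (prod_factorial_ne_zero X))

theorem isJPrime_unique {n : ℕ} {J J' : CircleSpace l →ₗ[ℚ] TriSpace} (hJ : IsJPrime n l J)
    (hJ' : IsJPrime n l J') : J' = J := by
  rw [← sub_eq_zero]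
  refine Submodule.linearMap_qext _ (Finsupp.lhom_ext' fun D => LinearMap.ext_ring ?_)
  exact eq_zero_of_place (K := J' - J) (fun X => by
    rw [LinearMap.sub_apply, hJ, hJ', sub_self]) rfl D.placement

/-! ### Graphs with many trivalent vertices -/

theorem Marked.card_legs_eq_sum (X : Marked l) : X.legs.card = ∑ i, X.numLegs i := by
  have e : ∀ i, X.numLegs i = (X.legs.filter fun h => X.color h = some i).card := fun i => by
    refine Nat.subtype_card _ fun h => ?_
    rw [Finset.mem_filter, Marked.mem_legs, ← X.color_isSome, and_iff_right_iff_imp]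
    intro hh
    rw [hh, Option.isSome_some]
  rw [Finset.sum_congr rfl fun i _ => e i,
    Finset.card_eq_sum_card_fiberwise (f := X.color) (t := Finset.univ.map Function.Embedding.some),
    Finset.sum_map]
  · rfl
  · intro h hh
    obtain ⟨i, hi⟩ := Option.isSome_iff_exists.1 ((X.color_isSome h).2 (Marked.mem_legs.1 hh))
    simp [hi]

/-- `opp` is an involution without fixed points. -/
theorem Marked.two_dvd (X : Marked l) : 2 ∣ X.numInner + X.legs.card := by
  have := Fintype.ofFinite X.H
  rw [X.numInner_eq, Nat.card_eq_fintype_card, ← Nat.modEq_zero_iff_dvd]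
  refine (Perm.card_fixedPoints_modEq (f := (⇑X.opp : X.H → X.H)) (p := 2) (n := 1)
    (funext X.opp_opp)).trans ?_
  rw [Fintype.card_eq_zero_iff.2 ⟨fun h => X.opp_ne _ h.2⟩]

/-- The cube of `rot` is the identity, and its fixed points are the legs. -/
theorem Marked.three_dvd (X : Marked l) : 3 ∣ X.numInner := by
  have := Fintype.ofFinite X.H
  have h := Perm.card_fixedPoints_modEq (f := (⇑X.rot : X.H → X.H)) (p := 3) (n := 1)
    (funext X.rot_rot_rot)
  rw [← Nat.card_eq_fintype_card, ← X.numInner_eq, ← Nat.card_eq_fintype_card] at h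
  have h2 : Nat.card (Function.fixedPoints X.rot) = X.legs.card := X.card_isLeg
  have h3 := h.trans (congrArg (· % 3) h2)
  rw [Nat.ModEq] at h3
  omega

/-- With `2n` legs of each colour and degree at most `(l+1)n`, at most `2(l+1)n - 2ln = 2n` vertices
are trivalent, which gives `6n` half-edges. The divisibilities by `2` and `3` compensate for the
rounding in the definition of the degree. -/
theorem jPrime_eq_zero {n : ℕ} {X : Marked l} (hX : 6 * n < X.numInner) : X.jPrime n = 0 := by
  rw [Marked.jPrime, if_neg]
  rintro ⟨h1, h2⟩
  have h3 := X.card_legs_eq_sum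
  rw [Finset.sum_congr rfl fun i _ => h1 i, Finset.sum_const, Finset.card_univ, Fintype.card_fin,
    smul_eq_mul] at h3
  have h4 := X.two_dvd
  have h5 := X.three_dvd
  rw [UTGraph.degree, UTGraph.numVertices, X.card_isLeg, ← Marked.numInner] at h2
  have h6 : l * (2 * n) = 2 * (l * n) := by ring
  have h7 : (l + 1) * n = l * n + n := by ring
  rw [h6] at h3
  rw [h7] at h2
  omega

/-- Joining legs only increases the number of trivalent vertices, so by induction the value is
independent of the word, and its mean `X.jPrime n` is zero. -/
theorem wordValue_eq_zero {n : ℕ} {X : Marked l} (hX : 6 * n < X.numInner) {w : List X.H}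
    (hw : w ∈ arr X.legs) : wordValue n X w = 0 := by
  obtain ⟨k, hk⟩ : ∃ k, X.legs.card = k := ⟨_, rfl⟩
  induction k using Nat.strong_induction_on generalizing X with
  | _ k ih =>
    refine eq_zero_of_swap_invariant (fun u b c v h => ?_) ?_ hw
    · rw [← sub_eq_zero, wordValue_swap n h, bracket]
      split_ifs with hbc
      · have h1 := Marked.numInner_fuse hbc
        have h2 := X.card_legs_fuse hbc
        exact ih _ (by omega) (by omega) (Marked.mem_arr_fuse hbc h) rfl
      · rfl
    · rw [sum_wordValue, jPrime_eq_zero hX, smul_zero]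

/-! ### Denominators -/

/-- The elements of `TriSpace` with a denominator having no prime factor above `m`. -/
def smoothSubgroup (m : ℕ) : AddSubgroup TriSpace where
  carrier := {v | ∃ N : ℕ, 0 < N ∧ (∀ p : ℕ, p.Prime → p ∣ N → p ≤ m) ∧ HasDenominator N v}
  zero_mem' := ⟨1, one_pos, fun p hp h => by
    rw [Nat.dvd_one] at h
    exact absurd h hp.ne_one, by
    rw [HasDenominator, smul_zero]
    exact zero_mem _⟩
  add_mem' := by
    rintro a b ⟨N, hN, hp, h⟩ ⟨N', hN', hp', h'⟩
    refine ⟨N * N', Nat.mul_pos hN hN', fun p hpp hd => ?_, ?_⟩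
    · rcases hpp.dvd_mul.1 hd with hd | hd
      · exact hp p hpp hd
      · exact hp' p hpp hd
    · rw [HasDenominator] at h h' ⊢
      have e : ((N * N' : ℕ) : ℚ) • (a + b) = N' • ((N : ℚ) • a) + N • ((N' : ℚ) • b) := by
        rw [← Nat.cast_smul_eq_nsmul ℚ, ← Nat.cast_smul_eq_nsmul ℚ, smul_smul, smul_smul, smul_add,
          Nat.cast_mul, mul_comm (N' : ℚ)]
      rw [e]
      exact add_mem (nsmul_mem h _) (nsmul_mem h' _)
  neg_mem' := by
    rintro a ⟨N, hN, hp, h⟩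
    refine ⟨N, hN, hp, ?_⟩
    rw [HasDenominator, smul_neg]
    exact neg_mem h

theorem factorial_inv_smul_mem {m j : ℕ} (hj : j ≤ m) {v : TriSpace} (hv : v ∈ smoothSubgroup m) :
    (j.factorial : ℚ)⁻¹ • v ∈ smoothSubgroup m := by
  obtain ⟨N, hN, hp, h⟩ := hv
  refine ⟨N * j.factorial, Nat.mul_pos hN j.factorial_pos, fun p hpp hd => ?_, ?_⟩
  · rcases hpp.dvd_mul.1 hd with hd | hd
    · exact hp p hpp hd
    · exact (hpp.dvd_factorial.1 hd).trans hj
  · rw [HasDenominator, smul_smul, Nat.cast_mul, mul_assoc, mul_inv_cancel₀, mul_one]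
    · exact h
    · exact_mod_cast j.factorial_ne_zero

/-- These values are integral, so no denominator is needed. -/
theorem jPrime_mem (n m : ℕ) (X : Marked l) : X.jPrime n ∈ smoothSubgroup m := by
  refine ⟨1, one_pos, fun p hp h => absurd (Nat.dvd_one.1 h) hp.ne_one, ?_⟩
  rw [HasDenominator, Nat.cast_one, one_smul, Marked.jPrime]
  split_ifs
  · exact sum_mem fun p _ => AddSubgroup.subset_closure ⟨_, rfl⟩
  · exact zero_mem _

/-! ### Newton expansion of averages in the place of one leg -/

/-- The average with `x` following `u`, summed over the ways to join `j` further legs with `x`. -/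
def fuseSum (n : ℕ) : ℕ → (X : Marked l) → List X.H → X.H → Finset X.H → TriSpace
  | 0 => fun X u x s => average n X (u ++ [x]) s
  | j + 1 => fun X u x s => ∑ y ∈ s, if h : X.Fusable x y then
      fuseSum n j (X.fuse x y h) (u.map Sum.inl) (Sum.inr true) (fuseRest s y) else 0

/-- Newton's formula: by `averageAt_sub`, iterated `j` times, the `j`-th difference at place `0` is
a multiple of `fuseSum n j`. The bound `m` is free because `p.choose j` vanishes for `j > p`, which
lets sums for different `p` share a range. -/
theorem averageAt_eq_sum (n : ℕ) {p : ℕ} {X : Marked l} {u : List X.H} {x : X.H} {s : Finset X.H}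
    (hs : Splits X.legs (u ++ [x]) s) (hp : p ≤ s.card) {m : ℕ} (hm : p < m) :
    averageAt n X u x s p = ∑ j ∈ Finset.range m,
      ((-1) ^ j * (p.choose j : ℚ) * (s.card.descFactorial j : ℚ)⁻¹) • fuseSum n j X u x s := by
  induction p generalizing X m with
  | zero =>
    obtain ⟨m, rfl⟩ := Nat.exists_eq_add_of_lt hm
    rw [zero_add, Finset.sum_range_succ', Finset.sum_eq_zero]
    · simp [averageAt_zero, fuseSum]
    · simp
  | succ p ih =>
    obtain ⟨m, rfl⟩ : ∃ m', m = m' + 1 := ⟨m - 1, by omega⟩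
    have h1 := averageAt_sub n hs (p := p) (by omega)
    have h2 : (s.card : ℚ)⁻¹ • (∑ y ∈ s, if h : X.Fusable x y then
        averageAt n (X.fuse x y h) (u.map Sum.inl) (Sum.inr true) (fuseRest s y) p else 0) =
        ∑ j ∈ Finset.range m, ((-1) ^ j * (p.choose j : ℚ) *
          (s.card.descFactorial (j + 1) : ℚ)⁻¹) • fuseSum n (j + 1) X u x s := by
      simp only [fuseSum, Finset.smul_sum]
      rw [Finset.sum_comm]
      refine Finset.sum_congr rfl fun y hy => ?_
      have hc := card_fuseRest hy
      split_ifs with hxy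
      · rw [ih (hs.fuse hy hxy) (by omega) (m := m) (by omega), Finset.smul_sum]
        refine Finset.sum_congr rfl fun j _ => ?_
        rw [smul_smul, ← hc, Nat.succ_descFactorial_succ, Nat.cast_mul, mul_inv]
        congr 1
        ring
      · simp
    have h3 := sub_sub_cancel (averageAt n X u x s p) (averageAt n X u x s (p + 1))
    rw [h1] at h3
    rw [← h3, h2, ih hs (by omega) (m := m + 1) (by omega), Finset.sum_range_succ',
      Finset.sum_range_succ', add_sub_right_comm, ← Finset.sum_sub_distrib]
    congr 1
    · refine Finset.sum_congr rfl fun j _ => ?_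
      rw [← sub_smul, Nat.choose_succ_succ, Nat.cast_add]
      congr 1
      ring
    · simp

theorem sum_range_choose_column (m j : ℕ) :
    ∑ p ∈ Finset.range m, p.choose j = m.choose (j + 1) := by
  induction m with
  | zero => simp
  | succ m ih => rw [Finset.sum_range_succ, ih, Nat.choose_succ_succ, add_comm]

/-- Summing the binomials over all places gives `(s.card + 1).choose (j + 1)`, and dividing by
`(s.card + 1) * s.card.descFactorial j` leaves exactly `1 / (j + 1)!`. The coefficients thus do not
depend on the number of legs. -/
theorem average_eq_sum (n : ℕ) {X : Marked l} {u : List X.H} {x : X.H} {s t : Finset X.H}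
    (hs : Splits X.legs (u ++ [x]) s) (ht : ∀ h, h ∈ t ↔ h = x ∨ h ∈ s) :
    average n X u t = ∑ j ∈ Finset.range (s.card + 1),
      ((-1) ^ j * ((j + 1).factorial : ℚ)⁻¹) • fuseSum n j X u x s := by
  rw [average_insert n X u hs.notMem ht,
    Finset.sum_congr rfl fun p hp => averageAt_eq_sum n hs (Nat.lt_succ_iff.1 (Finset.mem_range.1 hp))
      (Finset.mem_range.1 hp), Finset.sum_comm, Finset.smul_sum]
  refine Finset.sum_congr rfl fun j hj => ?_
  rw [← Finset.sum_smul, smul_smul, ← Finset.sum_mul, ← Finset.mul_sum, ← Nat.cast_sum,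
    sum_range_choose_column]
  congr 1
  have h1 : (s.card.descFactorial j : ℚ) ≠ 0 := by
    rw [Nat.cast_ne_zero, Ne, Nat.descFactorial_eq_zero_iff_lt]
    have := Finset.mem_range.1 hj
    omega
  have h2 : ((j + 1).factorial : ℚ) ≠ 0 := Nat.cast_ne_zero.2 (Nat.factorial_ne_zero _)
  have h3 : ((s.card + 1 : ℕ) : ℚ) ≠ 0 := Nat.cast_ne_zero.2 (Nat.succ_ne_zero _)
  have h4 : ((s.card + 1 : ℕ) : ℚ) * s.card.descFactorial j =
      (j + 1).factorial * (s.card + 1).choose (j + 1) := by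
    rw [← Nat.cast_mul, ← Nat.succ_descFactorial_succ, Nat.descFactorial_eq_factorial_mul_choose,
      Nat.cast_mul]
  field_simp
  rw [h4]
  ring

/-- Each join adds one trivalent vertex, that is, three inner half-edges, until the bound of
`wordValue_eq_zero` is exceeded. -/
theorem fuseSum_eq_zero {n j : ℕ} {X : Marked l} {u : List X.H} {x : X.H} {s : Finset X.H}
    (hs : Splits X.legs (u ++ [x]) s) (hX : 6 * n < X.numInner + 3 * j) :
    fuseSum n j X u x s = 0 := by
  induction j generalizing X with
  | zero =>
    change average n X (u ++ [x]) s = 0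
    rw [average, Finset.sum_eq_zero, smul_zero]
    exact fun v hv => wordValue_eq_zero hX (hs.mem_arr hv)
  | succ j ih =>
    rw [fuseSum]
    refine Finset.sum_eq_zero fun y hy => ?_
    split_ifs with hxy
    · have := Marked.numInner_fuse hxy
      exact ih (hs.fuse hy hxy) (by omega)
    · rfl

/-- Each join removes one letter from the rest, so after `j` joins only averages with fewer than `N`
free letters occur; the length of the prefix is unchanged. -/
theorem fuseSum_mem {n k N : ℕ} {S : AddSubgroup TriSpace}
    (h : ∀ (X : Marked l) (u : List X.H) (x : X.H) (s : Finset X.H), u.length = k → s.card < N →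
      Splits X.legs (u ++ [x]) s → average n X (u ++ [x]) s ∈ S) {j : ℕ} {X : Marked l}
    {u : List X.H} {x : X.H} {s : Finset X.H} (hu : u.length = k) (hs : Splits X.legs (u ++ [x]) s)
    (hN : s.card < N + j) : fuseSum n j X u x s ∈ S := by
  induction j generalizing X with
  | zero => exact h X u x s hu hN hs
  | succ j ih =>
    rw [fuseSum]
    refine sum_mem fun y hy => ?_
    split_ifs with hxy
    · have := card_fuseRest hy
      exact ih (by simpa using hu) (hs.fuse hy hxy) (by omega)
    · exact zero_mem _

/-- A double induction, on the length of the prefix and then on the number of free letters. With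
empty prefix the average is `X.jPrime n`. -/
theorem average_mem (n : ℕ) {X : Marked l} {u : List X.H} {s : Finset X.H}
    (hs : Splits X.legs u s) : average n X u s ∈ smoothSubgroup (2 * n + 1) := by
  obtain ⟨k, hk⟩ : ∃ k, u.length = k := ⟨_, rfl⟩
  induction k generalizing X s with
  | zero =>
    obtain rfl := List.length_eq_zero_iff.1 hk
    obtain rfl : s = X.legs := by
      obtain ⟨v, hv, h⟩ := hs
      ext a
      rw [← (mem_arr.1 hv).2, ← (mem_arr.1 h).2]
      rfl
    rw [average_legs]
    exact jPrime_mem n _ X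
  | succ k ih =>
    have key : ∀ (N : ℕ) (X : Marked l) (u : List X.H) (x : X.H) (s : Finset X.H), u.length = k →
        s.card < N → Splits X.legs (u ++ [x]) s →
        average n X (u ++ [x]) s ∈ smoothSubgroup (2 * n + 1) := by
      intro N
      induction N with
      | zero => exact fun X u x s _ h => absurd h (Nat.not_lt_zero _)
      | succ N ihN =>
        intro X u x s hu hN hs
        have hins : Splits X.legs u (insert x s) := by
          obtain ⟨v, hv⟩ := arr_nonempty s
          exact ⟨x :: v, cons_mem_arr hs.notMem hv, by simpa using hs.mem_arr hv⟩
        -- The average with the shorter prefix is known to lie in the subgroup. The term `j = 0` of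
        -- its expansion is the average sought, so it suffices to treat the terms with `j` positive.
        have h1 := ih hins hu
        rw [average_eq_sum n hs fun h => Finset.mem_insert, Finset.sum_range_succ'] at h1
        have h2 : ∑ j ∈ Finset.range s.card, ((-1) ^ (j + 1) * ((j + 1 + 1).factorial : ℚ)⁻¹) •
            fuseSum n (j + 1) X u x s ∈ smoothSubgroup (2 * n + 1) := by
          refine sum_mem fun j _ => ?_
          -- After the shift of the index the coefficient is `±1/(j+2)!`. If `j + 1 ≤ 2n` this
          -- factorial has only primes up to `2n + 1`, and the term has fewer free letters;
          -- otherwise the term has too many trivalent vertices and vanishes.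
          by_cases hj : j + 1 ≤ 2 * n
          · have h3 := factorial_inv_smul_mem (m := 2 * n + 1) (j := j + 1 + 1) (by omega)
              (fuseSum_mem (j := j + 1) ihN hu hs (by omega))
            rcases neg_one_pow_eq_or ℚ (j + 1) with e | e
            · rwa [e, one_mul]
            · rw [e, neg_one_mul, neg_smul]
              exact neg_mem h3
          · rw [fuseSum_eq_zero hs (by omega), smul_zero]
            exact zero_mem _
        have h3 := (AddSubgroup.add_mem_cancel_left _ h2).1 h1
        simpa [fuseSum] using h3
    obtain ⟨u', x, rfl⟩ : ∃ u' x, u = u' ++ [x] :=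
      ⟨u.dropLast, u.getLast (by rintro rfl; simp at hk), (List.dropLast_append_getLast _).symm⟩
    exact key _ X u' x s (by simpa using hk) (Nat.lt_succ_self _) hs

/-- A single value is the average with no free letters. -/
theorem wordValue_mem (n : ℕ) {X : Marked l} {w : List X.H} (hw : w ∈ arr X.legs) :
    wordValue n X w ∈ smoothSubgroup (2 * n + 1) := by
  rw [← average_empty]
  exact average_mem n ⟨[], by rw [arr_empty]; simp, by simpa using hw⟩

end

end ChineseChar

/-! ### The theorem -/

theorem mainTheorem8 (n l : ℕ) :
    ∃ J : ChineseChar.CircleSpace l →ₗ[ℚ] ChineseChar.TriSpace,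
      ChineseChar.IsJPrime n l J ∧
      (∀ J' : ChineseChar.CircleSpace l →ₗ[ℚ] ChineseChar.TriSpace,
        ChineseChar.IsJPrime n l J' → J' = J) ∧
      ∀ D : ChineseChar.Diagram l, ∃ N : ℕ, 0 < N ∧
        (∀ p : ℕ, p.Prime → p ∣ N → p ≤ 2 * n + 1) ∧
        ChineseChar.HasDenominator N (J D.onCircles) := by
  refine ⟨ChineseChar.circleMap n l, ChineseChar.isJPrime_circleMap n l, fun J' h =>
    ChineseChar.isJPrime_unique (ChineseChar.isJPrime_circleMap n l) h, fun D => ?_⟩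
  rw [ChineseChar.circleMap_onCircles]
  exact ChineseChar.wordValue_mem n D.placement.flat_mem_arr
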